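/- Let $\mathcal X_1,\mathcal X_2,\mathcal Y_1,\mathcal Y_2$ be finite alphabets and let $p^*(y_1,y_2|x_1,x_2)$ be the transition law of a discrete memoryless channel with inputs $x_1,x_2$ and outputs $y_1,y_2$. Let $\bar C_{12},\bar C_{21},C_{12},C_{21}\ge 0$. **Codes.** In the compound multiple-access channel with conferencing encoders and decoders (CME channel), encoder $i$ ($i=1,2$) has a message $W_i\in\mathcal W_i$ with $|\mathcal W_i|=\lceil 2^{nR_i}\rceil$, $(W_1,W_2)$ uniform. In $\bar K\ge 0$ conferencing rounds, the encoders simultaneously exchange symbols $\bar V_{1,k}\in\bar{\mathcal V}_{1,k}$ (sent by encoder 1, a function of $W_1,\bar V_{2,1},\dots,\bar V_{2,k-1}$) and $\bar V_{2,k}\in\bar{\mathcal V}_{2,k}$ (sent by encoder 2, a function of $W_2,\bar V_{1,1},\dots,\bar V_{1,k-1}$), where $\sum_k\log_2|\bar{\mathcal V}_{1,k}|\le n\bar C_{12}$ and $\sum_k\log_2|\bar{\mathcal V}_{2,k}|\le n\bar C_{21}$. Then encoder 1 transmits $X_1^n$, a function of $W_1$ and $\bar V_{2,1},\dots,\bar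 V_{2,\bar K}$, and encoder 2 transmits $X_2^n$, a function of $W_2$ and $\bar V_{1,1},\dots,\bar V_{1,\bar K}$. Having received the whole blocks $Y_1^n$ and $Y_2^n$, the decoders confer in the same way in $K\ge0$ rounds, with observations $Y_1^n,Y_2^n$ in place of $W_1,W_2$ and with budgets $\sum_k\log_2|\mathcal V_{1,k}|\le nC_{12}$ and $\sum_k\log_2|\mathcal V_{2,k}|\le nC_{21}$. Finally each decoder estimates the pair $(W_1,W_2)$ from its own output block and the received conferencing symbols. The error probability is the probability that at least one of the two estimates is wrong. A pair $(R_1,R_2)$ with $R_1,R_2\ge0$ is achievable if for every $\varepsilon>0$ and all sufficiently large $n$ there is such a code with error probability at most $\varepsilon$. The capacity region $\mathcal C_{CME}(\bar C_{12},\bar C_{21},C_{12},C_{21})$ is the closure of the set of achievable pairs. **Outer region.** Let $\mathcal C_{CM-out}(C_{12},C_{21})$ be the union, over all random variables $U$ with finite alphabet and all joint laws of the form $p(u)p(x_1|u)p(x_2|u)p^*(y_1,y_2|x_1,x_2)$, of the sets of triples $(R_0,R_1,R_2)$ with $R_0,R_1,R_2\ge 0$ and $$R_1\le\min\{I(X_1;Y_1|X_2U)+C_{21},\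 I(X_1;Y_2|X_2U)+C_{12},\ I(X_1;Y_1Y_2|X_2U)\},$$ $$R_2\le\min\{I(X_2;Y_1|X_1U)+C_{21},\ I(X_2;Y_2|X_1U)+C_{12},\ I(X_2;Y_1Y_2|X_1U)\},$$ $$R_1+R_2\le\min\{I(X_1X_2;Y_1|U)+C_{21},\ I(X_1X_2;Y_2|U)+C_{12},\ I(X_1X_2;Y_1Y_2|U)\},$$ $$R_0+R_1+R_2\le\min\{I(X_1X_2;Y_1)+C_{21},\ I(X_1X_2;Y_2)+C_{12},\ I(X_1X_2;Y_1Y_2)\},$$ all information quantities being in bits. Let $\mathcal C_{CME-out}(\bar C_{12},\bar C_{21},C_{12},C_{21})$ be the set of pairs $(R_1,R_2)$ with $R_1,R_2\ge0$ such that $$(R_{12}+R_{21},\ R_1-R_{12},\ R_2-R_{21})\in\mathcal C_{CM-out}(C_{12},C_{21}),\qquad R_{12}=\min\{R_1,\bar C_{12}\},\quad R_{21}=\min\{R_2,\bar C_{21}\}.$$ **Claim.** $$\mathcal C_{CME}(\bar C_{12},\bar C_{21},C_{12},C_{21})\subseteq\mathcal C_{CME-out}(\bar C_{12},\bar C_{21},C_{12},C_{21}).$$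 Moreover, with conferencing at the encoders only, equality holds: $$\mathcal C_{CME}(\bar C_{12},\bar C_{21},0,0)=\mathcal C_{CME-out}(\bar C_{12},\bar C_{21},0,0).$$ -/

import Mathlib

/-! Finite-alphabet information measures, two-party conferencing protocols, codes for the compound
multiple-access channel with conferencing encoders and decoders, and the associated rate regions.
A probability mass function on a finite set `α` is an element of `stdSimplex ℝ α`. -/

namespace CompoundMAC

section Information

variable {Ω α β γ : Type*} [Fintype Ω] [Fintype α] [Fintype β] [Fintype γ]

open scoped Classical in
/-- The law on `α` of the random variable `A : Ω → α`, where `Ω` has probability mass function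
`p`. -/
noncomputable def law (p : Ω → ℝ) (A : Ω → α) (a : α) : ℝ :=
  ∑ ω, if A ω = a then p ω else 0

/-- Shannon entropy `H(A)` in bits of the random variable `A`. -/
noncomputable def entropy (p : Ω → ℝ) (A : Ω → α) : ℝ :=
  (∑ a, Real.negMulLog (law p A a)) / Real.log 2

/-- Conditional entropy `H(A | C) = H(A, C) - H(C)` in bits. -/
noncomputable def condEntropy (p : Ω → ℝ) (A : Ω → α) (C : Ω → γ) : ℝ :=
  entropy p (fun ω => (A ω, C ω)) - entropy p C

/-- Mutual information `I(A; B) = H(A) - H(A | B)` in bits. -/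
noncomputable def mutualInfo (p : Ω → ℝ) (A : Ω → α) (B : Ω → β) : ℝ :=
  entropy p A - condEntropy p A B

/-- Conditional mutual information `I(A; B | C) = H(A | C) - H(A | B, C)` in bits. -/
noncomputable def condMutualInfo (p : Ω → ℝ) (A : Ω → α) (B : Ω → β) (C : Ω → γ) : ℝ :=
  condEntropy p A C - condEntropy p A (fun ω => (B ω, C ω))

end Information

/-- A deterministic conferencing protocol between a party 1 with observation in `S₁` and a party 2
with observation in `S₂`. In each round both parties simultaneously send a symbol, computed from
the own observation and the symbols received in the preceding rounds. The alphabets of round `k`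
have `card₁ k` and `card₂ k` elements. -/
structure Conference (S₁ S₂ : Type*) where
  /-- number of rounds -/
  rounds : ℕ
  /-- size of the alphabet of the symbol sent by party 1 in each round -/
  card₁ : Fin rounds → ℕ
  /-- size of the alphabet of the symbol sent by party 2 in each round -/
  card₂ : Fin rounds → ℕ
  /-- conferencing functions of party 1 -/
  send₁ : (k : Fin rounds) → S₁ → ((j : Fin rounds) → j < k → Fin (card₂ j)) → Fin (card₁ k)
  /-- conferencing functions of party 2 -/
  send₂ : (k : Fin rounds) → S₂ → ((j : Fin rounds) → j < k → Fin (card₁ j)) → Fin (card₂ k)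

namespace Conference

variable {S₁ S₂ : Type*} (c : Conference S₁ S₂)

/-- The pair of symbols exchanged in round `k` when the observations are `s₁` and `s₂`. -/
def exchange (s₁ : S₁) (s₂ : S₂) (k : Fin c.rounds) : Fin (c.card₁ k) × Fin (c.card₂ k) :=
  (c.send₁ k s₁ (fun j _ => (exchange s₁ s₂ j).2), c.send₂ k s₂ (fun j _ => (exchange s₁ s₂ j).1))
termination_by k

/-- All symbols sent by party 1. -/
def sent₁ (s₁ : S₁) (s₂ : S₂) (k : Fin c.rounds) : Fin (c.card₁ k) := (c.exchange s₁ s₂ k).1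

/-- All symbols sent by party 2. -/
def sent₂ (s₁ : S₁) (s₂ : S₂) (k : Fin c.rounds) : Fin (c.card₂ k) := (c.exchange s₁ s₂ k).2

/-- The total number of bits sent by party 1 is at most `n * C₁₂`, and the total number of bits
sent by party 2 is at most `n * C₂₁`. -/
def WithinBudget (n : ℕ) (C₁₂ C₂₁ : ℝ) : Prop :=
  ∑ k, Real.logb 2 (c.card₁ k) ≤ n * C₁₂ ∧ ∑ k, Real.logb 2 (c.card₂ k) ≤ n * C₂₁

theorem sent₁_eq (s₁ : S₁) (s₂ : S₂) (k : Fin c.rounds) :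
    c.sent₁ s₁ s₂ k = c.send₁ k s₁ (fun j _ => c.sent₂ s₁ s₂ j) := by
  unfold sent₁ sent₂
  rw [exchange]

theorem sent₂_eq (s₁ : S₁) (s₂ : S₂) (k : Fin c.rounds) :
    c.sent₂ s₁ s₂ k = c.send₂ k s₂ (fun j _ => c.sent₁ s₁ s₂ j) := by
  unfold sent₁ sent₂
  rw [exchange]

end Conference

/-- A code of block length `n` with `M₁` and `M₂` messages. The encoders confer about the two
messages before encoding, the decoders confer about the two output blocks before decoding, and
each decoder estimates both messages. -/
structure Code (X₁ X₂ Y₁ Y₂ : Type*) (M₁ M₂ n : ℕ) where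
  /-- conference between the encoders -/
  encConf : Conference (Fin M₁) (Fin M₂)
  /-- encoding function of encoder 1 -/
  enc₁ : Fin M₁ → ((k : Fin encConf.rounds) → Fin (encConf.card₂ k)) → (Fin n → X₁)
  /-- encoding function of encoder 2 -/
  enc₂ : Fin M₂ → ((k : Fin encConf.rounds) → Fin (encConf.card₁ k)) → (Fin n → X₂)
  /-- conference between the decoders -/
  decConf : Conference (Fin n → Y₁) (Fin n → Y₂)
  /-- decoding function of decoder 1 -/
  dec₁ : (Fin n → Y₁) → ((k : Fin decConf.rounds) → Fin (decConf.card₂ k)) → Fin M₁ × Fin M₂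
  /-- decoding function of decoder 2 -/
  dec₂ : (Fin n → Y₂) → ((k : Fin decConf.rounds) → Fin (decConf.card₁ k)) → Fin M₁ × Fin M₂

namespace Code

variable {X₁ X₂ Y₁ Y₂ : Type*} {M₁ M₂ n : ℕ} (c : Code X₁ X₂ Y₁ Y₂ M₁ M₂ n)

/-- Codeword of encoder 1, after the conference, for the message pair `(w₁, w₂)`. -/
def codeword₁ (w₁ : Fin M₁) (w₂ : Fin M₂) : Fin n → X₁ := c.enc₁ w₁ (c.encConf.sent₂ w₁ w₂)

/-- Codeword of encoder 2, after the conference, for the message pair `(w₁, w₂)`. -/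
def codeword₂ (w₁ : Fin M₁) (w₂ : Fin M₂) : Fin n → X₂ := c.enc₂ w₂ (c.encConf.sent₁ w₁ w₂)

/-- Estimate of the message pair at decoder 1, after the conference. -/
def estimate₁ (y₁ : Fin n → Y₁) (y₂ : Fin n → Y₂) : Fin M₁ × Fin M₂ :=
  c.dec₁ y₁ (c.decConf.sent₂ y₁ y₂)

/-- Estimate of the message pair at decoder 2, after the conference. -/
def estimate₂ (y₁ : Fin n → Y₁) (y₂ : Fin n → Y₂) : Fin M₁ × Fin M₂ :=
  c.dec₂ y₂ (c.decConf.sent₁ y₁ y₂)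

/-- Probability, averaged over uniform message pairs, that at least one of the decoders errs, when
the code is used on the memoryless channel with transition probabilities `W`. -/
noncomputable def errorProb [Fintype Y₁] [Fintype Y₂] (W : X₁ → X₂ → stdSimplex ℝ (Y₁ × Y₂)) : ℝ :=
  (1 / ((M₁ : ℝ) * M₂)) * ∑ w₁ : Fin M₁, ∑ w₂ : Fin M₂,
    ∑ y₁ : Fin n → Y₁, ∑ y₂ : Fin n → Y₂,
      if c.estimate₁ y₁ y₂ ≠ (w₁, w₂) ∨ c.estimate₂ y₁ y₂ ≠ (w₁, w₂) then
        ∏ j, (W (c.codeword₁ w₁ w₂ j) (c.codeword₂ w₁ w₂ j) : Y₁ × Y₂ → ℝ) (y₁ j, y₂ j)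
      else 0

end Code

section Regions

variable {X₁ X₂ Y₁ Y₂ : Type*} [Fintype X₁] [Fintype X₂] [Fintype Y₁] [Fintype Y₂]

/-- The rate pair `(R₁, R₂)` is achievable with encoder link capacities `B₁₂`, `B₂₁` and decoder
link capacities `C₁₂`, `C₂₁`. The numbers of conferencing rounds are arbitrary. -/
def Achievable (W : X₁ → X₂ → stdSimplex ℝ (Y₁ × Y₂)) (B₁₂ B₂₁ C₁₂ C₂₁ : ℝ) (R₁ R₂ : ℝ) : Prop :=
  0 ≤ R₁ ∧ 0 ≤ R₂ ∧
    ∀ ε : ℝ, 0 < ε → ∃ N : ℕ, ∀ n : ℕ, N ≤ n →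
      ∃ c : Code X₁ X₂ Y₁ Y₂ ⌈(2 : ℝ) ^ ((n : ℝ) * R₁)⌉₊ ⌈(2 : ℝ) ^ ((n : ℝ) * R₂)⌉₊ n,
        c.encConf.WithinBudget n B₁₂ B₂₁ ∧ c.decConf.WithinBudget n C₁₂ C₂₁ ∧ c.errorProb W ≤ ε

/-- The capacity region of the compound multiple-access channel with conferencing encoders and
decoders. -/
def capacityRegion (W : X₁ → X₂ → stdSimplex ℝ (Y₁ × Y₂)) (B₁₂ B₂₁ C₁₂ C₂₁ : ℝ) : Set (ℝ × ℝ) :=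
  closure {R | Achievable W B₁₂ B₂₁ C₁₂ C₂₁ R.1 R.2}

/-- The joint probability mass function `p(u) p(x₁|u) p(x₂|u) W(y₁, y₂|x₁, x₂)`. -/
def jointLaw {U : Type*} [Fintype U] (W : X₁ → X₂ → stdSimplex ℝ (Y₁ × Y₂))
    (pU : stdSimplex ℝ U) (p₁ : U → stdSimplex ℝ X₁) (p₂ : U → stdSimplex ℝ X₂) :
    U × X₁ × X₂ × Y₁ × Y₂ → ℝ :=
  fun ω => (pU : U → ℝ) ω.1 * (p₁ ω.1 : X₁ → ℝ) ω.2.1 * (p₂ ω.1 : X₂ → ℝ) ω.2.2.1 *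
    (W ω.2.1 ω.2.2.1 : Y₁ × Y₂ → ℝ) (ω.2.2.2.1, ω.2.2.2.2)

/-- The four multiple-access rate constraints for a receiver that observes `Y`, each relaxed by the
amount `C`, where the random variables `U, X₁, X₂, Y₁, Y₂` have joint law `p`. -/
def MACBounds {U Z : Type*} [Fintype U] [Fintype Z] (p : U × X₁ × X₂ × Y₁ × Y₂ → ℝ)
    (Y : U × X₁ × X₂ × Y₁ × Y₂ → Z) (C : ℝ) (R₀ R₁ R₂ : ℝ) : Prop :=
  R₁ ≤ condMutualInfo p (fun ω => ω.2.1) Y (fun ω => (ω.2.2.1, ω.1)) + C ∧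
  R₂ ≤ condMutualInfo p (fun ω => ω.2.2.1) Y (fun ω => (ω.2.1, ω.1)) + C ∧
  R₁ + R₂ ≤ condMutualInfo p (fun ω => (ω.2.1, ω.2.2.1)) Y (fun ω => ω.1) + C ∧
  R₀ + R₁ + R₂ ≤ mutualInfo p (fun ω => (ω.2.1, ω.2.2.1)) Y + C

/-- The region of rate triples `(R₀, R₁, R₂)` that bounds the capacity region of the compound
multiple-access channel with common message and decoder link capacities `C₁₂`, `C₂₁`: the union,
over auxiliary variables `U` with a finite alphabet and over all laws
`p(u) p(x₁|u) p(x₂|u) W(y₁, y₂|x₁, x₂)`, of the intersection of the constraints for receiver 1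
(assisted by the link from 2 to 1), for receiver 2 (assisted by the link from 1 to 2), and for a
receiver that observes both outputs. -/
def cmOuterRegion (W : X₁ → X₂ → stdSimplex ℝ (Y₁ × Y₂)) (C₁₂ C₂₁ : ℝ) : Set (ℝ × ℝ × ℝ) :=
  {R | ∃ (m : ℕ) (pU : stdSimplex ℝ (Fin m)) (p₁ : Fin m → stdSimplex ℝ X₁)
      (p₂ : Fin m → stdSimplex ℝ X₂),
    (0 ≤ R.1 ∧ 0 ≤ R.2.1 ∧ 0 ≤ R.2.2) ∧
    MACBounds (jointLaw W pU p₁ p₂) (fun ω => ω.2.2.2.1) C₂₁ R.1 R.2.1 R.2.2 ∧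
    MACBounds (jointLaw W pU p₁ p₂) (fun ω => ω.2.2.2.2) C₁₂ R.1 R.2.1 R.2.2 ∧
    MACBounds (jointLaw W pU p₁ p₂) (fun ω => (ω.2.2.2.1, ω.2.2.2.2)) 0 R.1 R.2.1 R.2.2}

/-- The outer region for conferencing encoders and decoders. -/
def cmeOuterRegion (W : X₁ → X₂ → stdSimplex ℝ (Y₁ × Y₂)) (B₁₂ B₂₁ C₁₂ C₂₁ : ℝ) : Set (ℝ × ℝ) :=
  {R | 0 ≤ R.1 ∧ 0 ≤ R.2 ∧
    (min R.1 B₁₂ + min R.2 B₂₁, R.1 - min R.1 B₁₂, R.2 - min R.2 B₂₁) ∈ cmOuterRegion W C₁₂ C₂₁}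

end Regions

end CompoundMAC

/-! Converse. The transcript `V` of the encoders' conference acts as a common message. Its level
sets are rectangles (`Conference.exchange_rectangle`), so the uniform messages remain independent
given `V`; each codeword is a function of its own message and `V`, hence the letters sent at one
time are conditionally independent given `V` (`exists_splitInputs`). With `U` the pair of `V` and a
uniform time index, Fano's inequality and single-letterisation (`entropy_sub_le_sum_letter`) yield
the four bounds. The conferencing symbols that a decoder receives relax them by at most their
entropy, which the link budget controls; a receiver of both outputs replays the decoders' conference
and needs no link. The conference budget enters through one observation: given `W₂`, the transcript
is determined by the symbols of encoder 1. It therefore reveals at most `n B₁₂` bits about `W₁`, and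
the private rate `R₁ - min R₁ B₁₂` survives (`Code.exists_rateBounds`). A code satisfies the bounds
only up to a slack, with an auxiliary alphabet that depends on the code. The constraints see the
auxiliary variable only through the law of the inputs and nine averages, so Carathéodory's theorem
bounds the alphabet, and compactness removes the slack (`exists_rateBounds_of_slack`). The same
slack absorbs the closure in the definition of the capacity region.

Achievability without decoder links. Encoder `i` announces a part of its message, of rate `min R_i
B`, in a single round. The announced parts form a common message and the rest stays private: this is
the multiple-access channel with common message, solved by superposition coding. A random codebook
is decoded by likelihood-ratio thresholds. The sent codewords pass because the mean information
densities are the rate bounds (`eventually_thresholdTest_fails_le`), and a wrong tuple passes with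
probability at most the inverse threshold (`expected_error_le`). One random codebook serves both
receivers, since their expected errors add. Rates are scaled by `l < 1` to create room, and `l → 1`
is absorbed by the closure. -/

namespace CompoundMAC

/-! ### Entropy inequalities: Gibbs, submodularity, Fano. -/

section Toolkit

variable {Ω α β γ δ : Type*} [Fintype Ω]

/-- Shannon entropy in bits of a probability mass function. -/
noncomputable def pmfEntropy [Fintype α] (q : α → ℝ) : ℝ := (∑ a, Real.negMulLog (q a)) / Real.log 2

theorem entropy_eq_pmfEntropy [Fintype α] (p : Ω → ℝ) (A : Ω → α) :
    entropy p A = pmfEntropy (law p A) := rfl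

theorem law_nonneg {p : Ω → ℝ} (hp : ∀ ω, 0 ≤ p ω) (A : Ω → α) (a : α) : 0 ≤ law p A a := by
  unfold law
  exact Finset.sum_nonneg fun ω _ => by split_ifs <;> simp [hp]

/-- Expectations of functions of a random variable can be computed from its law. -/
theorem sum_law_mul [Fintype α] (p : Ω → ℝ) (A : Ω → α) (F : α → ℝ) :
    ∑ a, law p A a * F a = ∑ ω, p ω * F (A ω) := by
  classical
  unfold law
  simp_rw [Finset.sum_mul]
  rw [Finset.sum_comm]
  refine Finset.sum_congr rfl fun ω _ => ?_
  simp [ite_mul]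

theorem sum_law [Fintype α] (p : Ω → ℝ) (A : Ω → α) : ∑ a, law p A a = ∑ ω, p ω := by
  simpa using sum_law_mul p A (fun _ => 1)

theorem law_mem [Fintype α] {p : Ω → ℝ} (hp : p ∈ stdSimplex ℝ Ω) (A : Ω → α) :
    law p A ∈ stdSimplex ℝ α :=
  ⟨law_nonneg hp.1 A, by rw [sum_law, hp.2]⟩

theorem le_law {p : Ω → ℝ} (hp : ∀ ω, 0 ≤ p ω) (A : Ω → α) (ω : Ω) : p ω ≤ law p A (A ω) := by
  classical
  unfold law
  have := Finset.single_le_sum (f := fun ω' => if A ω' = A ω then p ω' else 0)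
    (fun ω' _ => by split_ifs <;> simp [hp]) (Finset.mem_univ ω)
  simpa using this

theorem law_pos {p : Ω → ℝ} (hp : ∀ ω, 0 ≤ p ω) (A : Ω → α) {ω : Ω} (h : 0 < p ω) :
    0 < law p A (A ω) :=
  h.trans_le (le_law hp A ω)

open scoped Classical in
theorem law_comp [Fintype α] (p : Ω → ℝ) (A : Ω → α) (f : α → β) (b : β) :
    law p (fun ω => f (A ω)) b = ∑ a, if f a = b then law p A a else 0 := by
  have := sum_law_mul p A (fun a => if f a = b then 1 else 0)
  simp only [mul_ite, mul_one, mul_zero] at this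
  rw [this]
  unfold law
  exact Finset.sum_congr rfl fun _ _ => by congr

theorem law_law [Fintype α] (p : Ω → ℝ) (A : Ω → α) (f : α → β) :
    law (law p A) f = law p (fun ω => f (A ω)) := by
  classical
  ext b
  rw [law_comp p A f]
  rfl

theorem entropy_law [Fintype α] [Fintype β] (p : Ω → ℝ) (A : Ω → α) (f : α → β) :
    entropy (law p A) f = entropy p (fun ω => f (A ω)) := by
  rw [entropy_eq_pmfEntropy, entropy_eq_pmfEntropy, law_law]

theorem pmfEntropy_eq_sum_logb [Fintype α] (q : α → ℝ) :
    pmfEntropy q = -∑ a, q a * Real.logb 2 (q a) := by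
  unfold pmfEntropy
  rw [Finset.sum_div, ← Finset.sum_neg_distrib]
  refine Finset.sum_congr rfl fun a _ => ?_
  rw [Real.negMulLog, Real.logb]
  ring

/-- Entropy as an expectation over `Ω`: entropies of different variables become comparable term by
term, and points of mass zero drop out. -/
theorem entropy_eq_sum_logb [Fintype α] (p : Ω → ℝ) (A : Ω → α) :
    entropy p A = -∑ ω, p ω * Real.logb 2 (law p A (A ω)) := by
  rw [entropy_eq_pmfEntropy, pmfEntropy_eq_sum_logb,
    sum_law_mul p A (fun a => Real.logb 2 (law p A a))]

theorem law_le_law_comp {p : Ω → ℝ} (hp : ∀ ω, 0 ≤ p ω) (A : Ω → α) (f : α → β) (ω : Ω) :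
    law p A (A ω) ≤ law p (fun ω => f (A ω)) (f (A ω)) := by
  classical
  unfold law
  refine Finset.sum_le_sum fun ω' _ => ?_
  by_cases h : A ω' = A ω
  · simp [h]
  · rw [if_neg h]
    split_ifs <;> simp [hp]

/-- Merging values enlarges the probability of the value actually taken, hence lowers the surprise
at each point of positive mass. -/
theorem entropy_comp_le [Fintype α] [Fintype β] {p : Ω → ℝ} (hp : ∀ ω, 0 ≤ p ω) (A : Ω → α)
    (f : α → β) :
    entropy p (fun ω => f (A ω)) ≤ entropy p A := by
  rw [entropy_eq_sum_logb, entropy_eq_sum_logb, neg_le_neg_iff]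
  refine Finset.sum_le_sum fun ω _ => ?_
  rcases (hp ω).eq_or_lt with h | h
  · simp [← h]
  · exact mul_le_mul_of_nonneg_left (Real.logb_le_logb_of_le one_lt_two (law_pos hp A h)
      (law_le_law_comp hp A f ω)) h.le

/-- A random variable that is a function of another one has smaller entropy. -/
theorem entropy_le_of_function [Fintype α] [Fintype β] {p : Ω → ℝ} (hp : ∀ ω, 0 ≤ p ω) {A : Ω → α}
    {B : Ω → β} (f : α → β) (h : ∀ ω, B ω = f (A ω)) : entropy p B ≤ entropy p A := by
  rw [funext h]
  exact entropy_comp_le hp A f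

/-- Random variables that are functions of each other have the same entropy. -/
theorem entropy_congr [Fintype α] [Fintype β] {p : Ω → ℝ} (hp : ∀ ω, 0 ≤ p ω) {A : Ω → α}
    {B : Ω → β} (f : α → β) (g : β → α) (h : ∀ ω, B ω = f (A ω)) (h' : ∀ ω, A ω = g (B ω)) :
    entropy p A = entropy p B :=
  le_antisymm (entropy_le_of_function hp g h') (entropy_le_of_function hp f h)

/-- **Gibbs' inequality** for random variables. -/
theorem entropy_le_cross [Fintype α] {p : Ω → ℝ} (hp : p ∈ stdSimplex ℝ Ω) (A : Ω → α) (q : α → ℝ)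
    (hq : ∀ a, 0 ≤ q a) (hq1 : ∑ a, q a ≤ 1) (hpos : ∀ ω, 0 < p ω → 0 < q (A ω)) :
    entropy p A ≤ -∑ ω, p ω * Real.logb 2 (q (A ω)) := by
  have hlog : 0 < Real.log 2 := Real.log_pos one_lt_two
  have key : ∑ ω, p ω * (Real.logb 2 (q (A ω)) - Real.logb 2 (law p A (A ω))) ≤ 0 := by
    -- This is `log x ≤ x - 1` at the likelihood ratio of `q` and the law of `A`.
    have h1 : ∀ ω, p ω * (Real.logb 2 (q (A ω)) - Real.logb 2 (law p A (A ω))) ≤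
        p ω * (q (A ω) / law p A (A ω) - 1) / Real.log 2 := by
      intro ω
      rcases (hp.1 ω).eq_or_lt with h | h
      · simp [← h]
      · have hl := law_pos hp.1 A h
        have hq' := hpos ω h
        rw [mul_div_assoc]
        refine mul_le_mul_of_nonneg_left ?_ h.le
        rw [Real.logb, Real.logb, ← sub_div, ← Real.log_div hq'.ne' hl.ne']
        exact div_le_div_of_nonneg_right (Real.log_le_sub_one_of_pos (div_pos hq' hl)) hlog.le
    refine (Finset.sum_le_sum fun ω _ => h1 ω).trans ?_
    rw [← Finset.sum_div]
    refine div_nonpos_of_nonpos_of_nonneg ?_ hlog.le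
    have h2 := sum_law_mul p A (fun a => q a / law p A a - 1)
    rw [← h2]
    -- Values of probability zero may carry mass under `q`, so only an inequality holds; it suffices
    -- because `q` has total mass at most one.
    have h3 : ∀ a, law p A a * (q a / law p A a - 1) ≤ q a - law p A a := by
      intro a
      rcases (law_nonneg hp.1 A a).eq_or_lt with h | h
      · rw [← h]; simp [hq a]
      · rw [mul_sub, mul_div_cancel₀ _ h.ne', mul_one]
    refine (Finset.sum_le_sum fun a _ => h3 a).trans ?_
    rw [Finset.sum_sub_distrib, sum_law, hp.2]
    linarith
  rw [entropy_eq_sum_logb]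
  simp_rw [mul_sub] at key
  rw [Finset.sum_sub_distrib] at key
  linarith

theorem entropy_le_logb_card [Fintype α] {p : Ω → ℝ} (hp : p ∈ stdSimplex ℝ Ω) (A : Ω → α) :
    entropy p A ≤ Real.logb 2 (Fintype.card α) := by
  have hΩ : Nonempty Ω := by
    by_contra h
    rw [not_nonempty_iff] at h
    have := hp.2
    simp at this
  have : Nonempty α := hΩ.map A
  have hc : (0 : ℝ) < Fintype.card α := by exact_mod_cast Fintype.card_pos
  have := entropy_le_cross hp A (fun _ => (Fintype.card α : ℝ)⁻¹) (fun _ => by positivity)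
    (by simp [hc.ne']) (fun _ _ => by positivity)
  refine this.trans ?_
  rw [← Finset.sum_mul, hp.2, Real.logb_inv]
  simp

theorem sum_law_prod_left [Fintype α] (p : Ω → ℝ) (A : Ω → α) (B : Ω → β) (b : β) :
    ∑ a, law p (fun ω => (A ω, B ω)) (a, b) = law p B b := by
  classical
  unfold law
  rw [Finset.sum_comm]
  refine Finset.sum_congr rfl fun ω _ => ?_
  by_cases h : B ω = b <;> simp [h, Prod.ext_iff]

/-- **Submodularity** of entropy. -/
theorem entropy_submodular [Fintype α] [Fintype β] [Fintype γ] {p : Ω → ℝ}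
    (hp : p ∈ stdSimplex ℝ Ω) (A : Ω → α) (B : Ω → β) (C : Ω → γ) :
    entropy p (fun ω => (A ω, B ω, C ω)) + entropy p C ≤
      entropy p (fun ω => (A ω, C ω)) + entropy p (fun ω => (B ω, C ω)) := by
  have h0 := hp.1
  -- Gibbs against the law `p(a,c) p(b,c) / p(c)`, which makes `A` and `B` conditionally independent
  -- given `C`.
  have h := entropy_le_cross hp (fun ω => (A ω, B ω, C ω))
    (fun x => law p (fun ω => (A ω, C ω)) (x.1, x.2.2) * law p (fun ω => (B ω, C ω)) x.2
      / law p C x.2.2)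
    (fun x => div_nonneg (mul_nonneg (law_nonneg h0 _ _) (law_nonneg h0 _ _)) (law_nonneg h0 _ _))
    (by
      rw [Fintype.sum_prod_type_right]
      simp only [← Finset.sum_div, ← Finset.sum_mul, sum_law_prod_left]
      have : ∀ x : β × γ, law p C x.2 * law p (fun ω => (B ω, C ω)) x / law p C x.2 ≤
          law p (fun ω => (B ω, C ω)) x := by
        intro x
        rcases (law_nonneg h0 C x.2).eq_or_lt with h | h
        · rw [← h]; simp [law_nonneg h0]
        · rw [mul_div_cancel_left₀ _ h.ne']
      refine (Finset.sum_le_sum fun x _ => this x).trans ?_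
      rw [sum_law, hp.2])
    (fun ω hω => div_pos (mul_pos (law_pos h0 (fun ω => (A ω, C ω)) hω)
      (law_pos h0 (fun ω => (B ω, C ω)) hω)) (law_pos h0 C hω))
  have e : ∀ ω, p ω * Real.logb 2 (law p (fun ω => (A ω, C ω)) (A ω, C ω) *
      law p (fun ω => (B ω, C ω)) (B ω, C ω) / law p C (C ω)) =
      p ω * Real.logb 2 (law p (fun ω => (A ω, C ω)) (A ω, C ω)) +
      p ω * Real.logb 2 (law p (fun ω => (B ω, C ω)) (B ω, C ω)) -
      p ω * Real.logb 2 (law p C (C ω)) := by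
    intro ω
    rcases (h0 ω).eq_or_lt with h | h
    · simp [← h]
    · rw [Real.logb_div, Real.logb_mul]
      · ring
      · exact (law_pos h0 (fun ω => (A ω, C ω)) h).ne'
      · exact (law_pos h0 (fun ω => (B ω, C ω)) h).ne'
      · exact (mul_pos (law_pos h0 (fun ω => (A ω, C ω)) h)
          (law_pos h0 (fun ω => (B ω, C ω)) h)).ne'
      · exact (law_pos h0 C h).ne'
  simp only [e, Finset.sum_add_distrib, Finset.sum_sub_distrib] at h
  rw [entropy_eq_sum_logb p C, entropy_eq_sum_logb p (fun ω => (A ω, C ω)),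
    entropy_eq_sum_logb p (fun ω => (B ω, C ω))]
  linarith

theorem entropy_unit [Fintype β] {p : Ω → ℝ} (hp : p ∈ stdSimplex ℝ Ω) (u : β) :
    entropy p (fun _ => u) = 0 := by
  rw [entropy_eq_sum_logb]
  have : law p (fun _ : Ω => u) u = 1 := by
    unfold law
    simp [hp.2]
  simp [this]

theorem entropy_prod_le [Fintype α] [Fintype β] {p : Ω → ℝ} (hp : p ∈ stdSimplex ℝ Ω)
    (A : Ω → α) (B : Ω → β) :
    entropy p (fun ω => (A ω, B ω)) ≤ entropy p A + entropy p B := by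
  have h := entropy_submodular hp A B (fun _ => ())
  rw [entropy_unit hp, add_zero] at h
  rw [entropy_congr hp.1 (A := fun ω => (A ω, B ω)) (B := fun ω => (A ω, B ω, ()))
      (fun x => (x.1, x.2, ())) (fun x => (x.1, x.2.1)) (fun _ => rfl) (fun _ => rfl),
    entropy_congr hp.1 (A := A) (B := fun ω => (A ω, ()))
      (fun x => (x, ())) (fun x => x.1) (fun _ => rfl) (fun _ => rfl),
    entropy_congr hp.1 (A := B) (B := fun ω => (B ω, ()))
      (fun x => (x, ())) (fun x => x.1) (fun _ => rfl) (fun _ => rfl)]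
  exact h

/-- **Fano's inequality**. -/
theorem fano [Fintype α] [Fintype δ] {p : Ω → ℝ} (hp : p ∈ stdSimplex ℝ Ω) (A : Ω → α)
    (D : Ω → δ) (φ : δ → α) [Nonempty α] [DecidableEq α] :
    entropy p (fun ω => (A ω, D ω)) ≤ entropy p D + 1 +
      (∑ ω, if φ (D ω) ≠ A ω then p ω else 0) * Real.logb 2 (Fintype.card α) := by
  have hc : (0 : ℝ) < Fintype.card α := by exact_mod_cast Fintype.card_pos
  have h0 := hp.1
  -- Reference conditional law: mass one half on the decoded value, and one half spread uniformly
  -- over the alphabet. A correct guess costs one bit, a wrong one costs `log |α|` bits more.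
  set k : δ → α → ℝ := fun d a =>
    if φ d ≠ a then (2 * Fintype.card α : ℝ)⁻¹ else (2 : ℝ)⁻¹ with hk
  have hkpos : ∀ d a, 0 < k d a := fun d a => by
    simp only [hk]; split_ifs <;> positivity
  have hksum : ∀ d, ∑ a, k d a ≤ 1 := by
    intro d
    have : ∀ a, k d a ≤ (2 * Fintype.card α : ℝ)⁻¹ + if φ d = a then (2 : ℝ)⁻¹ else 0 := by
      intro a
      simp only [hk]
      by_cases h : φ d = a
      · simp [h]
      · simp [h]
    refine (Finset.sum_le_sum fun a _ => this a).trans ?_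
    rw [Finset.sum_add_distrib]
    simp only [Finset.sum_const, Finset.card_univ, nsmul_eq_mul, Finset.sum_ite_eq,
      Finset.mem_univ, if_true]
    rw [mul_inv]
    field_simp
    norm_num
  have h := entropy_le_cross hp (fun ω => (A ω, D ω)) (fun x => law p D x.2 * k x.2 x.1)
    (fun x => mul_nonneg (law_nonneg h0 _ _) (hkpos _ _).le)
    (by
      rw [Fintype.sum_prod_type_right]
      simp only [← Finset.mul_sum]
      refine (Finset.sum_le_sum fun d _ =>
        mul_le_mul_of_nonneg_left (hksum d) (law_nonneg h0 D d)).trans ?_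
      simp [sum_law, hp.2])
    (fun ω hω => mul_pos (law_pos h0 D hω) (hkpos _ _))
  refine h.trans ?_
  rw [entropy_eq_sum_logb p D]
  have e : ∀ ω, -(p ω * Real.logb 2 (law p D (D ω) * k (D ω) (A ω))) =
      -(p ω * Real.logb 2 (law p D (D ω))) + p ω +
      (if φ (D ω) ≠ A ω then p ω else 0) * Real.logb 2 (Fintype.card α) := by
    intro ω
    rcases (h0 ω).eq_or_lt with h | h
    · simp [← h]
    · rw [Real.logb_mul (law_pos h0 D h).ne' (hkpos _ _).ne']
      have h2 : Real.logb 2 (2 : ℝ) = 1 := Real.logb_self_eq_one one_lt_two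
      by_cases hφ : φ (D ω) ≠ A ω
      · simp only [hk, if_pos hφ]
        rw [Real.logb_inv, Real.logb_mul two_ne_zero hc.ne', h2]
        ring
      · simp only [hk, if_neg hφ]
        rw [Real.logb_inv, h2]
        ring
  rw [← Finset.sum_neg_distrib, Finset.sum_congr rfl fun ω _ => e ω, Finset.sum_add_distrib,
    Finset.sum_add_distrib, hp.2, Finset.sum_neg_distrib, Finset.sum_mul]

/-- The joint entropy of the input and the output of a channel. -/
theorem entropy_channel [Fintype α] [Fintype β] {p : Ω → ℝ} (S : Ω → α) (Z : Ω → β) (k : α → β → ℝ)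
    (hk : ∀ s, 0 < law p S s → ∑ z, k s z = 1) (h0 : ∀ ω, 0 ≤ p ω)
    (h : ∀ s z, law p (fun ω => (S ω, Z ω)) (s, z) = law p S s * k s z) :
    entropy p (fun ω => (S ω, Z ω)) = entropy p S + ∑ s, law p S s * pmfEntropy (k s) := by
  unfold entropy pmfEntropy
  rw [Fintype.sum_prod_type]
  simp only [h, Real.negMulLog_mul, Finset.sum_add_distrib]
  have : ∀ s, ∑ z, k s z * (law p S s).negMulLog = (law p S s).negMulLog := by
    intro s
    rw [← Finset.sum_mul]
    rcases (law_nonneg h0 S s).eq_or_lt with h | h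
    · simp [← h]
    · rw [hk s h, one_mul]
  simp only [this, ← Finset.mul_sum, add_div, ← mul_div_assoc, ← Finset.sum_div]

/-- Conditional entropy of a block is at most the sum of the conditional entropies of its
components. -/
theorem entropy_block_le [Fintype β] [Fintype γ] {p : Ω → ℝ} (hp : p ∈ stdSimplex ℝ Ω) (S : Ω → γ) :
    ∀ (n : ℕ) (Z : Ω → Fin n → β), entropy p (fun ω => (Z ω, S ω)) ≤
      entropy p S + ∑ i, (entropy p (fun ω => (Z ω i, S ω)) - entropy p S)
  | 0, Z => by
    rw [Finset.univ_eq_empty, Finset.sum_empty, add_zero]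
    exact entropy_le_of_function hp.1 (fun s => (fun i => i.elim0, s))
      (fun ω => Prod.ext (funext fun i => i.elim0) rfl)
  | n + 1, Z => by
    have ih := entropy_block_le hp S n (fun ω i => Z ω i.castSucc)
    have hs := entropy_submodular hp (fun ω (i : Fin n) => Z ω i.castSucc)
      (fun ω => Z ω (Fin.last n)) S
    have hc := entropy_le_of_function hp.1 (B := fun ω => (Z ω, S ω))
      (A := fun ω => ((fun (i : Fin n) => Z ω i.castSucc), Z ω (Fin.last n), S ω))
      (fun x => (Fin.snoc (α := fun _ => β) x.1 x.2.1, x.2.2)) (fun ω => by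
        refine Prod.ext (funext fun i => ?_) rfl
        refine Fin.lastCases ?_ (fun j => ?_) i <;> simp)
    rw [Fin.sum_univ_castSucc]
    linarith

end Toolkit

/-! ### Information quantities of a superposition law as explicit functions of its factors. -/

section Superposition

variable {𝒰 𝒳₁ 𝒳₂ 𝒵 : Type*} [Fintype 𝒰] [Fintype 𝒳₁] [Fintype 𝒳₂] [Fintype 𝒵]

/-- Law of `(U, X₁, X₂, Z)`, where `X₁` and `X₂` are conditionally independent given `U`, and `Z`
is the output of the channel `K` with inputs `X₁` and `X₂`. -/
def superLaw (q : 𝒰 → ℝ) (a : 𝒰 → 𝒳₁ → ℝ) (b : 𝒰 → 𝒳₂ → ℝ) (K : 𝒳₁ → 𝒳₂ → 𝒵 → ℝ) :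
    𝒰 × 𝒳₁ × 𝒳₂ × 𝒵 → ℝ :=
  fun x => q x.1 * a x.1 x.2.1 * b x.1 x.2.2.1 * K x.2.1 x.2.2.1 x.2.2.2

/-- Output law of the channel `K x₁ x₂` when `x₁` has law `a`. -/
def mix₁ (a : 𝒳₁ → ℝ) (K : 𝒳₁ → 𝒳₂ → 𝒵 → ℝ) (x₂ : 𝒳₂) (z : 𝒵) : ℝ := ∑ x₁, a x₁ * K x₁ x₂ z

/-- Output law of the channel `K x₁ x₂` when `x₂` has law `b`. -/
def mix₂ (b : 𝒳₂ → ℝ) (K : 𝒳₁ → 𝒳₂ → 𝒵 → ℝ) (x₁ : 𝒳₁) (z : 𝒵) : ℝ := ∑ x₂, b x₂ * K x₁ x₂ z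

/-- Output law of the channel `K` when the pair of inputs has law `π`. -/
def mix (π : 𝒳₁ × 𝒳₂ → ℝ) (K : 𝒳₁ → 𝒳₂ → 𝒵 → ℝ) (z : 𝒵) : ℝ := ∑ x, π x * K x.1 x.2 z

/-- The product of two probability mass functions. -/
def prodPmf (a : 𝒳₁ → ℝ) (b : 𝒳₂ → ℝ) : 𝒳₁ × 𝒳₂ → ℝ := fun x => a x.1 * b x.2

/-- The law of the pair of inputs. -/
def inputLaw (q : 𝒰 → ℝ) (a : 𝒰 → 𝒳₁ → ℝ) (b : 𝒰 → 𝒳₂ → ℝ) : 𝒳₁ × 𝒳₂ → ℝ :=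
  fun x => ∑ u, q u * prodPmf (a u) (b u) x

/-- Conditional entropy of the output of `K` given the inputs, which have law `π`. -/
noncomputable def noise (π : 𝒳₁ × 𝒳₂ → ℝ) (K : 𝒳₁ → 𝒳₂ → 𝒵 → ℝ) : ℝ :=
  ∑ x, π x * pmfEntropy (K x.1 x.2)

/-- `I(X₁; Z | X₂)` for independent inputs with laws `a` and `b`. -/
noncomputable def rate₁ (a : 𝒳₁ → ℝ) (b : 𝒳₂ → ℝ) (K : 𝒳₁ → 𝒳₂ → 𝒵 → ℝ) : ℝ :=
  ∑ x₂, b x₂ * pmfEntropy (mix₁ a K x₂) - noise (prodPmf a b) K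

/-- `I(X₂; Z | X₁)` for independent inputs with laws `a` and `b`. -/
noncomputable def rate₂ (a : 𝒳₁ → ℝ) (b : 𝒳₂ → ℝ) (K : 𝒳₁ → 𝒳₂ → 𝒵 → ℝ) : ℝ :=
  ∑ x₁, a x₁ * pmfEntropy (mix₂ b K x₁) - noise (prodPmf a b) K

/-- `I(X₁ X₂; Z)` for inputs with law `π`. -/
noncomputable def rateSum (π : 𝒳₁ × 𝒳₂ → ℝ) (K : 𝒳₁ → 𝒳₂ → 𝒵 → ℝ) : ℝ :=
  pmfEntropy (mix π K) - noise π K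

variable {q : 𝒰 → ℝ} {a : 𝒰 → 𝒳₁ → ℝ} {b : 𝒰 → 𝒳₂ → ℝ} {K : 𝒳₁ → 𝒳₂ → 𝒵 → ℝ}

omit [Fintype 𝒰] [Fintype 𝒳₁] [Fintype 𝒳₂] [Fintype 𝒵] in
theorem superLaw_nonneg (hq : ∀ u, 0 ≤ q u) (ha : ∀ u x, 0 ≤ a u x) (hb : ∀ u x, 0 ≤ b u x)
    (hK : ∀ x₁ x₂ z, 0 ≤ K x₁ x₂ z) (x : 𝒰 × 𝒳₁ × 𝒳₂ × 𝒵) : 0 ≤ superLaw q a b K x :=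
  mul_nonneg (mul_nonneg (mul_nonneg (hq _) (ha _ _)) (hb _ _)) (hK _ _ _)

theorem superLaw_mem (hq : q ∈ stdSimplex ℝ 𝒰) (ha : ∀ u, a u ∈ stdSimplex ℝ 𝒳₁)
    (hb : ∀ u, b u ∈ stdSimplex ℝ 𝒳₂) (hK : ∀ x₁ x₂, K x₁ x₂ ∈ stdSimplex ℝ 𝒵) :
    superLaw q a b K ∈ stdSimplex ℝ (𝒰 × 𝒳₁ × 𝒳₂ × 𝒵) := by
  refine ⟨superLaw_nonneg hq.1 (fun u => (ha u).1) (fun u => (hb u).1)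
    (fun x₁ x₂ => (hK x₁ x₂).1), ?_⟩
  simp only [superLaw, Fintype.sum_prod_type, ← Finset.mul_sum, (hK _ _).2, (hb _).2, (ha _).2,
    hq.2, mul_one]

section Laws

theorem law_superLaw₁₂ (hK : ∀ x₁ x₂, ∑ z, K x₁ x₂ z = 1) (s : 𝒳₁ × 𝒳₂ × 𝒰) :
    law (superLaw q a b K) (fun x => (x.2.1, x.2.2.1, x.1)) s =
      q s.2.2 * a s.2.2 s.1 * b s.2.2 s.2.1 := by
  classical
  obtain ⟨x₁, x₂, u⟩ := s
  simp only [law, superLaw, Fintype.sum_prod_type, Prod.mk.injEq, ite_and]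
  simp [← Finset.mul_sum, hK]

theorem law_superLaw₂ (hK : ∀ x₁ x₂, ∑ z, K x₁ x₂ z = 1) (ha : ∀ u, ∑ x, a u x = 1)
    (s : 𝒳₂ × 𝒰) :
    law (superLaw q a b K) (fun x => (x.2.2.1, x.1)) s = q s.2 * b s.2 s.1 := by
  classical
  obtain ⟨x₂, u⟩ := s
  simp only [law, superLaw, Fintype.sum_prod_type, Prod.mk.injEq, ite_and]
  simp [← Finset.mul_sum, hK, ← Finset.sum_mul, ha]

theorem law_superLaw₁ (hK : ∀ x₁ x₂, ∑ z, K x₁ x₂ z = 1) (hb : ∀ u, ∑ x, b u x = 1)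
    (s : 𝒳₁ × 𝒰) :
    law (superLaw q a b K) (fun x => (x.2.1, x.1)) s = q s.2 * a s.2 s.1 := by
  classical
  obtain ⟨x₁, u⟩ := s
  simp only [law, superLaw, Fintype.sum_prod_type, Prod.mk.injEq, ite_and]
  simp [← Finset.mul_sum, hK, hb]

theorem law_superLaw₀ (hK : ∀ x₁ x₂, ∑ z, K x₁ x₂ z = 1) (ha : ∀ u, ∑ x, a u x = 1)
    (hb : ∀ u, ∑ x, b u x = 1) (u : 𝒰) :
    law (superLaw q a b K) (fun x => x.1) u = q u := by
  classical
  simp only [law, superLaw, Fintype.sum_prod_type]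
  simp [← Finset.mul_sum, hK, hb, ha]

theorem law_superLaw_inputs (hK : ∀ x₁ x₂, ∑ z, K x₁ x₂ z = 1) (s : 𝒳₁ × 𝒳₂) :
    law (superLaw q a b K) (fun x => (x.2.1, x.2.2.1)) s = inputLaw q a b s := by
  classical
  obtain ⟨x₁, x₂⟩ := s
  simp only [law, superLaw, Fintype.sum_prod_type, Prod.mk.injEq, ite_and]
  simp [← Finset.mul_sum, hK, inputLaw, prodPmf, mul_assoc]

end Laws

variable (hq : q ∈ stdSimplex ℝ 𝒰) (ha : ∀ u, a u ∈ stdSimplex ℝ 𝒳₁)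
  (hb : ∀ u, b u ∈ stdSimplex ℝ 𝒳₂) (hK : ∀ x₁ x₂, K x₁ x₂ ∈ stdSimplex ℝ 𝒵)

omit [Fintype 𝒳₂] in
theorem mix₁_mem {α : 𝒳₁ → ℝ} (hα : α ∈ stdSimplex ℝ 𝒳₁)
    (hK : ∀ x₁ x₂, K x₁ x₂ ∈ stdSimplex ℝ 𝒵) (x₂ : 𝒳₂) : mix₁ α K x₂ ∈ stdSimplex ℝ 𝒵 := by
  refine ⟨fun z => Finset.sum_nonneg fun x _ => mul_nonneg (hα.1 x) ((hK x x₂).1 z), ?_⟩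
  unfold mix₁
  rw [Finset.sum_comm]
  simp only [← Finset.mul_sum, (hK _ _).2, hα.2, mul_one]

omit [Fintype 𝒳₁] in
theorem mix₂_mem {β : 𝒳₂ → ℝ} (hβ : β ∈ stdSimplex ℝ 𝒳₂)
    (hK : ∀ x₁ x₂, K x₁ x₂ ∈ stdSimplex ℝ 𝒵) (x₁ : 𝒳₁) : mix₂ β K x₁ ∈ stdSimplex ℝ 𝒵 := by
  refine ⟨fun z => Finset.sum_nonneg fun x _ => mul_nonneg (hβ.1 x) ((hK x₁ x).1 z), ?_⟩
  unfold mix₂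
  rw [Finset.sum_comm]
  simp only [← Finset.mul_sum, (hK _ _).2, hβ.2, mul_one]

theorem mix_mem {π : 𝒳₁ × 𝒳₂ → ℝ} (hπ : π ∈ stdSimplex ℝ (𝒳₁ × 𝒳₂))
    (hK : ∀ x₁ x₂, K x₁ x₂ ∈ stdSimplex ℝ 𝒵) : mix π K ∈ stdSimplex ℝ 𝒵 := by
  refine ⟨fun z => Finset.sum_nonneg fun x _ => mul_nonneg (hπ.1 x) ((hK x.1 x.2).1 z), ?_⟩
  unfold mix
  rw [Finset.sum_comm]
  simp only [← Finset.mul_sum, (hK _ _).2, hπ.2, mul_one]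

theorem prodPmf_mem {α : 𝒳₁ → ℝ} {β : 𝒳₂ → ℝ} (hα : α ∈ stdSimplex ℝ 𝒳₁)
    (hβ : β ∈ stdSimplex ℝ 𝒳₂) : prodPmf α β ∈ stdSimplex ℝ (𝒳₁ × 𝒳₂) := by
  refine ⟨fun x => mul_nonneg (hα.1 _) (hβ.1 _), ?_⟩
  simp only [prodPmf, Fintype.sum_prod_type, ← Finset.mul_sum, hα.2, hβ.2, mul_one]

theorem inputLaw_mem (hq : q ∈ stdSimplex ℝ 𝒰) (ha : ∀ u, a u ∈ stdSimplex ℝ 𝒳₁)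
    (hb : ∀ u, b u ∈ stdSimplex ℝ 𝒳₂) : inputLaw q a b ∈ stdSimplex ℝ (𝒳₁ × 𝒳₂) := by
  refine ⟨fun x => Finset.sum_nonneg fun u _ => mul_nonneg (hq.1 u)
    ((prodPmf_mem (ha u) (hb u)).1 x), ?_⟩
  unfold inputLaw
  rw [Finset.sum_comm]
  simp only [← Finset.mul_sum, (prodPmf_mem (ha _) (hb _)).2, hq.2, mul_one]

/-- The noise entropy is linear in the input law, so conditioning on `U` does not change it. -/
theorem noise_inputLaw : noise (inputLaw q a b) K = ∑ u, q u * noise (prodPmf (a u) (b u)) K := by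
  simp only [noise, inputLaw, Finset.sum_mul, Finset.mul_sum]
  rw [Finset.sum_comm]
  simp only [mul_assoc]

include hq ha hb hK

/-- Once both inputs are fixed the output has law `K`, so the chain rule `entropy_channel` adds the
noise entropy. The companions below fix fewer variables, and average `K` over any input left out. -/
theorem entropy_superLaw₁₂ :
    entropy (superLaw q a b K) (fun x => ((x.2.1, x.2.2.1, x.1), x.2.2.2)) =
      entropy (superLaw q a b K) (fun x => (x.2.1, x.2.2.1, x.1)) +
        ∑ u, q u * noise (prodPmf (a u) (b u)) K := by
  classical
  have hl := law_superLaw₁₂ (q := q) (a := a) (b := b) (fun x₁ x₂ => (hK x₁ x₂).2)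
  rw [entropy_channel _ _ (fun s => K s.1 s.2.1) (fun s _ => (hK _ _).2)
    (superLaw_mem hq ha hb hK).1]
  · congr 1
    simp only [hl, Fintype.sum_prod_type, noise, prodPmf, Finset.mul_sum]
    rw [Finset.sum_comm_cycle]
    simp only [mul_assoc]
  · rintro ⟨x₁, x₂, u⟩ z
    rw [hl]
    simp only [law, superLaw, Fintype.sum_prod_type, Prod.mk.injEq, ite_and]
    simp

theorem entropy_superLaw₂ :
    entropy (superLaw q a b K) (fun x => ((x.2.2.1, x.1), x.2.2.2)) =
      entropy (superLaw q a b K) (fun x => (x.2.2.1, x.1)) +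
        ∑ u, q u * ∑ x₂, b u x₂ * pmfEntropy (mix₁ (a u) K x₂) := by
  classical
  have hl := law_superLaw₂ (q := q) (b := b) (fun x₁ x₂ => (hK x₁ x₂).2) (fun u => (ha u).2)
  rw [entropy_channel _ _ (fun s => mix₁ (a s.2) K s.1) (fun s _ => (mix₁_mem (ha _) hK _).2)
    (superLaw_mem hq ha hb hK).1]
  · congr 1
    simp only [hl, Fintype.sum_prod_type, Finset.mul_sum]
    rw [Finset.sum_comm]
    simp only [mul_assoc]
  · rintro ⟨x₂, u⟩ z
    rw [hl]
    simp only [law, superLaw, Fintype.sum_prod_type, Prod.mk.injEq, ite_and]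
    simp only [mix₁, Finset.mul_sum]
    simp only [Finset.sum_ite_eq', Finset.mem_univ, if_true, Finset.sum_ite_irrel,
      Finset.sum_const_zero]
    exact Finset.sum_congr rfl fun x _ => by ring

theorem entropy_superLaw₁ :
    entropy (superLaw q a b K) (fun x => ((x.2.1, x.1), x.2.2.2)) =
      entropy (superLaw q a b K) (fun x => (x.2.1, x.1)) +
        ∑ u, q u * ∑ x₁, a u x₁ * pmfEntropy (mix₂ (b u) K x₁) := by
  classical
  have hl := law_superLaw₁ (q := q) (a := a) (fun x₁ x₂ => (hK x₁ x₂).2) (fun u => (hb u).2)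
  rw [entropy_channel _ _ (fun s => mix₂ (b s.2) K s.1) (fun s _ => (mix₂_mem (hb _) hK _).2)
    (superLaw_mem hq ha hb hK).1]
  · congr 1
    simp only [hl, Fintype.sum_prod_type, Finset.mul_sum]
    rw [Finset.sum_comm]
    simp only [mul_assoc]
  · rintro ⟨x₁, u⟩ z
    rw [hl]
    simp only [law, superLaw, Fintype.sum_prod_type, Prod.mk.injEq, ite_and]
    simp only [mix₂, Finset.mul_sum]
    simp only [Finset.sum_ite_eq', Finset.mem_univ, if_true, Finset.sum_ite_irrel,
      Finset.sum_const_zero]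
    exact Finset.sum_congr rfl fun x _ => by ring

theorem entropy_superLaw₀ :
    entropy (superLaw q a b K) (fun x => (x.1, x.2.2.2)) =
      entropy (superLaw q a b K) (fun x => x.1) +
        ∑ u, q u * pmfEntropy (mix (prodPmf (a u) (b u)) K) := by
  classical
  have hl := law_superLaw₀ (q := q) (fun x₁ x₂ => (hK x₁ x₂).2) (fun u => (ha u).2)
    (fun u => (hb u).2)
  rw [entropy_channel _ _ (fun u => mix (prodPmf (a u) (b u)) K)
    (fun s _ => (mix_mem (prodPmf_mem (ha _) (hb _)) hK).2)
    (superLaw_mem hq ha hb hK).1]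
  · simp only [hl]
  · rintro u z
    rw [hl]
    simp only [law, superLaw, Fintype.sum_prod_type, Prod.mk.injEq, ite_and]
    simp only [mix, prodPmf, Finset.mul_sum, Fintype.sum_prod_type]
    simp only [Finset.sum_ite_eq', Finset.mem_univ, if_true, Finset.sum_ite_irrel,
      Finset.sum_const_zero]
    exact Finset.sum_congr rfl fun x _ => Finset.sum_congr rfl fun y _ => by ring

theorem entropy_superLaw_inputs :
    entropy (superLaw q a b K) (fun x => ((x.2.1, x.2.2.1), x.2.2.2)) =
      entropy (superLaw q a b K) (fun x => (x.2.1, x.2.2.1)) + noise (inputLaw q a b) K := by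
  classical
  have hl := law_superLaw_inputs (q := q) (a := a) (b := b) (fun x₁ x₂ => (hK x₁ x₂).2)
  rw [entropy_channel _ _ (fun s => K s.1 s.2) (fun s _ => (hK _ _).2)
    (superLaw_mem hq ha hb hK).1]
  · simp only [hl, noise]
  · rintro ⟨x₁, x₂⟩ z
    rw [hl]
    simp only [law, superLaw, Fintype.sum_prod_type, Prod.mk.injEq, ite_and]
    simp [inputLaw, Finset.sum_mul, prodPmf, mul_assoc]

omit hq ha hb hK in
theorem law_superLaw_output :
    law (superLaw q a b K) (fun x => x.2.2.2) = mix (inputLaw q a b) K := by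
  classical
  ext z
  simp only [law, superLaw, Fintype.sum_prod_type, mix, inputLaw, prodPmf, Finset.sum_mul]
  simp only [Finset.sum_ite_eq', Finset.mem_univ, if_true]
  rw [Finset.sum_comm_cycle, Finset.sum_comm_cycle]
  simp only [mul_assoc]

omit hq ha hb hK in
theorem entropy_superLaw_output :
    entropy (superLaw q a b K) (fun x => x.2.2.2) = pmfEntropy (mix (inputLaw q a b) K) := by
  rw [entropy_eq_pmfEntropy, law_superLaw_output]

end Superposition

/-! ### Mutual informations of variables that follow a superposition law. -/

section SuperpositionInformation

variable {Ω 𝒰 𝒳₁ 𝒳₂ 𝒵 : Type*} [Fintype Ω] [Fintype 𝒰] [Fintype 𝒳₁] [Fintype 𝒳₂] [Fintype 𝒵]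
  {p : Ω → ℝ} {U : Ω → 𝒰} {A : Ω → 𝒳₁} {B : Ω → 𝒳₂} {Z : Ω → 𝒵}
  {q : 𝒰 → ℝ} {a : 𝒰 → 𝒳₁ → ℝ} {b : 𝒰 → 𝒳₂ → ℝ} {K : 𝒳₁ → 𝒳₂ → 𝒵 → ℝ}
  (hq : q ∈ stdSimplex ℝ 𝒰) (ha : ∀ u, a u ∈ stdSimplex ℝ 𝒳₁)
  (hb : ∀ u, b u ∈ stdSimplex ℝ 𝒳₂) (hK : ∀ x₁ x₂, K x₁ x₂ ∈ stdSimplex ℝ 𝒵)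
  (h : law p (fun ω => (U ω, A ω, B ω, Z ω)) = superLaw q a b K)

include h in
-- Carries the computations over to any space with variables of this law: the joint law in the
-- definition of the region, and the letters of a code at a fixed time.
theorem entropy_of_law_eq_superLaw {γ : Type*} [Fintype γ] (f : 𝒰 × 𝒳₁ × 𝒳₂ × 𝒵 → γ) :
    entropy p (fun ω => f (U ω, A ω, B ω, Z ω)) = entropy (superLaw q a b K) f := by
  rw [← h, entropy_law]

include hq ha hb hK

theorem entropy_superLaw_all :
    entropy (superLaw q a b K) (fun x => (x.2.1, x.2.2.2, x.2.2.1, x.1)) =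
      entropy (superLaw q a b K) (fun x => (x.2.1, x.2.2.1, x.1)) +
        ∑ u, q u * noise (prodPmf (a u) (b u)) K := by
  rw [← entropy_superLaw₁₂ hq ha hb hK]
  exact entropy_congr (superLaw_mem hq ha hb hK).1
    (fun s => ((s.1, s.2.2.1, s.2.2.2), s.2.1)) (fun s => (s.1.1, s.2, s.1.2.1, s.1.2.2))
    (fun _ => rfl) (fun _ => rfl)

include h

theorem condMutualInfo₁_eq : condMutualInfo p A Z (fun ω => (B ω, U ω)) =
    ∑ u, q u * rate₁ (a u) (b u) K := by
  have hm := (superLaw_mem hq ha hb hK).1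
  unfold condMutualInfo condEntropy
  rw [entropy_of_law_eq_superLaw h (fun x => (x.2.1, x.2.2.1, x.1)),
    entropy_of_law_eq_superLaw h (fun x => (x.2.2.1, x.1)),
    entropy_of_law_eq_superLaw h (fun x => (x.2.1, x.2.2.2, x.2.2.1, x.1)),
    entropy_of_law_eq_superLaw h (fun x => (x.2.2.2, x.2.2.1, x.1)),
    entropy_superLaw_all hq ha hb hK,
    entropy_congr hm (A := fun x : 𝒰 × 𝒳₁ × 𝒳₂ × 𝒵 => (x.2.2.2, x.2.2.1, x.1))
      (B := fun x => ((x.2.2.1, x.1), x.2.2.2)) (fun s => (s.2, s.1)) (fun s => (s.2, s.1))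
      (fun _ => rfl) (fun _ => rfl), entropy_superLaw₂ hq ha hb hK]
  simp only [rate₁, mul_sub, Finset.sum_sub_distrib]
  ring

theorem condMutualInfo₂_eq : condMutualInfo p B Z (fun ω => (A ω, U ω)) =
    ∑ u, q u * rate₂ (a u) (b u) K := by
  have hm := (superLaw_mem hq ha hb hK).1
  unfold condMutualInfo condEntropy
  rw [entropy_of_law_eq_superLaw h (fun x => (x.2.2.1, x.2.1, x.1)),
    entropy_of_law_eq_superLaw h (fun x => (x.2.1, x.1)),
    entropy_of_law_eq_superLaw h (fun x => (x.2.2.1, x.2.2.2, x.2.1, x.1)),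
    entropy_of_law_eq_superLaw h (fun x => (x.2.2.2, x.2.1, x.1)),
    entropy_congr hm (A := fun x : 𝒰 × 𝒳₁ × 𝒳₂ × 𝒵 => (x.2.2.1, x.2.2.2, x.2.1, x.1))
      (B := fun x => (x.2.1, x.2.2.2, x.2.2.1, x.1)) (fun s => (s.2.2.1, s.2.1, s.1, s.2.2.2))
      (fun s => (s.2.2.1, s.2.1, s.1, s.2.2.2)) (fun _ => rfl) (fun _ => rfl),
    entropy_congr hm (A := fun x : 𝒰 × 𝒳₁ × 𝒳₂ × 𝒵 => (x.2.2.1, x.2.1, x.1))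
      (B := fun x => (x.2.1, x.2.2.1, x.1)) (fun s => (s.2.1, s.1, s.2.2))
      (fun s => (s.2.1, s.1, s.2.2)) (fun _ => rfl) (fun _ => rfl),
    entropy_superLaw_all hq ha hb hK,
    entropy_congr hm (A := fun x : 𝒰 × 𝒳₁ × 𝒳₂ × 𝒵 => (x.2.2.2, x.2.1, x.1))
      (B := fun x => ((x.2.1, x.1), x.2.2.2)) (fun s => (s.2, s.1)) (fun s => (s.2, s.1))
      (fun _ => rfl) (fun _ => rfl), entropy_superLaw₁ hq ha hb hK]
  simp only [rate₂, mul_sub, Finset.sum_sub_distrib]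
  ring

theorem condMutualInfo_sum_eq : condMutualInfo p (fun ω => (A ω, B ω)) Z U =
    ∑ u, q u * rateSum (prodPmf (a u) (b u)) K := by
  have hm := (superLaw_mem hq ha hb hK).1
  unfold condMutualInfo condEntropy
  rw [entropy_of_law_eq_superLaw h (fun x => ((x.2.1, x.2.2.1), x.1)),
    entropy_of_law_eq_superLaw h (fun x => x.1),
    entropy_of_law_eq_superLaw h (fun x => ((x.2.1, x.2.2.1), x.2.2.2, x.1)),
    entropy_of_law_eq_superLaw h (fun x => (x.2.2.2, x.1)),
    entropy_congr hm (A := fun x : 𝒰 × 𝒳₁ × 𝒳₂ × 𝒵 => ((x.2.1, x.2.2.1), x.2.2.2, x.1))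
      (B := fun x => (x.2.1, x.2.2.2, x.2.2.1, x.1)) (fun s => (s.1.1, s.2.1, s.1.2, s.2.2))
      (fun s => ((s.1, s.2.2.1), s.2.1, s.2.2.2)) (fun _ => rfl) (fun _ => rfl),
    entropy_congr hm (A := fun x : 𝒰 × 𝒳₁ × 𝒳₂ × 𝒵 => ((x.2.1, x.2.2.1), x.1))
      (B := fun x => (x.2.1, x.2.2.1, x.1)) (fun s => (s.1.1, s.1.2, s.2))
      (fun s => ((s.1, s.2.1), s.2.2)) (fun _ => rfl) (fun _ => rfl),
    entropy_superLaw_all hq ha hb hK,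
    entropy_congr hm (A := fun x : 𝒰 × 𝒳₁ × 𝒳₂ × 𝒵 => (x.2.2.2, x.1))
      (B := fun x => (x.1, x.2.2.2)) (fun s => (s.2, s.1)) (fun s => (s.2, s.1))
      (fun _ => rfl) (fun _ => rfl), entropy_superLaw₀ hq ha hb hK]
  simp only [rateSum, mul_sub, Finset.sum_sub_distrib]
  ring

theorem mutualInfo_eq : mutualInfo p (fun ω => (A ω, B ω)) Z = rateSum (inputLaw q a b) K := by
  unfold mutualInfo condEntropy
  rw [entropy_of_law_eq_superLaw h (fun x => (x.2.1, x.2.2.1)),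
    entropy_of_law_eq_superLaw h (fun x => ((x.2.1, x.2.2.1), x.2.2.2)),
    entropy_of_law_eq_superLaw h (fun x => x.2.2.2),
    entropy_superLaw_inputs hq ha hb hK, entropy_superLaw_output]
  simp only [rateSum]
  ring

end SuperpositionInformation

/-! ### The rate constraints in explicit form. -/

section Bounds

variable {X₁ X₂ Y₁ Y₂ Z : Type*} [Fintype X₁] [Fintype X₂] [Fintype Y₁] [Fintype Y₂] [Fintype Z]

/-- The channel to a receiver that observes the function `g` of the two outputs. -/
noncomputable def receiver (W : X₁ → X₂ → stdSimplex ℝ (Y₁ × Y₂)) (g : Y₁ × Y₂ → Z) :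
    X₁ → X₂ → Z → ℝ :=
  fun x₁ x₂ => law (W x₁ x₂ : Y₁ × Y₂ → ℝ) g

omit [Fintype X₁] [Fintype X₂] in
theorem receiver_mem (W : X₁ → X₂ → stdSimplex ℝ (Y₁ × Y₂)) (g : Y₁ × Y₂ → Z) (x₁ : X₁)
    (x₂ : X₂) : receiver W g x₁ x₂ ∈ stdSimplex ℝ Z :=
  law_mem (W x₁ x₂).2 g

/-- The multiple-access rate constraints of a receiver, as explicit functions of the laws of the
auxiliary variable and of the inputs. -/
def RateBounds {m : ℕ} (q : Fin m → ℝ) (a : Fin m → X₁ → ℝ) (b : Fin m → X₂ → ℝ)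
    (K : X₁ → X₂ → Z → ℝ) (C R₀ R₁ R₂ : ℝ) : Prop :=
  R₁ ≤ ∑ u, q u * rate₁ (a u) (b u) K + C ∧
  R₂ ≤ ∑ u, q u * rate₂ (a u) (b u) K + C ∧
  R₁ + R₂ ≤ ∑ u, q u * rateSum (prodPmf (a u) (b u)) K + C ∧
  R₀ + R₁ + R₂ ≤ rateSum (inputLaw q a b) K + C

omit [Fintype Z] in
theorem law_jointLaw {U : Type*} [Fintype U] (W : X₁ → X₂ → stdSimplex ℝ (Y₁ × Y₂))
    (q : stdSimplex ℝ U) (a : U → stdSimplex ℝ X₁) (b : U → stdSimplex ℝ X₂) (g : Y₁ × Y₂ → Z) :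
    law (jointLaw W q a b) (fun ω => (ω.1, ω.2.1, ω.2.2.1, g (ω.2.2.2.1, ω.2.2.2.2))) =
      superLaw q (fun u => a u) (fun u => b u) (receiver W g) := by
  classical
  ext ⟨u, x₁, x₂, z⟩
  simp only [law, jointLaw, superLaw, receiver, Fintype.sum_prod_type, Prod.mk.injEq, ite_and,
    Finset.mul_sum, mul_ite, mul_zero]
  simp only [Finset.sum_ite_eq', Finset.mem_univ, if_true, Finset.sum_ite_irrel,
      Finset.sum_const_zero]

/-- Turns the constraints into formulas in the laws `q`, `a`, `b`, on which continuity and mixing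
arguments can act. -/
theorem MACBounds_iff {m : ℕ} (W : X₁ → X₂ → stdSimplex ℝ (Y₁ × Y₂))
    (q : stdSimplex ℝ (Fin m)) (a : Fin m → stdSimplex ℝ X₁) (b : Fin m → stdSimplex ℝ X₂)
    (g : Y₁ × Y₂ → Z) (C R₀ R₁ R₂ : ℝ) :
    MACBounds (jointLaw W q a b) (fun ω => g (ω.2.2.2.1, ω.2.2.2.2)) C R₀ R₁ R₂ ↔
      RateBounds (q : Fin m → ℝ) (fun u => a u) (fun u => b u) (receiver W g) C R₀ R₁ R₂ := by
  have h := law_jointLaw W q a b g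
  have ha := fun u => (a u).2
  have hb := fun u => (b u).2
  unfold MACBounds RateBounds
  rw [condMutualInfo₁_eq q.2 ha hb (receiver_mem W g) h,
    condMutualInfo₂_eq q.2 ha hb (receiver_mem W g) h,
    condMutualInfo_sum_eq q.2 ha hb (receiver_mem W g) h,
    mutualInfo_eq q.2 ha hb (receiver_mem W g) h]
  exact Iff.rfl

end Bounds

/-! ### Bounding the auxiliary alphabet and removing slack by compactness. -/

/-- **Carathéodory's theorem** for mixtures: the averages of finitely many functions under a mixture
with finitely many components are also attained by a mixture with a bounded number of
components. -/
theorem exists_mixture_card {κ T ι : Type*} [Fintype κ] [Fintype ι] (φ : κ → T → ℝ) (w : ι → ℝ)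
    (hw : w ∈ stdSimplex ℝ ι) (t : ι → T) :
    ∃ w' ∈ stdSimplex ℝ (Fin (Fintype.card κ + 1)), ∃ t' : Fin (Fintype.card κ + 1) → T,
      ∀ k, ∑ j, w' j * φ k (t' j) = ∑ i, w i * φ k (t i) := by
  classical
  set Φ : T → κ → ℝ := fun s k => φ k s with hΦ
  have hx : ∑ i, w i • Φ (t i) ∈ convexHull ℝ (Set.range Φ) :=
    (convex_convexHull ℝ _).sum_mem (fun i _ => hw.1 i) hw.2
      (fun i _ => subset_convexHull ℝ _ ⟨t i, rfl⟩)
  obtain ⟨ι', _, z, v, hz, hind, hv, hv1, hsum⟩ := eq_pos_convex_span_of_mem_convexHull hx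
  have hne : Nonempty T := by
    by_contra hT
    rw [not_nonempty_iff] at hT
    have := Function.isEmpty t
    have := hw.2
    simp at this
  choose s hs using fun i => hz (Set.mem_range_self i)
  -- Affinely independent points in `κ → ℝ` number at most `|κ| + 1`.
  have hcard : Fintype.card ι' ≤ Fintype.card (Fin (Fintype.card κ + 1)) := by
    have := hind.card_le_finrank_succ
    refine this.trans ?_
    rw [Fintype.card_fin]
    have h2 := Submodule.finrank_le (vectorSpan ℝ (Set.range z))
    simp only [Module.finrank_fintype_fun_eq_card] at h2
    omega
  obtain ⟨e⟩ := Function.Embedding.nonempty_of_card_le hcard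
  -- The mixture is padded to exactly `|κ| + 1` components; the indices outside the range of `e` get
  -- weight zero, so their component is arbitrary.
  refine ⟨law v e, law_mem ⟨fun i => (hv i).le, hv1⟩ e,
    Function.extend e s (fun _ => Classical.arbitrary T), fun k => ?_⟩
  rw [sum_law_mul v e (fun j => φ k (Function.extend e s (fun _ => Classical.arbitrary T) j))]
  simp only [e.injective.extend_apply]
  have := congrFun hsum k
  simp only [← hs, Finset.sum_apply, Pi.smul_apply, smul_eq_mul, hΦ] at this
  exact this

section Compactness

variable {X₁ X₂ Z : Type*} [Fintype X₁] [Fintype X₂] [Fintype Z]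

theorem RateBounds.mono {m : ℕ} {q : Fin m → ℝ} {a : Fin m → X₁ → ℝ}
    {b : Fin m → X₂ → ℝ} {K : X₁ → X₂ → Z → ℝ} {C C' R₀ R₁ R₂ : ℝ} (hC : C ≤ C')
    (h : RateBounds q a b K C R₀ R₁ R₂) : RateBounds q a b K C' R₀ R₁ R₂ := by
  obtain ⟨h₁, h₂, h₃, h₄⟩ := h
  exact ⟨by linarith, by linarith, by linarith, by linarith⟩

theorem RateBounds.of_forall_slack {m : ℕ} {q : Fin m → ℝ} {a : Fin m → X₁ → ℝ}
    {b : Fin m → X₂ → ℝ} {K : X₁ → X₂ → Z → ℝ} {C R₀ R₁ R₂ : ℝ}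
    (h : ∀ n : ℕ, RateBounds q a b K (C + 1 / ((n : ℝ) + 1)) R₀ R₁ R₂) :
    RateBounds q a b K C R₀ R₁ R₂ := by
  have key : ∀ x y : ℝ, (∀ n : ℕ, x ≤ y + (C + 1 / ((n : ℝ) + 1))) → x ≤ y + C := by
    intro x y hxy
    refine le_of_forall_pos_le_add fun ε hε => ?_
    obtain ⟨n, hn⟩ := exists_nat_one_div_lt hε
    linarith [hxy n]
  exact ⟨key _ _ fun n => (h n).1, key _ _ fun n => (h n).2.1, key _ _ fun n => (h n).2.2.1,
    key _ _ fun n => (h n).2.2.2⟩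

/-- All rates are built from sums, products and `negMulLog`, which is continuous even at zero, so
vanishing probabilities need no separate treatment. -/
theorem isClosed_rateBounds (N : ℕ) (K : X₁ → X₂ → Z → ℝ) (C R₀ R₁ R₂ : ℝ) :
    IsClosed {x : (Fin N → ℝ) × (Fin N → X₁ → ℝ) × (Fin N → X₂ → ℝ) |
      RateBounds x.1 x.2.1 x.2.2 K C R₀ R₁ R₂} := by
  have hn := Real.continuous_negMulLog
  unfold RateBounds rate₁ rate₂ rateSum noise mix mix₁ mix₂ inputLaw prodPmf pmfEntropy
  simp only [Set.ofPred_and]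
  refine IsClosed.inter ?_ (IsClosed.inter ?_ (IsClosed.inter ?_ ?_)) <;>
  refine isClosed_le (by fun_prop) (by fun_prop)

theorem RateBounds.congr {m m' : ℕ} {q : Fin m → ℝ} {a : Fin m → X₁ → ℝ} {b : Fin m → X₂ → ℝ}
    {q' : Fin m' → ℝ} {a' : Fin m' → X₁ → ℝ} {b' : Fin m' → X₂ → ℝ}
    {K : X₁ → X₂ → Z → ℝ} {C R₀ R₁ R₂ : ℝ} (h : RateBounds q a b K C R₀ R₁ R₂)
    (h₁ : ∑ u, q' u * rate₁ (a' u) (b' u) K = ∑ u, q u * rate₁ (a u) (b u) K)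
    (h₂ : ∑ u, q' u * rate₂ (a' u) (b' u) K = ∑ u, q u * rate₂ (a u) (b u) K)
    (h₃ : ∑ u, q' u * rateSum (prodPmf (a' u) (b' u)) K =
      ∑ u, q u * rateSum (prodPmf (a u) (b u)) K)
    (h₄ : inputLaw q' a' b' = inputLaw q a b) : RateBounds q' a' b' K C R₀ R₁ R₂ := by
  unfold RateBounds
  rwa [h₁, h₂, h₃, h₄]

/-- The rate constraints of finitely many receivers hold as soon as they hold up to arbitrarily
small slack. -/
theorem exists_rateBounds_of_slack {Z₁ Z₂ Z₃ : Type*} [Fintype Z₁] [Fintype Z₂] [Fintype Z₃]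
    (K₁ : X₁ → X₂ → Z₁ → ℝ) (K₂ : X₁ → X₂ → Z₂ → ℝ) (K₃ : X₁ → X₂ → Z₃ → ℝ)
    (C₁ C₂ C₃ R₀ R₁ R₂ : ℝ)
    (h : ∀ δ : ℝ, 0 < δ → ∃ (m : ℕ) (q : stdSimplex ℝ (Fin m)) (a : Fin m → stdSimplex ℝ X₁)
      (b : Fin m → stdSimplex ℝ X₂),
      RateBounds q (fun u => a u) (fun u => b u) K₁ (C₁ + δ) R₀ R₁ R₂ ∧
      RateBounds q (fun u => a u) (fun u => b u) K₂ (C₂ + δ) R₀ R₁ R₂ ∧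
      RateBounds q (fun u => a u) (fun u => b u) K₃ (C₃ + δ) R₀ R₁ R₂) :
    ∃ (m : ℕ) (q : stdSimplex ℝ (Fin m)) (a : Fin m → stdSimplex ℝ X₁)
      (b : Fin m → stdSimplex ℝ X₂),
      RateBounds q (fun u => a u) (fun u => b u) K₁ C₁ R₀ R₁ R₂ ∧
      RateBounds q (fun u => a u) (fun u => b u) K₂ C₂ R₀ R₁ R₂ ∧
      RateBounds q (fun u => a u) (fun u => b u) K₃ C₃ R₀ R₁ R₂ := by
  -- The quantities a change of mixture must preserve: every value of the input law, which fixes the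
  -- unconditional bounds, and three conditional rates for each of the three receivers.
  set φ : (X₁ × X₂) ⊕ Fin 3 ⊕ Fin 3 ⊕ Fin 3 → stdSimplex ℝ X₁ × stdSimplex ℝ X₂ → ℝ :=
    fun k t => Sum.elim (fun x => prodPmf (t.1 : X₁ → ℝ) (t.2 : X₂ → ℝ) x)
      (Sum.elim (![rate₁ t.1 t.2 K₁, rate₂ t.1 t.2 K₁, rateSum (prodPmf t.1 t.2) K₁])
      (Sum.elim (![rate₁ t.1 t.2 K₂, rate₂ t.1 t.2 K₂, rateSum (prodPmf t.1 t.2) K₂])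
      (![rate₁ t.1 t.2 K₃, rate₂ t.1 t.2 K₃, rateSum (prodPmf t.1 t.2) K₃]))) k with hφ
  set N := Fintype.card ((X₁ × X₂) ⊕ Fin 3 ⊕ Fin 3 ⊕ Fin 3) + 1 with hN
  set S : Set ((Fin N → ℝ) × (Fin N → X₁ → ℝ) × (Fin N → X₂ → ℝ)) :=
    stdSimplex ℝ (Fin N) ×ˢ ((Set.univ.pi fun _ => stdSimplex ℝ X₁) ×ˢ
      (Set.univ.pi fun _ => stdSimplex ℝ X₂)) with hS
  have hScompact : IsCompact S := (isCompact_stdSimplex ℝ (Fin N)).prod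
    ((isCompact_univ_pi fun _ => isCompact_stdSimplex ℝ X₁).prod
      (isCompact_univ_pi fun _ => isCompact_stdSimplex ℝ X₂))
  -- Parameters on a fixed alphabet that meet the constraints with slack `1 / (n + 1)`: a decreasing
  -- sequence of nonempty compact sets, and a point common to all of them has no slack.
  set D : ℕ → Set ((Fin N → ℝ) × (Fin N → X₁ → ℝ) × (Fin N → X₂ → ℝ)) := fun n =>
    S ∩ ({x | RateBounds x.1 x.2.1 x.2.2 K₁ (C₁ + 1 / ((n : ℝ) + 1)) R₀ R₁ R₂} ∩
      ({x | RateBounds x.1 x.2.1 x.2.2 K₂ (C₂ + 1 / ((n : ℝ) + 1)) R₀ R₁ R₂} ∩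
      {x | RateBounds x.1 x.2.1 x.2.2 K₃ (C₃ + 1 / ((n : ℝ) + 1)) R₀ R₁ R₂})) with hD
  have hclosed : ∀ n, IsClosed ({x : (Fin N → ℝ) × (Fin N → X₁ → ℝ) × (Fin N → X₂ → ℝ) |
      RateBounds x.1 x.2.1 x.2.2 K₁ (C₁ + 1 / ((n : ℝ) + 1)) R₀ R₁ R₂} ∩
      ({x | RateBounds x.1 x.2.1 x.2.2 K₂ (C₂ + 1 / ((n : ℝ) + 1)) R₀ R₁ R₂} ∩
      {x | RateBounds x.1 x.2.1 x.2.2 K₃ (C₃ + 1 / ((n : ℝ) + 1)) R₀ R₁ R₂})) := fun n =>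
    (isClosed_rateBounds _ _ _ _ _ _).inter
      ((isClosed_rateBounds _ _ _ _ _ _).inter (isClosed_rateBounds _ _ _ _ _ _))
  have hcompact : ∀ n, IsCompact (D n) := fun n => hScompact.inter_right (hclosed n)
  obtain ⟨x, hx⟩ := IsCompact.nonempty_iInter_of_sequence_nonempty_isCompact_isClosed D
    (fun n x hx => by
      have hle : 1 / (((n + 1 : ℕ) : ℝ) + 1) ≤ 1 / ((n : ℝ) + 1) := by
        apply one_div_le_one_div_of_le <;> push_cast <;> linarith
      exact ⟨hx.1, hx.2.1.mono (by linarith), hx.2.2.1.mono (by linarith),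
        hx.2.2.2.mono (by linarith)⟩)
    (fun n => by
      obtain ⟨m, q, a, b, h₁, h₂, h₃⟩ := h (1 / ((n : ℝ) + 1)) (by positivity)
      obtain ⟨w, hw, t, ht⟩ := exists_mixture_card φ (q : Fin m → ℝ) q.2 (fun u => (a u, b u))
      have hin : inputLaw w (fun j => ((t j).1 : X₁ → ℝ)) (fun j => ((t j).2 : X₂ → ℝ)) =
          inputLaw (q : Fin m → ℝ) (fun u => a u) (fun u => b u) := by
        ext x
        exact ht (Sum.inl x)
      refine ⟨(w, fun j => ((t j).1 : X₁ → ℝ), fun j => ((t j).2 : X₂ → ℝ)),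
        ⟨hw, fun j _ => (t j).1.2, fun j _ => (t j).2.2⟩, ?_, ?_, ?_⟩
      · exact h₁.congr (ht (Sum.inr (Sum.inl 0))) (ht (Sum.inr (Sum.inl 1)))
          (ht (Sum.inr (Sum.inl 2))) hin
      · exact h₂.congr (ht (Sum.inr (Sum.inr (Sum.inl 0)))) (ht (Sum.inr (Sum.inr (Sum.inl 1))))
          (ht (Sum.inr (Sum.inr (Sum.inl 2)))) hin
      · exact h₃.congr (ht (Sum.inr (Sum.inr (Sum.inr 0)))) (ht (Sum.inr (Sum.inr (Sum.inr 1))))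
          (ht (Sum.inr (Sum.inr (Sum.inr 2)))) hin)
    (hcompact 0) (fun n => (hcompact n).isClosed)
  rw [Set.mem_iInter] at hx
  have hxS := (hx 0).1
  refine ⟨N, ⟨x.1, hxS.1⟩, fun u => ⟨x.2.1 u, hxS.2.1 u trivial⟩,
    fun u => ⟨x.2.2 u, hxS.2.2 u trivial⟩, ?_, ?_, ?_⟩
  · exact RateBounds.of_forall_slack fun n => (hx n).2.1
  · exact RateBounds.of_forall_slack fun n => (hx n).2.2.1
  · exact RateBounds.of_forall_slack fun n => (hx n).2.2.2

end Compactness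

/-! ### Sums over vectors with independent components. -/

section ProductSums

variable {ι : Type*} {α : ι → Type*} [Fintype ι] [DecidableEq ι] [∀ i, Fintype (α i)]

/-- A random vector with independent components has the prescribed marginals. -/
theorem sum_prod_mul_eval (q : ∀ i, α i → ℝ) (hq : ∀ i, ∑ x, q i x = 1) (i₀ : ι)
    (G : α i₀ → ℝ) : ∑ f : ∀ i, α i, (∏ i, q i (f i)) * G (f i₀) = ∑ x, q i₀ x * G x := by
  classical
  -- The function is absorbed into the factor at `i₀`, after which the sum of products is a product
  -- of sums.
  have h : ∀ f : ∀ i, α i, (∏ i, q i (f i)) * G (f i₀) =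
      ∏ i, Function.update q i₀ (fun x => q i₀ x * G x) i (f i) := by
    intro f
    rw [Fintype.prod_eq_mul_prod_compl i₀, Fintype.prod_eq_mul_prod_compl i₀
      (fun i => Function.update q i₀ (fun x => q i₀ x * G x) i (f i))]
    rw [Function.update_self, mul_right_comm]
    congr 1
    refine Finset.prod_congr rfl fun i hi => ?_
    rw [Function.update_of_ne (by simpa using hi)]
  simp only [h]
  rw [← Fintype.prod_sum, Fintype.prod_eq_mul_prod_compl i₀, Function.update_self]
  rw [Finset.prod_eq_one, mul_one]
  intro i hi
  rw [Function.update_of_ne (by simpa using hi), hq]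

theorem sum_prod_eq_one (q : ∀ i, α i → ℝ) (hq : ∀ i, ∑ x, q i x = 1) :
    ∑ f : ∀ i, α i, ∏ i, q i (f i) = 1 := by
  rw [← Fintype.prod_sum]
  simp [hq]

/-- Two components of a random vector with independent components are independent. -/
theorem sum_prod_mul_eval₂ (q : ∀ i, α i → ℝ) (hq : ∀ i, ∑ x, q i x = 1) {i₀ i₁ : ι}
    (hi : i₀ ≠ i₁) (G : α i₀ → α i₁ → ℝ) :
    ∑ f : ∀ i, α i, (∏ i, q i (f i)) * G (f i₀) (f i₁) =
      ∑ x, ∑ y, q i₀ x * q i₁ y * G x y := by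
  classical
  -- Splitting by the value `y` of the second component concentrates its factor at `y` and leaves a
  -- function of the first component only.
  have h : ∀ f : ∀ i, α i, (∏ i, q i (f i)) * G (f i₀) (f i₁) =
      ∑ y, (∏ i, Function.update q i₁ (fun x => if x = y then q i₁ y else 0) i (f i)) *
        G (f i₀) y := by
    intro f
    have : ∀ y, ∏ i, Function.update q i₁ (fun x => if x = y then q i₁ y else 0) i (f i) =
        if f i₁ = y then ∏ i, q i (f i) else 0 := by
      intro y
      rw [Fintype.prod_eq_mul_prod_compl i₁, Function.update_self]
      split_ifs with hy
      · rw [Fintype.prod_eq_mul_prod_compl i₁ (fun i => q i (f i)), hy]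
        congr 1
        refine Finset.prod_congr rfl fun i hi => ?_
        rw [Function.update_of_ne (by simpa using hi)]
      · rw [zero_mul]
    simp [this, ite_mul]
  simp only [h]
  rw [Finset.sum_comm]
  have h2 : ∀ y, ∑ f : ∀ i, α i, (∏ i, Function.update q i₁
      (fun x => if x = y then q i₁ y else 0) i (f i)) * G (f i₀) y =
      ∑ x, q i₀ x * q i₁ y * G x y := by
    intro y
    by_cases hy : q i₁ y = 0
    · have : ∀ f : ∀ i, α i, ∏ i, Function.update q i₁
          (fun x => if x = y then q i₁ y else 0) i (f i) = 0 := fun f =>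
        Finset.prod_eq_zero (Finset.mem_univ i₁) (by simp [hy])
      rw [Finset.sum_eq_zero fun f _ => by rw [this f, zero_mul]]
      simp [hy]
    -- The weight `q i₁ y` moves into the function, so that the factor at `i₁` is a normalised point
    -- mass.
    · have h3 := sum_prod_mul_eval (Function.update q i₁ (fun x => if x = y then 1 else 0))
        (fun i => by
          rcases eq_or_ne i i₁ with rfl | hne
          · simp
          · simp [Function.update_of_ne hne, hq]) i₀ (fun x => q i₁ y * G x y)
      rw [Function.update_of_ne hi] at h3
      simp only [← mul_assoc] at h3
      rw [← h3]
      refine Finset.sum_congr rfl fun f _ => ?_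
      congr 1
      rw [Fintype.prod_eq_mul_prod_compl i₁, Fintype.prod_eq_mul_prod_compl i₁ (fun i =>
        Function.update q i₁ (fun x => if x = y then 1 else 0) i (f i)), Function.update_self,
        Function.update_self, mul_right_comm]
      congr 1
      · split_ifs <;> simp
      · refine Finset.prod_congr rfl fun i hi => ?_
        have : i ≠ i₁ := by simpa using hi
        rw [Function.update_of_ne this, Function.update_of_ne this]
  simp only [h2]
  rw [Finset.sum_comm]

end ProductSums

/-! ### Laws of memoryless blocks. -/

section BlockLaw

/-- The law of a vector with independent components. -/
def blockLaw {ι α : Type*} [Fintype ι] (q : ι → α → ℝ) (f : ι → α) : ℝ := ∏ i, q i (f i)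

variable {ι α β : Type*} [Fintype ι] [DecidableEq ι] [Fintype α] [Fintype β]

theorem blockLaw_mem {q : ι → α → ℝ} (hq : ∀ i, q i ∈ stdSimplex ℝ α) :
    blockLaw q ∈ stdSimplex ℝ (ι → α) :=
  ⟨fun _ => Finset.prod_nonneg fun i _ => (hq i).1 _, sum_prod_eq_one q fun i => (hq i).2⟩

theorem pmfEntropy_blockLaw {q : ι → α → ℝ} (hq : ∀ i, q i ∈ stdSimplex ℝ α) :
    pmfEntropy (blockLaw q) = ∑ i, pmfEntropy (q i) := by
  simp only [pmfEntropy_eq_sum_logb]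
  rw [Finset.sum_neg_distrib, neg_inj]
  have h : ∀ f : ι → α, blockLaw q f * Real.logb 2 (blockLaw q f) =
      ∑ i, (∏ j, q j (f j)) * Real.logb 2 (q i (f i)) := by
    intro f
    rw [← Finset.mul_sum]
    -- The logarithm of a product splits only when all factors are nonzero; otherwise both sides
    -- vanish.
    by_cases h0 : blockLaw q f = 0
    · unfold blockLaw at h0
      simp [blockLaw, h0]
    · unfold blockLaw at h0 ⊢
      rw [Real.logb_prod]
      intro i _ hi
      exact h0 (Finset.prod_eq_zero (Finset.mem_univ i) hi)
  simp only [h]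
  rw [Finset.sum_comm]
  exact Finset.sum_congr rfl fun i _ =>
    sum_prod_mul_eval q (fun i => (hq i).2) i (fun x => Real.logb 2 (q i x))

omit [Fintype β] in
theorem law_blockLaw_comp (q : ι → α → ℝ) (g : α → β) :
    law (blockLaw q) (fun f i => g (f i)) = blockLaw fun i => law (q i) g := by
  classical
  ext z
  unfold law blockLaw
  rw [Fintype.prod_sum]
  refine Finset.sum_congr rfl fun f _ => ?_
  split_ifs with h
  · subst h
    simp
  · obtain ⟨i, hi⟩ := Function.ne_iff.1 h
    exact (Finset.prod_eq_zero (Finset.mem_univ i) (if_neg hi)).symm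

theorem law_blockLaw_eval {q : ι → α → ℝ} (hq : ∀ i, ∑ x, q i x = 1) (i : ι) :
    law (blockLaw q) (fun f => f i) = q i := by
  classical
  ext x
  have := sum_prod_mul_eval q hq i (fun y => if y = x then 1 else 0)
  simp only [mul_ite, mul_one, mul_zero, Finset.sum_ite_eq', Finset.mem_univ, if_true] at this
  rw [← this]
  unfold law blockLaw
  exact Finset.sum_congr rfl fun f _ => by congr

end BlockLaw

/-! ### Messages sent over `n` uses of a memoryless channel. -/

section BlockChannel

variable {S X₁ X₂ Y Z γ : Type*} [Fintype S] [Fintype X₁] [Fintype X₂] [Fintype Y] [Fintype Z]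
  [Fintype γ] {n : ℕ}

/-- Joint law of a source `s` with law `r` and the outputs of `n` uses of the channel `W`, with the
codewords `x₁ s` and `x₂ s` as inputs. -/
def channelLaw (r : S → ℝ) (W : X₁ → X₂ → Y → ℝ) (x₁ : S → Fin n → X₁) (x₂ : S → Fin n → X₂) :
    S × (Fin n → Y) → ℝ :=
  fun ω => r ω.1 * blockLaw (fun j => W (x₁ ω.1 j) (x₂ ω.1 j)) ω.2

variable {r : S → ℝ} {W : X₁ → X₂ → Y → ℝ} {x₁ : S → Fin n → X₁} {x₂ : S → Fin n → X₂}

omit [Fintype X₁] [Fintype X₂] in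
theorem channelLaw_mem (hr : r ∈ stdSimplex ℝ S) (hW : ∀ a b, W a b ∈ stdSimplex ℝ Y) :
    channelLaw r W x₁ x₂ ∈ stdSimplex ℝ (S × (Fin n → Y)) := by
  refine ⟨fun ω => mul_nonneg (hr.1 _) ((blockLaw_mem fun j => hW _ _).1 _), ?_⟩
  simp only [channelLaw, Fintype.sum_prod_type, ← Finset.mul_sum,
    (blockLaw_mem fun j => hW _ _).2, mul_one, hr.2]

omit [Fintype X₁] [Fintype X₂] in
theorem law_channelLaw_output {β : Type*} (φ : (Fin n → Y) → β) (s : S) (z : β) :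
    law (channelLaw r W x₁ x₂) (fun ω => (ω.1, φ ω.2)) (s, z) =
      r s * law (blockLaw fun j => W (x₁ s j) (x₂ s j)) φ z := by
  classical
  unfold law channelLaw
  simp only [Fintype.sum_prod_type, Prod.mk.injEq, ite_and, Finset.mul_sum, mul_ite, mul_zero]
  simp only [Finset.sum_ite_eq', Finset.mem_univ, if_true, Finset.sum_ite_irrel,
      Finset.sum_const_zero]

omit [Fintype X₁] [Fintype X₂] in
theorem law_channelLaw_source (hW : ∀ a b, W a b ∈ stdSimplex ℝ Y) :
    law (channelLaw r W x₁ x₂) (fun ω => ω.1) = r := by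
  classical
  ext s
  unfold law channelLaw
  simp only [Fintype.sum_prod_type]
  simp [← Finset.mul_sum, (blockLaw_mem fun j => hW _ _).2]

/-- Given the source the outputs are independent, so the conditional entropy of the block is a sum
over times; averaging over the source leaves the noise under the law of the inputs at each time. -/
theorem entropy_channelLaw (hr : r ∈ stdSimplex ℝ S) (hW : ∀ a b, W a b ∈ stdSimplex ℝ Y)
    (g : Y → Z) :
    entropy (channelLaw r W x₁ x₂) (fun ω => (ω.1, fun i => g (ω.2 i))) =
      entropy (channelLaw r W x₁ x₂) (fun ω => ω.1) +
        ∑ i, noise (law r fun s => (x₁ s i, x₂ s i)) (fun a b => law (W a b) g) := by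
  have hl := law_channelLaw_source (r := r) (x₁ := x₁) (x₂ := x₂) hW
  rw [entropy_channel (fun ω : S × (Fin n → Y) => ω.1) (fun ω i => g (ω.2 i))
    (fun s => blockLaw fun j => law (W (x₁ s j) (x₂ s j)) g)
    (fun s _ => (blockLaw_mem fun j => law_mem (hW _ _) g).2) (channelLaw_mem hr hW).1]
  · congr 1
    simp only [hl, pmfEntropy_blockLaw fun j => law_mem (hW _ _) g, Finset.mul_sum]
    rw [Finset.sum_comm]
    refine Finset.sum_congr rfl fun i _ => ?_
    unfold noise
    rw [sum_law_mul r (fun s => (x₁ s i, x₂ s i)) (fun x => pmfEntropy (law (W x.1 x.2) g))]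
  · intro s z
    rw [law_channelLaw_output (fun y i => g (y i)), hl, law_blockLaw_comp]

/-- One use of the channel turns the law of the inputs into the law of inputs and output. -/
theorem law_channelLaw_letter (hW : ∀ a b, W a b ∈ stdSimplex ℝ Y) (g : Y → Z) (V : S → γ)
    {q : γ → ℝ} {a : γ → X₁ → ℝ} {b : γ → X₂ → ℝ} (i : Fin n)
    (h : ∀ v α β, law r (fun s => (V s, x₁ s i, x₂ s i)) (v, α, β) = q v * a v α * b v β) :
    law (channelLaw r W x₁ x₂) (fun ω => (V ω.1, x₁ ω.1 i, x₂ ω.1 i, g (ω.2 i))) =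
      superLaw q a b (fun a b => law (W a b) g) := by
  classical
  ext ⟨v, α, β, z⟩
  -- Only the source and one output letter matter, and their joint law involves a single use of the
  -- channel.
  have e := sum_law_mul (channelLaw r W x₁ x₂) (fun ω => (ω.1, g (ω.2 i)))
    (fun x => if (V x.1, x₁ x.1 i, x₂ x.1 i, x.2) = (v, α, β, z) then (1 : ℝ) else 0)
  have hev : ∀ s z, law (channelLaw r W x₁ x₂) (fun ω => (ω.1, g (ω.2 i))) (s, z) =
      r s * law (W (x₁ s i) (x₂ s i)) g z := by
    intro s z
    rw [law_channelLaw_output (fun y => g (y i)), ← law_law _ (fun y : Fin n → Y => y i),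
      law_blockLaw_eval (q := fun j => W (x₁ s j) (x₂ s j)) (fun j => (hW _ _).2)]
  have e2 := sum_law_mul r (fun s => (V s, x₁ s i, x₂ s i))
    (fun x => if x = (v, α, β) then law (W x.2.1 x.2.2) g z else 0)
  simp only [mul_ite, mul_zero, Finset.sum_ite_eq', Finset.mem_univ, if_true] at e2
  have e3 : law (channelLaw r W x₁ x₂) (fun ω => (V ω.1, x₁ ω.1 i, x₂ ω.1 i, g (ω.2 i)))
      (v, α, β, z) = ∑ ω, channelLaw r W x₁ x₂ ω *
        if (V ω.1, x₁ ω.1 i, x₂ ω.1 i, g (ω.2 i)) = (v, α, β, z) then (1 : ℝ) else 0 := by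
    unfold law
    simp only [mul_ite, mul_one, mul_zero]
    exact Finset.sum_congr rfl fun _ _ => by congr
  rw [e3, ← e, superLaw, ← h, e2, Fintype.sum_prod_type]
  refine Finset.sum_congr rfl fun s _ => ?_
  simp only [hev, Prod.mk.injEq]
  by_cases h' : V s = v ∧ x₁ s i = α ∧ x₂ s i = β
  · simp [h'.1, h'.2.1, h'.2.2]
  · rw [if_neg h']
    refine Finset.sum_eq_zero fun z' _ => ?_
    rw [if_neg (fun h2 => h' ⟨h2.1, h2.2.1, h2.2.2.1⟩), mul_zero]

end BlockChannel

/-! ### Single-letter converse bounds. -/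

section Converse

variable {S X₁ X₂ Y Z τ θ θ' : Type*} [Fintype S] [Fintype X₁] [Fintype X₂] [Fintype Y] [Fintype Z]
  [Fintype τ] [Fintype θ] [Fintype θ'] {n : ℕ}
  {r : S → ℝ} {W : X₁ → X₂ → Y → ℝ} {x₁ : S → Fin n → X₁} {x₂ : S → Fin n → X₂}

/-- Single-letter bound on the information about the source that is not contained in `Q`, when the
source is estimated from the outputs and from `T`. -/
theorem entropy_sub_le_sum_letter [Nonempty S] [DecidableEq S] (hr : r ∈ stdSimplex ℝ S)
    (hW : ∀ a b, W a b ∈ stdSimplex ℝ Y) (g : Y → Z) (T : S × (Fin n → Y) → τ)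
    (φ : (Fin n → Z) × τ → S) (Q : S → θ) (f : Fin n → θ → θ') :
    entropy (channelLaw r W x₁ x₂) (fun ω => ω.1) -
        entropy (channelLaw r W x₁ x₂) (fun ω => Q ω.1) ≤
      ∑ i, (entropy (channelLaw r W x₁ x₂) (fun ω => (f i (Q ω.1), g (ω.2 i))) -
        entropy (channelLaw r W x₁ x₂) (fun ω => f i (Q ω.1)) -
        noise (law r fun s => (x₁ s i, x₂ s i)) (fun a b => law (W a b) g)) +
      (entropy (channelLaw r W x₁ x₂) T + (1 +
        (∑ ω, if φ (fun i => g (ω.2 i), T ω) ≠ ω.1 then channelLaw r W x₁ x₂ ω else 0) *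
          Real.logb 2 (Fintype.card S))) := by
  have hp := channelLaw_mem (x₁ := x₁) (x₂ := x₂) hr hW
  have hent := entropy_channelLaw (x₁ := x₁) (x₂ := x₂) hr hW g
  set p := channelLaw r W x₁ x₂ with hpdef
  have hfano := fano hp (fun ω => ω.1) (fun ω => ((fun i => g (ω.2 i) : Fin n → Z), T ω)) φ
  -- Combined with Fano this gives `H(S, Zⁿ) ≤ H(Q, Zⁿ, T)` up to the error term. Separating `T`
  -- then costs at most its entropy.
  have h1 := entropy_submodular hp (fun ω => ω.1) (fun ω => Q ω.1)
    (fun ω => ((fun i => g (ω.2 i) : Fin n → Z), T ω))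
  have h2 := entropy_le_of_function hp.1
    (A := fun ω => (ω.1, Q ω.1, ((fun i => g (ω.2 i) : Fin n → Z), T ω)))
    (B := fun ω => (ω.1, (fun i => g (ω.2 i) : Fin n → Z)))
    (fun x => (x.1, x.2.2.1)) (fun _ => rfl)
  have h3 := entropy_prod_le hp (fun ω => ((fun i => g (ω.2 i) : Fin n → Z), Q ω.1)) T
  have h4 := entropy_le_of_function hp.1
    (A := fun ω => (((fun i => g (ω.2 i) : Fin n → Z), Q ω.1), T ω))
    (B := fun ω => (Q ω.1, ((fun i => g (ω.2 i) : Fin n → Z), T ω)))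
    (fun x => (x.1.2, x.1.1, x.2)) (fun _ => rfl)
  have h5 := entropy_block_le hp (fun ω => Q ω.1) n (fun ω i => g (ω.2 i))
  -- Conditioning a letter on a function of `Q` instead of `Q` can only raise its entropy; the
  -- function keeps what the single-letter formula mentions.
  have h6 : ∀ i, entropy p (fun ω => (g (ω.2 i), Q ω.1)) - entropy p (fun ω => Q ω.1) ≤
      entropy p (fun ω => (f i (Q ω.1), g (ω.2 i))) - entropy p (fun ω => f i (Q ω.1)) := by
    intro i
    have e1 := entropy_submodular hp (fun ω => g (ω.2 i)) (fun ω => Q ω.1) (fun ω => f i (Q ω.1))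
    have e2 := entropy_le_of_function hp.1
      (A := fun ω => (g (ω.2 i), Q ω.1, f i (Q ω.1))) (B := fun ω => (g (ω.2 i), Q ω.1))
      (fun x => (x.1, x.2.1)) (fun _ => rfl)
    have e3 := entropy_le_of_function hp.1
      (A := fun ω => Q ω.1) (B := fun ω => (Q ω.1, f i (Q ω.1)))
      (fun x => (x, f i x)) (fun _ => rfl)
    have e4 := entropy_le_of_function hp.1
      (A := fun ω => (f i (Q ω.1), g (ω.2 i))) (B := fun ω => (g (ω.2 i), f i (Q ω.1)))
      (fun x => (x.2, x.1)) (fun _ => rfl)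
    linarith
  have h7 := Finset.sum_le_sum fun i (_ : i ∈ Finset.univ) => h6 i
  rw [Finset.sum_sub_distrib (fun i => entropy p (fun ω => (f i (Q ω.1), g (ω.2 i))) -
    entropy p (fun ω => f i (Q ω.1)))]
  linarith

/-- The data of a converse argument: the encoders' transcript `V` makes the two channel inputs
conditionally independent, with conditional laws `a` and `b`. -/
structure SplitInputs (r : S → ℝ) (x₁ : S → Fin n → X₁) (x₂ : S → Fin n → X₂) (V : S → θ)
    (q : θ → ℝ) (a : Fin n → θ → X₁ → ℝ) (b : Fin n → θ → X₂ → ℝ) : Prop where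
  q_mem : q ∈ stdSimplex ℝ θ
  a_mem : ∀ i v, a i v ∈ stdSimplex ℝ X₁
  b_mem : ∀ i v, b i v ∈ stdSimplex ℝ X₂
  law_eq : ∀ i v α β, law r (fun s => (V s, x₁ s i, x₂ s i)) (v, α, β) = q v * a i v α * b i v β

variable {V : S → θ} {q : θ → ℝ} {a : Fin n → θ → X₁ → ℝ} {b : Fin n → θ → X₂ → ℝ}

theorem SplitInputs.law_inputs (h : SplitInputs r x₁ x₂ V q a b) (i : Fin n) :
    law r (fun s => (x₁ s i, x₂ s i)) = inputLaw q (a i) (b i) := by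
  ext x
  rw [← sum_law_prod_left r V (fun s => (x₁ s i, x₂ s i)) x]
  exact Finset.sum_congr rfl fun v _ => by rw [h.law_eq, prodPmf, mul_assoc]

variable [Nonempty S] [DecidableEq S] (h : SplitInputs r x₁ x₂ V q a b) (hr : r ∈ stdSimplex ℝ S)
  (hW : ∀ a b, W a b ∈ stdSimplex ℝ Y) (g : Y → Z) (T : S × (Fin n → Y) → τ)
  (φ : (Fin n → Z) × τ → S)

include h hr hW

/-- The receiver is granted the transcript and the message of encoder 2, hence also `x₂`. What it
still has to learn about the source must pass through `x₁`; at each time only the letter of `x₂` and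
the transcript are retained. -/
theorem SplitInputs.rate₁_bound {M : Type*} [Fintype M] (w : S → M) (k : M → θ → Fin n → X₂)
    (hk : ∀ s, x₂ s = k (w s) (V s)) :
    entropy (channelLaw r W x₁ x₂) (fun ω => ω.1) -
        entropy (channelLaw r W x₁ x₂) (fun ω => (w ω.1, V ω.1)) ≤
      ∑ i, ∑ v, q v * rate₁ (a i v) (b i v) (fun a b => law (W a b) g) +
      (entropy (channelLaw r W x₁ x₂) T + (1 +
        (∑ ω, if φ (fun i => g (ω.2 i), T ω) ≠ ω.1 then channelLaw r W x₁ x₂ ω else 0) *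
          Real.logb 2 (Fintype.card S))) := by
  have := entropy_sub_le_sum_letter (x₁ := x₁) (x₂ := x₂) hr hW g T φ (fun s => (w s, V s))
    (fun i x => (k x.1 x.2 i, x.2))
  simp only [← hk] at this
  refine this.trans (add_le_add_left (Finset.sum_le_sum fun i _ => ?_) _)
  have hl := law_channelLaw_letter hW g V i (h.law_eq i)
  have hK : ∀ a b, law (W a b) g ∈ stdSimplex ℝ Z := fun a b => law_mem (hW a b) g
  rw [entropy_of_law_eq_superLaw hl (fun x => ((x.2.2.1, x.1), x.2.2.2)),
    entropy_of_law_eq_superLaw hl (fun x => (x.2.2.1, x.1)), h.law_inputs, noise_inputLaw,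
    entropy_superLaw₂ h.q_mem (h.a_mem i) (h.b_mem i) hK]
  simp only [rate₁, mul_sub, Finset.sum_sub_distrib]
  linarith

theorem SplitInputs.rate₂_bound {M : Type*} [Fintype M] (w : S → M) (k : M → θ → Fin n → X₁)
    (hk : ∀ s, x₁ s = k (w s) (V s)) :
    entropy (channelLaw r W x₁ x₂) (fun ω => ω.1) -
        entropy (channelLaw r W x₁ x₂) (fun ω => (w ω.1, V ω.1)) ≤
      ∑ i, ∑ v, q v * rate₂ (a i v) (b i v) (fun a b => law (W a b) g) +
      (entropy (channelLaw r W x₁ x₂) T + (1 +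
        (∑ ω, if φ (fun i => g (ω.2 i), T ω) ≠ ω.1 then channelLaw r W x₁ x₂ ω else 0) *
          Real.logb 2 (Fintype.card S))) := by
  have := entropy_sub_le_sum_letter (x₁ := x₁) (x₂ := x₂) hr hW g T φ (fun s => (w s, V s))
    (fun i x => (k x.1 x.2 i, x.2))
  simp only [← hk] at this
  refine this.trans (add_le_add_left (Finset.sum_le_sum fun i _ => ?_) _)
  have hl := law_channelLaw_letter hW g V i (h.law_eq i)
  have hK : ∀ a b, law (W a b) g ∈ stdSimplex ℝ Z := fun a b => law_mem (hW a b) g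
  rw [entropy_of_law_eq_superLaw hl (fun x => ((x.2.1, x.1), x.2.2.2)),
    entropy_of_law_eq_superLaw hl (fun x => (x.2.1, x.1)), h.law_inputs, noise_inputLaw,
    entropy_superLaw₁ h.q_mem (h.a_mem i) (h.b_mem i) hK]
  simp only [rate₂, mul_sub, Finset.sum_sub_distrib]
  linarith

/-- Only the transcript is granted, so both inputs carry information. -/
theorem SplitInputs.rateSum_bound :
    entropy (channelLaw r W x₁ x₂) (fun ω => ω.1) -
        entropy (channelLaw r W x₁ x₂) (fun ω => V ω.1) ≤
      ∑ i, ∑ v, q v * rateSum (prodPmf (a i v) (b i v)) (fun a b => law (W a b) g) +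
      (entropy (channelLaw r W x₁ x₂) T + (1 +
        (∑ ω, if φ (fun i => g (ω.2 i), T ω) ≠ ω.1 then channelLaw r W x₁ x₂ ω else 0) *
          Real.logb 2 (Fintype.card S))) := by
  refine (entropy_sub_le_sum_letter (x₁ := x₁) (x₂ := x₂) hr hW g T φ V (fun i x => x)).trans
    (add_le_add_left (Finset.sum_le_sum fun i _ => ?_) _)
  have hl := law_channelLaw_letter hW g V i (h.law_eq i)
  have hK : ∀ a b, law (W a b) g ∈ stdSimplex ℝ Z := fun a b => law_mem (hW a b) g
  rw [entropy_of_law_eq_superLaw hl (fun x => (x.1, x.2.2.2)),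
    entropy_of_law_eq_superLaw hl (fun x => x.1), h.law_inputs, noise_inputLaw,
    entropy_superLaw₀ h.q_mem (h.a_mem i) (h.b_mem i) hK]
  simp only [rateSum, mul_sub, Finset.sum_sub_distrib]
  linarith

/-- Nothing is granted (`Q` is constant), so the input pair enters through its unconditional law and
no auxiliary variable remains. -/
theorem SplitInputs.total_bound :
    entropy (channelLaw r W x₁ x₂) (fun ω => ω.1) ≤
      ∑ i, rateSum (inputLaw q (a i) (b i)) (fun a b => law (W a b) g) +
      (entropy (channelLaw r W x₁ x₂) T + (1 +
        (∑ ω, if φ (fun i => g (ω.2 i), T ω) ≠ ω.1 then channelLaw r W x₁ x₂ ω else 0) *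
          Real.logb 2 (Fintype.card S))) := by
  have hp := channelLaw_mem (x₁ := x₁) (x₂ := x₂) hr hW
  have := entropy_sub_le_sum_letter (x₁ := x₁) (x₂ := x₂) hr hW g T φ (fun _ => ()) (fun i x => x)
  rw [entropy_unit hp, sub_zero] at this
  refine this.trans (add_le_add_left (Finset.sum_le_sum fun i _ => ?_) _)
  have hl := law_channelLaw_letter hW g V i (h.law_eq i)
  rw [h.law_inputs, rateSum, ← entropy_superLaw_output,
    ← entropy_of_law_eq_superLaw hl (fun x => x.2.2.2), sub_zero,
    entropy_congr hp.1 (A := fun ω => ((), g (ω.2 i))) (B := fun ω => g (ω.2 i))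
      (fun x => x.2) (fun x => ((), x)) (fun _ => rfl) (fun _ => rfl)]

end Converse

/-! ### Concavity of mutual information in the input law. -/

section Concavity

variable {X₁ X₂ Z ι : Type*} [Fintype X₁] [Fintype X₂] [Fintype Z] [Fintype ι]

theorem pmfEntropy_concave {w : ι → ℝ} (hw : w ∈ stdSimplex ℝ ι) {ρ : ι → Z → ℝ}
    (hρ : ∀ i z, 0 ≤ ρ i z) :
    ∑ i, w i * pmfEntropy (ρ i) ≤ pmfEntropy (fun z => ∑ i, w i * ρ i z) := by
  unfold pmfEntropy
  simp only [← mul_div_assoc, ← Finset.sum_div, Finset.mul_sum]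
  refine div_le_div_of_nonneg_right ?_ (Real.log_nonneg one_le_two)
  rw [Finset.sum_comm]
  refine Finset.sum_le_sum fun z _ => ?_
  have := Real.concaveOn_negMulLog.le_map_sum (t := Finset.univ) (w := w) (p := fun i => ρ i z)
    (fun i _ => hw.1 i) hw.2 (fun i _ => hρ i z)
  simpa using this

/-- Mutual information is concave in the law of the input. -/
theorem rateSum_concave {w : ι → ℝ} (hw : w ∈ stdSimplex ℝ ι) {π : ι → X₁ × X₂ → ℝ}
    (hπ : ∀ i x, 0 ≤ π i x) {K : X₁ → X₂ → Z → ℝ} (hK : ∀ a b z, 0 ≤ K a b z) :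
    ∑ i, w i * rateSum (π i) K ≤ rateSum (fun x => ∑ i, w i * π i x) K := by
  have h := pmfEntropy_concave hw (ρ := fun i => mix (π i) K)
    (fun i z => Finset.sum_nonneg fun x _ => mul_nonneg (hπ i x) (hK _ _ _))
  have e1 : mix (fun x => ∑ i, w i * π i x) K = fun z => ∑ i, w i * mix (π i) K z := by
    ext z
    simp only [mix, Finset.sum_mul, Finset.mul_sum]
    rw [Finset.sum_comm]
    simp only [mul_assoc]
  -- The noise is linear in the input law, so the concavity comes entirely from the output entropy.
  have e2 : noise (fun x => ∑ i, w i * π i x) K = ∑ i, w i * noise (π i) K := by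
    simp only [noise, Finset.sum_mul, Finset.mul_sum]
    rw [Finset.sum_comm]
    simp only [mul_assoc]
  unfold rateSum
  rw [e1, e2]
  simp only [mul_sub, Finset.sum_sub_distrib]
  linarith

end Concavity

/-! ### Rectangle structure of conference transcripts. -/

namespace Conference

variable {S₁ S₂ : Type*} (c : Conference S₁ S₂)

/-- The pairs of observations that lead to a given transcript form a rectangle. -/
theorem exchange_rectangle {s₁ s₁' : S₁} {s₂ s₂' : S₂} (h : c.exchange s₁ s₂ = c.exchange s₁' s₂') :
    c.exchange s₁ s₂' = c.exchange s₁ s₂ := by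
  -- Induction on the round. For the mixed pair `(s₁, s₂')`, party 1 sees the same past as under
  -- `(s₁, s₂)` and party 2 the same past as under `(s₁', s₂')`; both pasts come from the common
  -- transcript, so each party repeats its symbol.
  have key : ∀ m : ℕ, ∀ k : Fin c.rounds, (k : ℕ) < m →
      c.exchange s₁ s₂' k = c.exchange s₁ s₂ k := by
    intro m
    induction m with
    | zero => intro k hk; omega
    | succ m ih =>
      intro k hk
      have hj : ∀ j : Fin c.rounds, j < k → c.exchange s₁ s₂' j = c.exchange s₁ s₂ j :=
        fun j hj => ih j (by have : (j : ℕ) < k := hj; omega)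
      refine Prod.ext ?_ ?_
      · have e : (fun (j : Fin c.rounds) (_ : j < k) => (c.exchange s₁ s₂' j).2) =
            fun j _ => (c.exchange s₁ s₂ j).2 := by
          funext j hjk; rw [hj j hjk]
        rw [exchange, exchange]
        exact congrArg (c.send₁ k s₁) e
      · have e : (fun (j : Fin c.rounds) (_ : j < k) => (c.exchange s₁ s₂' j).1) =
            fun j _ => (c.exchange s₁' s₂' j).1 := by
          funext j hjk; rw [hj j hjk, h]
        rw [h, exchange, exchange]
        exact congrArg (c.send₂ k s₂') e
  funext k
  exact key (k + 1) k (Nat.lt_succ_self _)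

end Conference

/-! ### Conditional independence of the inputs given the transcript. -/

section Rectangles

open scoped Classical in
-- The empirical law of `f` on `A`. For empty `A` both sides vanish and any law will do, which is
-- why `X` has to be nonempty: some values of a transcript may never occur.
theorem exists_conditional_law {α X : Type*} [Fintype X] [Nonempty X] (A : Finset α) (f : α → X) :
    ∃ a ∈ stdSimplex ℝ X, ∀ x, ∑ w ∈ A, (if f w = x then (1 : ℝ) else 0) = A.card * a x := by
  rcases A.eq_empty_or_nonempty with rfl | hA
  · exact ⟨Pi.single (Classical.arbitrary X) 1, single_mem_stdSimplex ℝ _, by simp⟩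
  · have hc : (0 : ℝ) < A.card := by exact_mod_cast hA.card_pos
    refine ⟨fun x => (∑ w ∈ A, (if f w = x then (1 : ℝ) else 0)) / A.card, ⟨fun x => ?_, ?_⟩,
      fun x => by field_simp⟩
    · exact div_nonneg (Finset.sum_nonneg fun w _ => by split_ifs <;> simp) hc.le
    · rw [← Finset.sum_div, Finset.sum_comm]
      simp [hc.ne']

/-- Independent uniform messages are conditionally independent given a random variable whose level
sets are rectangles. -/
theorem exists_splitInputs {α β θ X₁ X₂ : Type*} [Fintype α] [Fintype β] [Nonempty α] [Nonempty β]
    [Fintype θ] [Fintype X₁] [Fintype X₂] [Nonempty X₁] [Nonempty X₂] {n : ℕ} (V : α × β → θ)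
    (hV : ∀ w₁ w₂ w₁' w₂', V (w₁, w₂) = V (w₁', w₂') → V (w₁, w₂') = V (w₁, w₂))
    (k₁ : α → θ → Fin n → X₁) (k₂ : β → θ → Fin n → X₂) :
    ∃ q a b, SplitInputs (fun _ : α × β => ((Fintype.card α : ℝ) * Fintype.card β)⁻¹)
      (fun s => k₁ s.1 (V s)) (fun s => k₂ s.2 (V s)) V q a b := by
  classical
  set r : ℝ := ((Fintype.card α : ℝ) * Fintype.card β)⁻¹ with hr
  have hrmem : (fun _ : α × β => r) ∈ stdSimplex ℝ (α × β) := by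
    refine ⟨fun _ => by positivity, ?_⟩
    have h1 : (Fintype.card α : ℝ) ≠ 0 := by exact_mod_cast Fintype.card_ne_zero
    have h2 : (Fintype.card β : ℝ) ≠ 0 := by exact_mod_cast Fintype.card_ne_zero
    simp [hr]
    field_simp
  -- The two projections of a level set of `V`; since the level set is a rectangle, it is the
  -- product of its projections.
  set A : θ → Finset α := fun v => Finset.univ.filter fun w₁ => ∃ w₂, V (w₁, w₂) = v with hA
  set B : θ → Finset β := fun v => Finset.univ.filter fun w₂ => ∃ w₁, V (w₁, w₂) = v with hB
  have hAB : ∀ v w₁ w₂, V (w₁, w₂) = v ↔ w₁ ∈ A v ∧ w₂ ∈ B v := by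
    intro v w₁ w₂
    simp only [hA, hB, Finset.mem_filter, Finset.mem_univ, true_and]
    constructor
    · exact fun h => ⟨⟨w₂, h⟩, ⟨w₁, h⟩⟩
    · rintro ⟨⟨w₂', h⟩, ⟨w₁', h'⟩⟩
      rw [hV w₁ w₂' w₁' w₂ (h.trans h'.symm), h]
  choose a ha ha' using fun (i : Fin n) (v : θ) => exists_conditional_law (A v) (fun w => k₁ w v i)
  choose b hb hb' using fun (i : Fin n) (v : θ) => exists_conditional_law (B v) (fun w => k₂ w v i)
  have hq : ∀ v, law (fun _ : α × β => r) V v = r * ((A v).card * (B v).card) := by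
    intro v
    simp only [law, Fintype.sum_prod_type, hAB v, ite_and]
    simp [Finset.sum_ite_irrel]
    ring
  refine ⟨law (fun _ => r) V, a, b, law_mem hrmem V, ha, hb, fun i v x₁ x₂ => ?_⟩
  -- The number of message pairs in the rectangle that produce the letters `x₁` and `x₂` is a
  -- product of two counts, because `V` is constant there.
  calc law (fun _ : α × β => r) (fun s => (V s, k₁ s.1 (V s) i, k₂ s.2 (V s) i)) (v, x₁, x₂)
      = r * ((∑ w ∈ A v, (if k₁ w v i = x₁ then (1 : ℝ) else 0)) *
          ∑ w ∈ B v, (if k₂ w v i = x₂ then (1 : ℝ) else 0)) := by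
        rw [Finset.sum_mul_sum, Finset.mul_sum]
        simp only [law, Fintype.sum_prod_type, Prod.mk.injEq]
        rw [← Finset.sum_subset (Finset.subset_univ (A v))]
        · refine Finset.sum_congr rfl fun w₁ h₁ => ?_
          rw [Finset.mul_sum, ← Finset.sum_subset (Finset.subset_univ (B v))]
          · refine Finset.sum_congr rfl fun w₂ h₂ => ?_
            have := (hAB v w₁ w₂).2 ⟨h₁, h₂⟩
            simp only [this, true_and]
            by_cases e₁ : k₁ w₁ v i = x₁ <;> by_cases e₂ : k₂ w₂ v i = x₂ <;> simp [e₁, e₂]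
          · intro w₂ _ h₂
            exact if_neg fun h => h₂ ((hAB v w₁ w₂).1 h.1).2
        · intro w₁ _ h₁
          exact Finset.sum_eq_zero fun w₂ _ => if_neg fun h => h₁ ((hAB v w₁ w₂).1 h.1).1
    _ = law (fun _ : α × β => r) V v * a i v x₁ * b i v x₂ := by
        rw [ha', hb', hq]
        ring

end Rectangles

/-! ### The uniform time index as part of the auxiliary variable. -/

section Timesharing

variable {S X₁ X₂ Y Z τ θ M₁ M₂ : Type*} [Fintype S] [Fintype X₁] [Fintype X₂] [Fintype Y]
  [Fintype Z] [Fintype τ] [Fintype θ] [Fintype M₁] [Fintype M₂] {n : ℕ}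
  {r : S → ℝ} {W : X₁ → X₂ → Y → ℝ} {x₁ : S → Fin n → X₁} {x₂ : S → Fin n → X₂}
  {V : S → θ} {q : θ → ℝ} {a : Fin n → θ → X₁ → ℝ} {b : Fin n → θ → X₂ → ℝ}

/-- Law of the auxiliary variable that consists of the transcript and of a uniform time index. -/
noncomputable def timeLaw {θ : Type*} (n : ℕ) (q : θ → ℝ) : Fin n × θ → ℝ :=
  fun x => (n : ℝ)⁻¹ * q x.2

theorem timeLaw_mem (hn : 0 < n) (hq : q ∈ stdSimplex ℝ θ) :
    timeLaw n q ∈ stdSimplex ℝ (Fin n × θ) := by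
  have : (n : ℝ) ≠ 0 := by exact_mod_cast hn.ne'
  refine ⟨fun x => mul_nonneg (by positivity) (hq.1 _), ?_⟩
  simp [timeLaw, Fintype.sum_prod_type, ← Finset.mul_sum, hq.2, this]

theorem sum_timeLaw {m : ℕ} (e : Fin m ≃ Fin n × θ) (F : Fin n → θ → ℝ) :
    ∑ u, timeLaw n q (e u) * F (e u).1 (e u).2 = (n : ℝ)⁻¹ * ∑ i, ∑ v, q v * F i v := by
  rw [e.sum_comp (fun x => timeLaw n q x * F x.1 x.2), Fintype.sum_prod_type, Finset.mul_sum]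
  simp only [timeLaw, Finset.mul_sum, mul_assoc]

/-- The rate constraints of a receiver that can decode the source. -/
theorem SplitInputs.rateBounds [Nonempty S] [DecidableEq S] (h : SplitInputs r x₁ x₂ V q a b)
    (hr : r ∈ stdSimplex ℝ S) (hW : ∀ a b, W a b ∈ stdSimplex ℝ Y) (hn : 0 < n)
    (w₁ : S → M₁) (w₂ : S → M₂) (k₁ : M₁ → θ → Fin n → X₁) (k₂ : M₂ → θ → Fin n → X₂)
    (hk₁ : ∀ s, x₁ s = k₁ (w₁ s) (V s)) (hk₂ : ∀ s, x₂ s = k₂ (w₂ s) (V s))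
    {m : ℕ} (e : Fin m ≃ Fin n × θ) {R₀ R₁ R₂ C η : ℝ}
    (h₁ : n * R₁ ≤ entropy r id - entropy r (fun s => (w₂ s, V s)))
    (h₂ : n * R₂ ≤ entropy r id - entropy r (fun s => (w₁ s, V s)))
    (h₃ : n * (R₁ + R₂) ≤ entropy r id - entropy r V)
    (h₀ : n * (R₀ + R₁ + R₂) ≤ entropy r id)
    (g : Y → Z) (T : S × (Fin n → Y) → τ) (φ : (Fin n → Z) × τ → S)
    (hT : entropy (channelLaw r W x₁ x₂) T ≤ n * C)
    (hη : 1 + (∑ ω, if φ (fun i => g (ω.2 i), T ω) ≠ ω.1 then channelLaw r W x₁ x₂ ω else 0) *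
      Real.logb 2 (Fintype.card S) ≤ n * η) :
    RateBounds (fun u => timeLaw n q (e u)) (fun u => a (e u).1 (e u).2)
      (fun u => b (e u).1 (e u).2) (fun a b => law (W a b) g) (C + η) R₀ R₁ R₂ := by
  have hn' : (0 : ℝ) < n := by exact_mod_cast hn
  have hsrc := law_channelLaw_source (r := r) (x₁ := x₁) (x₂ := x₂) hW
  have b₁ := h.rate₁_bound hr hW g T φ w₂ k₂ hk₂
  have b₂ := h.rate₂_bound hr hW g T φ w₁ k₁ hk₁
  have b₃ := h.rateSum_bound hr hW g T φ
  have b₀ := h.total_bound hr hW g T φ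
  have c₁ := entropy_law (channelLaw r W x₁ x₂) (fun ω => ω.1) (fun s => (w₂ s, V s))
  have c₂ := entropy_law (channelLaw r W x₁ x₂) (fun ω => ω.1) (fun s => (w₁ s, V s))
  have c₃ := entropy_law (channelLaw r W x₁ x₂) (fun ω => ω.1) V
  have c₀ := entropy_law (channelLaw r W x₁ x₂) (fun ω => ω.1) (id : S → S)
  rw [hsrc] at c₁ c₂ c₃ c₀
  simp only [id] at c₀
  change entropy r id = _ at c₀
  rw [← c₀, ← c₁] at b₁
  rw [← c₀, ← c₂] at b₂
  rw [← c₀, ← c₃] at b₃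
  rw [← c₀] at b₀
  have key : ∀ R I : ℝ, n * R ≤ I + (n * C + n * η) → R ≤ (n : ℝ)⁻¹ * I + (C + η) := by
    intro R I hRI
    have : (n : ℝ) * R ≤ n * ((n : ℝ)⁻¹ * I + (C + η)) := by
      rw [mul_add, mul_inv_cancel_left₀ hn'.ne']
      linarith
    exact le_of_mul_le_mul_left this hn'
  refine ⟨?_, ?_, ?_, ?_⟩
  · rw [sum_timeLaw e (fun i v => rate₁ (a i v) (b i v) _)]
    exact key _ _ (by linarith)
  · rw [sum_timeLaw e (fun i v => rate₂ (a i v) (b i v) _)]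
    exact key _ _ (by linarith)
  · rw [sum_timeLaw e (fun i v => rateSum (prodPmf (a i v) (b i v)) _)]
    exact key _ _ (by linarith)
  -- The last bound is not conditioned on `U`, so the average over time does not become a rate by
  -- itself; concavity bounds it by the rate of the averaged input law.
  · have hcon := rateSum_concave (K := fun a b => law (W a b) g) (w := fun _ : Fin n => (n : ℝ)⁻¹)
      (π := fun i => inputLaw q (a i) (b i))
      ⟨fun _ => by positivity, by simp [hn'.ne']⟩
      (fun i => (inputLaw_mem h.q_mem (h.a_mem i) (h.b_mem i)).1)
      (fun x y => (law_mem (hW x y) g).1)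
    have hin : inputLaw (fun u => timeLaw n q (e u)) (fun u => a (e u).1 (e u).2)
        (fun u => b (e u).1 (e u).2) = fun x => ∑ i, (n : ℝ)⁻¹ * inputLaw q (a i) (b i) x := by
      ext x
      unfold inputLaw
      rw [sum_timeLaw e (fun i v => prodPmf (a i v) (b i v) x), Finset.mul_sum]
    rw [hin]
    rw [← Finset.mul_sum] at hcon
    have := key (R₀ + R₁ + R₂) _ (by linarith : _ ≤ ∑ i, rateSum (inputLaw q (a i) (b i))
      (fun a b => law (W a b) g) + (n * C + n * η))
    linarith

end Timesharing

/-! ### The converse for one conferencing code. -/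

section CodeConverse

/-- Entropy of a tuple of symbols. -/
theorem entropy_tuple_le {Ω : Type*} [Fintype Ω] {p : Ω → ℝ} (hp : p ∈ stdSimplex ℝ Ω) {K : ℕ}
    {d : Fin K → ℕ} (T : Ω → (k : Fin K) → Fin (d k)) :
    entropy p T ≤ ∑ k, Real.logb 2 (d k) := by
  have hΩ : Nonempty Ω := by
    by_contra h
    rw [not_nonempty_iff] at h
    have := hp.2
    simp at this
  -- No alphabet is empty, since `T` takes a value in each of them; this lets the logarithm of the
  -- product split.
  have hd : ∀ k, (d k : ℝ) ≠ 0 := by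
    intro k h
    have : d k = 0 := by exact_mod_cast h
    have t := T (Classical.arbitrary Ω) k
    rw [this] at t
    exact t.elim0
  refine (entropy_le_logb_card hp T).trans_eq ?_
  rw [Fintype.card_pi, Nat.cast_prod, Real.logb_prod]
  · simp
  · intro k _
    simpa using hd k

theorem entropy_uniform {S : Type*} [Fintype S] [Nonempty S] :
    entropy (fun _ : S => (Fintype.card S : ℝ)⁻¹) id = Real.logb 2 (Fintype.card S) := by
  classical
  have hc : (Fintype.card S : ℝ) ≠ 0 := by exact_mod_cast Fintype.card_ne_zero
  have hl : law (fun _ : S => (Fintype.card S : ℝ)⁻¹) id = fun _ => (Fintype.card S : ℝ)⁻¹ := by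
    ext s
    simp [law]
  rw [entropy_eq_sum_logb, hl]
  simp [Real.logb_inv, hc]

variable {X₁ X₂ Y₁ Y₂ : Type*} [Fintype X₁] [Fintype X₂] [Fintype Y₁] [Fintype Y₂]
  {M₁ M₂ n : ℕ}

omit [Fintype X₁] [Fintype X₂] in
/-- The error probability of a code in terms of the joint law of messages and output blocks. -/
theorem Code.errorProb_eq (c : Code X₁ X₂ Y₁ Y₂ M₁ M₂ n) (W : X₁ → X₂ → stdSimplex ℝ (Y₁ × Y₂)) :
    c.errorProb W = ∑ ω : (Fin M₁ × Fin M₂) × (Fin n → Y₁ × Y₂),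
      if c.estimate₁ (fun i => (ω.2 i).1) (fun i => (ω.2 i).2) ≠ ω.1 ∨
        c.estimate₂ (fun i => (ω.2 i).1) (fun i => (ω.2 i).2) ≠ ω.1 then
        channelLaw (fun _ => ((Fintype.card (Fin M₁) : ℝ) * Fintype.card (Fin M₂))⁻¹)
          (fun x₁ x₂ => W x₁ x₂) (fun s => c.codeword₁ s.1 s.2) (fun s => c.codeword₂ s.1 s.2) ω
      else 0 := by
  unfold Code.errorProb channelLaw blockLaw
  rw [Fintype.sum_prod_type, Fintype.sum_prod_type, Finset.mul_sum]
  refine Finset.sum_congr rfl fun w₁ _ => ?_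
  rw [Finset.mul_sum]
  refine Finset.sum_congr rfl fun w₂ _ => ?_
  rw [← (Equiv.arrowProdEquivProdArrow (Fin n) (fun _ => Y₁) (fun _ => Y₂)).symm.sum_comp,
    Fintype.sum_prod_type, Finset.mul_sum]
  refine Finset.sum_congr rfl fun y₁ _ => ?_
  rw [Finset.mul_sum]
  refine Finset.sum_congr rfl fun y₂ _ => ?_
  rw [mul_ite, mul_zero, one_div, Fintype.card_fin, Fintype.card_fin]
  rfl

/-- The converse for a single code. -/
theorem Code.exists_rateBounds [Nonempty X₁] [Nonempty X₂] (c : Code X₁ X₂ Y₁ Y₂ M₁ M₂ n)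
    (W : X₁ → X₂ → stdSimplex ℝ (Y₁ × Y₂)) (hM₁ : 0 < M₁) (hM₂ : 0 < M₂) (hn : 0 < n)
    {B₁₂ B₂₁ C₁₂ C₂₁ : ℝ} (henc : c.encConf.WithinBudget n B₁₂ B₂₁)
    (hdec : c.decConf.WithinBudget n C₁₂ C₂₁)
    {R₀ R₁ R₂ η : ℝ}
    (h₁ : n * R₁ ≤ max 0 (Real.logb 2 M₁ - n * B₁₂))
    (h₂ : n * R₂ ≤ max 0 (Real.logb 2 M₂ - n * B₂₁))
    (h₀ : n * (R₀ + R₁ + R₂) ≤ Real.logb 2 M₁ + Real.logb 2 M₂)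
    (hη : 1 + c.errorProb W * (Real.logb 2 M₁ + Real.logb 2 M₂) ≤ n * η) :
    ∃ (m : ℕ) (q : stdSimplex ℝ (Fin m)) (a : Fin m → stdSimplex ℝ X₁)
      (b : Fin m → stdSimplex ℝ X₂),
      RateBounds q (fun u => a u) (fun u => b u) (receiver W Prod.fst) (C₂₁ + η) R₀ R₁ R₂ ∧
      RateBounds q (fun u => a u) (fun u => b u) (receiver W Prod.snd) (C₁₂ + η) R₀ R₁ R₂ ∧
      RateBounds q (fun u => a u) (fun u => b u) (receiver W id) (0 + η) R₀ R₁ R₂ := by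
  have : Nonempty (Fin M₁) := ⟨⟨0, hM₁⟩⟩
  have : Nonempty (Fin M₂) := ⟨⟨0, hM₂⟩⟩
  have hM₁' : (M₁ : ℝ) ≠ 0 := by exact_mod_cast hM₁.ne'
  have hM₂' : (M₂ : ℝ) ≠ 0 := by exact_mod_cast hM₂.ne'
  have hn' : (0 : ℝ) < n := by exact_mod_cast hn
  set V : Fin M₁ × Fin M₂ → ((k : Fin c.encConf.rounds) →
    Fin (c.encConf.card₁ k) × Fin (c.encConf.card₂ k)) :=
    fun s => c.encConf.exchange s.1 s.2 with hV
  set k₁ : Fin M₁ → ((k : Fin c.encConf.rounds) →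
    Fin (c.encConf.card₁ k) × Fin (c.encConf.card₂ k)) → Fin n → X₁ :=
    fun w v => c.enc₁ w (fun k => (v k).2) with hk₁
  set k₂ : Fin M₂ → ((k : Fin c.encConf.rounds) →
    Fin (c.encConf.card₁ k) × Fin (c.encConf.card₂ k)) → Fin n → X₂ :=
    fun w v => c.enc₂ w (fun k => (v k).1) with hk₂
  obtain ⟨q, a, b, hs⟩ := exists_splitInputs V
    (fun w₁ w₂ w₁' w₂' h => c.encConf.exchange_rectangle h) k₁ k₂
  set r : Fin M₁ × Fin M₂ → ℝ :=
    fun _ => ((Fintype.card (Fin M₁) : ℝ) * Fintype.card (Fin M₂))⁻¹ with hr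
  have hru : r = fun _ => (Fintype.card (Fin M₁ × Fin M₂) : ℝ)⁻¹ := by
    rw [hr, Fintype.card_prod]
    push_cast
    rfl
  have hrm : r ∈ stdSimplex ℝ (Fin M₁ × Fin M₂) := by
    rw [hru]
    refine ⟨fun _ => by positivity, ?_⟩
    have : (Fintype.card (Fin M₁ × Fin M₂) : ℝ) ≠ 0 := by exact_mod_cast Fintype.card_ne_zero
    simp only [Finset.sum_const, Finset.card_univ, nsmul_eq_mul]
    exact mul_inv_cancel₀ this
  have hlogcard : Real.logb 2 (Fintype.card (Fin M₁ × Fin M₂)) =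
      Real.logb 2 M₁ + Real.logb 2 M₂ := by
    rw [Fintype.card_prod, Fintype.card_fin, Fintype.card_fin, Nat.cast_mul,
      Real.logb_mul hM₁' hM₂']
  have hHs : entropy r id = Real.logb 2 M₁ + Real.logb 2 M₂ := by
    rw [hru, entropy_uniform, hlogcard]
  have hW : ∀ x₁ x₂, (W x₁ x₂ : Y₁ × Y₂ → ℝ) ∈ stdSimplex ℝ (Y₁ × Y₂) := fun x₁ x₂ => (W x₁ x₂).2
  have hp := channelLaw_mem (x₁ := fun s => k₁ s.1 (V s)) (x₂ := fun s => k₂ s.2 (V s)) hrm hW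
  have hs₁ := entropy_tuple_le hrm (fun s => c.encConf.sent₁ s.1 s.2)
  have hs₂ := entropy_tuple_le hrm (fun s => c.encConf.sent₂ s.1 s.2)
  have hw₁ := entropy_le_logb_card hrm (fun s => s.1)
  have hw₂ := entropy_le_logb_card hrm (fun s => s.2)
  rw [Fintype.card_fin] at hw₁ hw₂
  -- the messages given the transcript
  have hV₂ : entropy r (fun s => (s.2, V s)) ≤ n * B₁₂ + Real.logb 2 M₂ := by
    have e1 := entropy_prod_le hrm (fun s => c.encConf.sent₁ s.1 s.2) (fun s => s.2)
    -- Encoder 2's symbols can be recomputed from its message and the symbols of encoder 1, so only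
    -- the latter are charged.
    have e2 := entropy_le_of_function hrm.1 (A := fun s => (c.encConf.sent₁ s.1 s.2, s.2))
      (B := fun s => (s.2, V s))
      (fun x => (x.2, fun k => (x.1 k, c.encConf.send₂ k x.2 (fun j _ => x.1 j))))
      (fun s => Prod.ext rfl (funext fun k => Prod.ext rfl (c.encConf.sent₂_eq s.1 s.2 k)))
    linarith [henc.1]
  have hV₁ : entropy r (fun s => (s.1, V s)) ≤ n * B₂₁ + Real.logb 2 M₁ := by
    have e1 := entropy_prod_le hrm (fun s => c.encConf.sent₂ s.1 s.2) (fun s => s.1)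
    have e2 := entropy_le_of_function hrm.1 (A := fun s => (c.encConf.sent₂ s.1 s.2, s.1))
      (B := fun s => (s.1, V s))
      (fun x => (x.2, fun k => (c.encConf.send₁ k x.2 (fun j _ => x.1 j), x.1 k)))
      (fun s => Prod.ext rfl (funext fun k => Prod.ext (c.encConf.sent₁_eq s.1 s.2 k) rfl))
    linarith [henc.2]
  -- These two inequalities serve the branch `0` of the maxima in `h₁` and `h₂`, where the link
  -- budget exceeds the message size.
  have hV₂' := entropy_le_of_function hrm.1 (A := id) (B := fun s => (s.2, V s))
    (fun s => (s.2, V s)) (fun _ => rfl)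
  have hV₁' := entropy_le_of_function hrm.1 (A := id) (B := fun s => (s.1, V s))
    (fun s => (s.1, V s)) (fun _ => rfl)
  have i₁ : n * R₁ ≤ entropy r id - entropy r (fun s => (s.2, V s)) :=
    h₁.trans (max_le (by linarith) (by linarith))
  have i₂ : n * R₂ ≤ entropy r id - entropy r (fun s => (s.1, V s)) :=
    h₂.trans (max_le (by linarith) (by linarith))
  -- The sum of `i₁` and `i₂`: submodularity bounds `H(W₁ W₂) + H(V)` by `H(W₁, V) + H(W₂, V)`.
  -- Estimating `H(V)` through both budgets is not necessary.
  have i₃ : n * (R₁ + R₂) ≤ entropy r id - entropy r V := by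
    have e1 := entropy_submodular hrm (fun s => s.1) (fun s => s.2) V
    have e2 := entropy_le_of_function hrm.1 (A := fun s => (s.1, s.2, V s)) (B := id)
      (fun x => (x.1, x.2.1)) (fun _ => rfl)
    linarith
  -- The auxiliary variable, a time index together with a transcript, is relabelled because the
  -- region asks for an alphabet `Fin m`.
  set e := (Fintype.equivFin (Fin n × ((k : Fin c.encConf.rounds) →
    Fin (c.encConf.card₁ k) × Fin (c.encConf.card₂ k)))).symm
  have hq : (fun u => timeLaw n q (e u)) ∈ stdSimplex ℝ (Fin _) := by
    have := timeLaw_mem hn hs.q_mem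
    exact ⟨fun u => this.1 _, by rw [e.sum_comp (timeLaw n q)]; exact this.2⟩
  -- The Fano term of each receiver only needs its own error event, which is contained in the event
  -- that some decoder errs.
  have herr : ∀ (P : (Fin M₁ × Fin M₂) × (Fin n → Y₁ × Y₂) → Prop) [DecidablePred P],
      (∀ ω, P ω → (c.estimate₁ (fun i => (ω.2 i).1) (fun i => (ω.2 i).2) ≠ ω.1 ∨
        c.estimate₂ (fun i => (ω.2 i).1) (fun i => (ω.2 i).2) ≠ ω.1)) →
      1 + (∑ ω, if P ω then channelLaw r (fun x₁ x₂ => W x₁ x₂)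
          (fun s => k₁ s.1 (V s)) (fun s => k₂ s.2 (V s)) ω else 0) *
        Real.logb 2 (Fintype.card (Fin M₁ × Fin M₂)) ≤ n * η := by
    intro P _ hP
    refine le_trans ?_ hη
    rw [hlogcard]
    have hlog : 0 ≤ Real.logb 2 M₁ + Real.logb 2 M₂ := by
      rw [← hlogcard]
      exact Real.logb_nonneg one_lt_two (by exact_mod_cast Fintype.card_pos)
    refine add_le_add_right (mul_le_mul_of_nonneg_right ?_ hlog) 1
    rw [c.errorProb_eq W]
    refine Finset.sum_le_sum fun ω _ => ?_
    by_cases hω : P ω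
    · rw [if_pos hω, if_pos (hP ω hω)]
      exact le_rfl
    · rw [if_neg hω]
      split_ifs
      · exact hp.1 ω
      · exact le_rfl
  refine ⟨_, ⟨_, hq⟩, fun u => ⟨_, hs.a_mem (e u).1 (e u).2⟩,
    fun u => ⟨_, hs.b_mem (e u).1 (e u).2⟩, ?_, ?_, ?_⟩
  · exact SplitInputs.rateBounds hs hrm hW hn (fun s => s.1) (fun s => s.2)
      k₁ k₂ (fun _ => rfl) (fun _ => rfl) e i₁ i₂ i₃ (h₀.trans_eq hHs.symm) Prod.fst
      (fun ω => c.decConf.sent₂ (fun i => (ω.2 i).1) (fun i => (ω.2 i).2))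
      (fun x => c.dec₁ x.1 x.2) ((entropy_tuple_le hp _).trans hdec.2)
      (herr (fun ω => c.estimate₁ (fun i => (ω.2 i).1) (fun i => (ω.2 i).2) ≠ ω.1)
        fun ω hω => Or.inl hω)
  · exact SplitInputs.rateBounds hs hrm hW hn (fun s => s.1) (fun s => s.2)
      k₁ k₂ (fun _ => rfl) (fun _ => rfl) e i₁ i₂ i₃ (h₀.trans_eq hHs.symm) Prod.snd
      (fun ω => c.decConf.sent₁ (fun i => (ω.2 i).1) (fun i => (ω.2 i).2))
      (fun x => c.dec₂ x.1 x.2) ((entropy_tuple_le hp _).trans hdec.1)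
      (herr (fun ω => c.estimate₂ (fun i => (ω.2 i).1) (fun i => (ω.2 i).2) ≠ ω.1)
        fun ω hω => Or.inr hω)
  -- A receiver of both blocks can run the whole decoders' conference and use decoder 1, so its side
  -- information `T` is trivial and its link term is zero.
  · exact SplitInputs.rateBounds hs hrm hW hn (fun s => s.1) (fun s => s.2)
      k₁ k₂ (fun _ => rfl) (fun _ => rfl) e i₁ i₂ i₃ (h₀.trans_eq hHs.symm) id
      (fun _ => ())
      (fun x => c.estimate₁ (fun i => (x.1 i).1) (fun i => (x.1 i).2))
      (by rw [entropy_unit hp, mul_zero])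
      (herr (fun ω => c.estimate₁ (fun i => (ω.2 i).1) (fun i => (ω.2 i).2) ≠ ω.1)
        fun ω hω => Or.inl hω)

end CodeConverse

/-! ### The outer bound for the capacity region. -/

section OuterBound

/-- Trades a perturbation of the rates against slack, so that a limit of achievable pairs inherits
approximate constraints. -/
theorem RateBounds.transfer {X₁ X₂ Z : Type*} [Fintype X₁] [Fintype X₂] [Fintype Z] {m : ℕ}
    {q : Fin m → ℝ} {a : Fin m → X₁ → ℝ} {b : Fin m → X₂ → ℝ} {K : X₁ → X₂ → Z → ℝ}
    {C C' R₀ R₁ R₂ R₀' R₁' R₂' : ℝ} (h : RateBounds q a b K C R₀' R₁' R₂')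
    (h₁ : R₁ + C ≤ R₁' + C') (h₂ : R₂ + C ≤ R₂' + C') (h₃ : R₁ + R₂ + C ≤ R₁' + R₂' + C')
    (h₀ : R₀ + R₁ + R₂ + C ≤ R₀' + R₁' + R₂' + C') : RateBounds q a b K C' R₀ R₁ R₂ := by
  obtain ⟨e₁, e₂, e₃, e₄⟩ := h
  exact ⟨by linarith, by linarith, by linarith, by linarith⟩

theorem le_logb_ceil (n : ℕ) (R : ℝ) : n * R ≤ Real.logb 2 ⌈(2 : ℝ) ^ ((n : ℝ) * R)⌉₊ := by
  rw [Real.le_logb_iff_rpow_le one_lt_two]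
  · exact Nat.le_ceil _
  · exact_mod_cast Nat.ceil_pos.2 (Real.rpow_pos_of_pos two_pos _)

theorem ceil_le_two_mul {x : ℝ} (hx : 1 ≤ x) : (⌈x⌉₊ : ℝ) ≤ 2 * x := by
  have := (Nat.ceil_lt_add_one (by linarith : 0 ≤ x)).le
  linarith

theorem one_le_two_rpow {x : ℝ} (hx : 0 ≤ x) : (1 : ℝ) ≤ 2 ^ x :=
  Real.one_le_rpow one_le_two hx

/-- Rounding a number that is at least one up to an integer at most doubles it, which costs one bit.
-/
theorem logb_ceil_le (n : ℕ) {R : ℝ} (hR : 0 ≤ R) :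
    Real.logb 2 ⌈(2 : ℝ) ^ ((n : ℝ) * R)⌉₊ ≤ n * R + 1 := by
  have hpos : (0 : ℝ) < ⌈(2 : ℝ) ^ ((n : ℝ) * R)⌉₊ := by
    exact_mod_cast Nat.ceil_pos.2 (Real.rpow_pos_of_pos two_pos _)
  rw [Real.logb_le_iff_le_rpow one_lt_two hpos, Real.rpow_add two_pos, Real.rpow_one]
  exact (ceil_le_two_mul (one_le_two_rpow (by positivity))).trans_eq (mul_comm _ _)

variable {X₁ X₂ Y₁ Y₂ : Type*} [Fintype X₁] [Fintype X₂] [Fintype Y₁] [Fintype Y₂]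

omit [Fintype X₁] [Fintype X₂] in
-- Some code of positive length sends letters. The converse needs nonempty input alphabets to assign
-- input laws to transcripts that never occur.
theorem Achievable.nonempty {W : X₁ → X₂ → stdSimplex ℝ (Y₁ × Y₂)} {B₁₂ B₂₁ C₁₂ C₂₁ R₁ R₂ : ℝ}
    (h : Achievable W B₁₂ B₂₁ C₁₂ C₂₁ R₁ R₂) : Nonempty X₁ ∧ Nonempty X₂ := by
  obtain ⟨-, -, h⟩ := h
  obtain ⟨N, hN⟩ := h 1 one_pos
  obtain ⟨c, -⟩ := hN (N + 1) (Nat.le_succ N)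
  have p₁ : 0 < ⌈(2 : ℝ) ^ (((N + 1 : ℕ) : ℝ) * R₁)⌉₊ :=
    Nat.ceil_pos.2 (Real.rpow_pos_of_pos two_pos _)
  have p₂ : 0 < ⌈(2 : ℝ) ^ (((N + 1 : ℕ) : ℝ) * R₂)⌉₊ :=
    Nat.ceil_pos.2 (Real.rpow_pos_of_pos two_pos _)
  exact ⟨⟨c.codeword₁ ⟨0, p₁⟩ ⟨0, p₂⟩ 0⟩, ⟨c.codeword₂ ⟨0, p₁⟩ ⟨0, p₂⟩ 0⟩⟩

theorem Achievable.exists_rateBounds {W : X₁ → X₂ → stdSimplex ℝ (Y₁ × Y₂)}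
    {B₁₂ B₂₁ C₁₂ C₂₁ R₁ R₂ : ℝ} (h : Achievable W B₁₂ B₂₁ C₁₂ C₂₁ R₁ R₂) {δ : ℝ} (hδ : 0 < δ) :
    ∃ (m : ℕ) (q : stdSimplex ℝ (Fin m)) (a : Fin m → stdSimplex ℝ X₁)
      (b : Fin m → stdSimplex ℝ X₂),
      RateBounds q (fun u => a u) (fun u => b u) (receiver W Prod.fst) (C₂₁ + δ)
        (min R₁ B₁₂ + min R₂ B₂₁) (R₁ - min R₁ B₁₂) (R₂ - min R₂ B₂₁) ∧
      RateBounds q (fun u => a u) (fun u => b u) (receiver W Prod.snd) (C₁₂ + δ)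
        (min R₁ B₁₂ + min R₂ B₂₁) (R₁ - min R₁ B₁₂) (R₂ - min R₂ B₂₁) ∧
      RateBounds q (fun u => a u) (fun u => b u) (receiver W id) (0 + δ)
        (min R₁ B₁₂ + min R₂ B₂₁) (R₁ - min R₁ B₁₂) (R₂ - min R₂ B₂₁) := by
  obtain ⟨_, _⟩ := h.nonempty
  obtain ⟨hR₁, hR₂, h⟩ := h
  -- The messages have at most `n (R₁ + R₂ + 2)` bits, rounding included, so this error level limits
  -- the Fano product to `n δ / 2`. The block length beyond `2 / δ` makes the remaining single bit
  -- at most `n δ / 2`.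
  obtain ⟨N, hN⟩ := h (δ / (2 * (R₁ + R₂ + 2))) (by positivity)
  obtain ⟨k, hk⟩ := exists_nat_gt (2 / δ)
  set n := max N k + 1 with hn
  have hn0 : 0 < n := Nat.succ_pos _
  have hn1 : (1 : ℝ) ≤ n := by exact_mod_cast hn0
  have hnN : N ≤ n := (le_max_left N k).trans (Nat.le_succ _)
  have hkn : (k : ℝ) ≤ n := by exact_mod_cast (le_max_right N k).trans (Nat.le_succ _)
  obtain ⟨c, henc, hdec, herr⟩ := hN n hnN
  have hrate : ∀ R B : ℝ, n * (R - min R B) ≤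
      max 0 (Real.logb 2 ⌈(2 : ℝ) ^ ((n : ℝ) * R)⌉₊ - n * B) := by
    intro R B
    rcases le_total R B with hRB | hRB
    · rw [min_eq_left hRB, sub_self, mul_zero]
      exact le_max_left _ _
    · rw [min_eq_right hRB]
      exact le_max_of_le_right (by linarith [le_logb_ceil n R])
  refine c.exists_rateBounds W (Nat.ceil_pos.2 (Real.rpow_pos_of_pos two_pos _))
    (Nat.ceil_pos.2 (Real.rpow_pos_of_pos two_pos _)) hn0 henc hdec (hrate R₁ B₁₂) (hrate R₂ B₂₁)
    ?_ ?_
  · have := le_logb_ceil n R₁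
    have := le_logb_ceil n R₂
    nlinarith
  · have l₁ := logb_ceil_le n hR₁
    have l₂ := logb_ceil_le n hR₂
    have l₁' := (mul_nonneg (Nat.cast_nonneg n) hR₁).trans (le_logb_ceil n R₁)
    have l₂' := (mul_nonneg (Nat.cast_nonneg n) hR₂).trans (le_logb_ceil n R₂)
    have hsum : Real.logb 2 ⌈(2 : ℝ) ^ ((n : ℝ) * R₁)⌉₊ + Real.logb 2 ⌈(2 : ℝ) ^ ((n : ℝ) * R₂)⌉₊ ≤
        n * (R₁ + R₂ + 2) := by nlinarith
    have e1 : c.errorProb W * (Real.logb 2 ⌈(2 : ℝ) ^ ((n : ℝ) * R₁)⌉₊ +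
        Real.logb 2 ⌈(2 : ℝ) ^ ((n : ℝ) * R₂)⌉₊) ≤
        δ / (2 * (R₁ + R₂ + 2)) * (n * (R₁ + R₂ + 2)) :=
      (mul_le_mul_of_nonneg_right herr (add_nonneg l₁' l₂')).trans
        (mul_le_mul_of_nonneg_left hsum (by positivity))
    have e2 : δ / (2 * (R₁ + R₂ + 2)) * (n * (R₁ + R₂ + 2)) = n * δ / 2 := by
      have : R₁ + R₂ + 2 ≠ 0 := by positivity
      field_simp
    have e3 : 2 < n * δ := by
      have := hk.trans_le hkn
      rwa [div_lt_iff₀ hδ] at this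
    linarith

/-- The outer bound. -/
theorem capacityRegion_subset (W : X₁ → X₂ → stdSimplex ℝ (Y₁ × Y₂)) (B₁₂ B₂₁ C₁₂ C₂₁ : ℝ)
    (hB₁₂ : 0 ≤ B₁₂) (hB₂₁ : 0 ≤ B₂₁) :
    capacityRegion W B₁₂ B₂₁ C₁₂ C₂₁ ⊆ cmeOuterRegion W B₁₂ B₂₁ C₁₂ C₂₁ := by
  rintro ⟨R₁, R₂⟩ hR
  have hR₁ : 0 ≤ R₁ := by
    have : IsClosed {x : ℝ × ℝ | 0 ≤ x.1} := isClosed_le continuous_const continuous_fst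
    exact closure_minimal (fun x hx => hx.1) this hR
  have hR₂ : 0 ≤ R₂ := by
    have : IsClosed {x : ℝ × ℝ | 0 ≤ x.2} := isClosed_le continuous_const continuous_snd
    exact closure_minimal (fun x hx => hx.2.1) this hR
  refine ⟨hR₁, hR₂, ?_⟩
  obtain ⟨m, q, a, b, h₁, h₂, h₃⟩ := exists_rateBounds_of_slack (receiver W Prod.fst)
    (receiver W Prod.snd) (receiver W id) C₂₁ C₁₂ 0 (min R₁ B₁₂ + min R₂ B₂₁) (R₁ - min R₁ B₁₂)
    (R₂ - min R₂ B₂₁) (by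
      intro δ hδ
      -- Distance `δ / 4` perturbs the sum bounds by at most `δ / 2`; the approximating pair
      -- satisfies its constraints with slack `δ / 2`. Excess over a fixed budget moves no more than
      -- the rate does.
      obtain ⟨⟨R₁', R₂'⟩, hR', hdist⟩ := Metric.mem_closure_iff.1 hR (δ / 4) (by positivity)
      rw [Prod.dist_eq, max_lt_iff, Real.dist_eq, Real.dist_eq, abs_lt, abs_lt] at hdist
      obtain ⟨⟨d1, d2⟩, ⟨d3, d4⟩⟩ := hdist
      dsimp only at d1 d2 d3 d4
      have key : ∀ R R' B : ℝ, -(δ / 4) < R - R' → R - R' < δ / 4 →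
          R - min R B ≤ R' - min R' B + δ / 4 := by
        intro R R' B _ _
        rcases le_total R B with h | h <;> rcases le_total R' B with h' | h' <;>
          simp only [min_eq_left, min_eq_right, h, h'] <;> linarith
      have k₁ := key R₁ R₁' B₁₂ d1 d2
      have k₂ := key R₂ R₂' B₂₁ d3 d4
      obtain ⟨m, q, a, b, h₁, h₂, h₃⟩ := Achievable.exists_rateBounds hR' (half_pos hδ)
      exact ⟨m, q, a, b,
        h₁.transfer (by linarith) (by linarith) (by linarith) (by linarith),
        h₂.transfer (by linarith) (by linarith) (by linarith) (by linarith),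
        h₃.transfer (by linarith) (by linarith) (by linarith) (by linarith)⟩)
  exact ⟨m, q, a, b, ⟨add_nonneg (le_min hR₁ hB₁₂) (le_min hR₂ hB₂₁),
    sub_nonneg.2 (min_le_left _ _), sub_nonneg.2 (min_le_left _ _)⟩,
    (MACBounds_iff W q a b Prod.fst _ _ _ _).2 h₁, (MACBounds_iff W q a b Prod.snd _ _ _ _).2 h₂,
    (MACBounds_iff W q a b id _ _ _ _).2 h₃⟩

end OuterBound

/-! ### Random superposition codes and their error events. -/

section RandomCoding

variable {𝒰 𝒳₁ 𝒳₂ 𝒵 ι₀ ι₁ ι₂ : Type*} [Fintype 𝒰] [Fintype 𝒳₁] [Fintype 𝒳₂] [Fintype 𝒵]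
  [Fintype ι₀] [Fintype ι₁] [Fintype ι₂] [DecidableEq ι₀] [DecidableEq ι₁] [DecidableEq ι₂]

/-- Law of a cloud of a superposition code: a cloud centre in `𝒰` and satellites in `𝒳₁` and `𝒳₂`
that are conditionally independent given the cloud centre. -/
def cloudLaw (p : 𝒰 → ℝ) (a : 𝒰 → 𝒳₁ → ℝ) (b : 𝒰 → 𝒳₂ → ℝ) :
    𝒰 × (ι₁ → 𝒳₁) × (ι₂ → 𝒳₂) → ℝ :=
  fun k => p k.1 * (blockLaw (fun _ => a k.1) k.2.1 * blockLaw (fun _ => b k.1) k.2.2)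

variable {p : 𝒰 → ℝ} {a : 𝒰 → 𝒳₁ → ℝ} {b : 𝒰 → 𝒳₂ → ℝ} {K : 𝒳₁ → 𝒳₂ → 𝒵 → ℝ}
  (hp : p ∈ stdSimplex ℝ 𝒰) (ha : ∀ u, a u ∈ stdSimplex ℝ 𝒳₁)
  (hb : ∀ u, b u ∈ stdSimplex ℝ 𝒳₂) (hK : ∀ x₁ x₂, K x₁ x₂ ∈ stdSimplex ℝ 𝒵)

theorem cloudLaw_mem (hp : p ∈ stdSimplex ℝ 𝒰) (ha : ∀ u, a u ∈ stdSimplex ℝ 𝒳₁)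
    (hb : ∀ u, b u ∈ stdSimplex ℝ 𝒳₂) :
    cloudLaw p a b ∈ stdSimplex ℝ (𝒰 × (ι₁ → 𝒳₁) × (ι₂ → 𝒳₂)) := by
  refine ⟨fun k => mul_nonneg (hp.1 _) (mul_nonneg ((blockLaw_mem fun _ => ha _).1 _)
    ((blockLaw_mem fun _ => hb _).1 _)), ?_⟩
  simp only [cloudLaw, Fintype.sum_prod_type, ← Finset.mul_sum, (blockLaw_mem fun _ => hb _).2,
    mul_one, (blockLaw_mem fun _ => ha _).2, hp.2]

theorem sum_cloudLaw_mul (F : 𝒰 → (ι₁ → 𝒳₁) → (ι₂ → 𝒳₂) → ℝ) :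
    ∑ k, cloudLaw p a b k * F k.1 k.2.1 k.2.2 = ∑ u, p u * ∑ f, blockLaw (fun _ => a u) f *
      ∑ g, blockLaw (fun _ => b u) g * F u f g := by
  simp only [cloudLaw, Fintype.sum_prod_type, Finset.mul_sum, mul_assoc]

/-- Fresh samples of a probability mass function. -/
theorem sum_blockLaw_mul_eval {ι α : Type*} [Fintype ι] [DecidableEq ι] [Fintype α] {q : α → ℝ}
    (hq : q ∈ stdSimplex ℝ α) (i : ι) (F : α → ℝ) :
    ∑ f : ι → α, blockLaw (fun _ => q) f * F (f i) = ∑ x, q x * F x :=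
  sum_prod_mul_eval (fun _ => q) (fun _ => hq.2) i F

theorem sum_blockLaw_mul_eval₂ {ι α : Type*} [Fintype ι] [DecidableEq ι] [Fintype α] {q : α → ℝ}
    (hq : q ∈ stdSimplex ℝ α) {i j : ι} (hij : i ≠ j) (F : α → α → ℝ) :
    ∑ f : ι → α, blockLaw (fun _ => q) f * F (f i) (f j) = ∑ x, q x * ∑ y, q y * F x y := by
  simp only [Finset.mul_sum, ← mul_assoc]
  exact sum_prod_mul_eval₂ (fun _ => q) (fun _ => hq.2) hij F

/-- A cloud contains each of its satellite pairs with the prescribed law. -/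
theorem sum_cloudLaw_mul_eval (ha : ∀ u, a u ∈ stdSimplex ℝ 𝒳₁)
    (hb : ∀ u, b u ∈ stdSimplex ℝ 𝒳₂) (j : ι₁) (l : ι₂) (F : 𝒰 → 𝒳₁ → 𝒳₂ → ℝ) :
    ∑ k, cloudLaw p a b k * F k.1 (k.2.1 j) (k.2.2 l) =
      ∑ u, p u * ∑ x, a u x * ∑ y, b u y * F u x y := by
  rw [sum_cloudLaw_mul (fun u f g => F u (f j) (g l))]
  refine Finset.sum_congr rfl fun u _ => congrArg _ ?_
  simp only [sum_blockLaw_mul_eval (hb u) l (F u _)]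
  rw [sum_blockLaw_mul_eval (ha u) j (fun x => ∑ y, b u y * F u x y)]

section Events

variable {G : 𝒰 → 𝒳₁ → 𝒳₂ → 𝒵 → Prop} {T : ℝ}

open scoped Classical in
-- Change of measure: where the test holds, `ρ` is at most `κ / T`, and `κ` has total mass one.
theorem sum_indicator_le (P : 𝒵 → Prop) {ρ κ : 𝒵 → ℝ} (hT : 0 < T)
    (hκ : κ ∈ stdSimplex ℝ 𝒵) (h : ∀ z, P z → T * ρ z ≤ κ z) :
    ∑ z, ρ z * (if P z then 1 else 0) ≤ 1 / T := by
  have : ∀ z, ρ z * (if P z then (1 : ℝ) else 0) ≤ κ z / T := by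
    intro z
    split_ifs with hz
    · rw [mul_one, le_div_iff₀ hT, mul_comm]
      exact h z hz
    · rw [mul_zero]
      exact div_nonneg (hκ.1 z) hT.le
  refine (Finset.sum_le_sum fun z _ => this z).trans_eq ?_
  rw [← Finset.sum_div, hκ.2]

theorem sum_mul_le_of_le {α : Type*} [Fintype α] {q F : α → ℝ} {c : ℝ} (hq : q ∈ stdSimplex ℝ α)
    (h : ∀ x, F x ≤ c) : ∑ x, q x * F x ≤ c := by
  refine (Finset.sum_le_sum fun x _ => mul_le_mul_of_nonneg_left (h x) (hq.1 x)).trans_eq ?_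
  rw [← Finset.sum_mul, hq.2, one_mul]

include hp ha hb hK

open scoped Classical in
/-- A wrong satellite of the first kind passes the threshold test with small probability. -/
theorem cloud_event₁_le (hT : 0 < T)
    (h : ∀ u x₁ x₂ z, G u x₁ x₂ z → T * mix₁ (a u) K x₂ z ≤ K x₁ x₂ z) {j j' : ι₁} (hj : j ≠ j')
    (l : ι₂) :
    ∑ k, cloudLaw p a b k * ∑ z, K (k.2.1 j) (k.2.2 l) z *
      (if G k.1 (k.2.1 j') (k.2.2 l) z then 1 else 0) ≤ 1 / T := by
  rw [sum_cloudLaw_mul (fun u f g => ∑ z, K (f j) (g l) z * (if G u (f j') (g l) z then 1 else 0))]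
  refine sum_mul_le_of_le hp fun u => ?_
  simp only [fun f : ι₁ → 𝒳₁ => sum_blockLaw_mul_eval (hb u) l
    (fun y => ∑ z, K (f j) y z * (if G u (f j') y z then 1 else 0))]
  rw [sum_blockLaw_mul_eval₂ (ha u) hj.symm (fun x' x =>
    ∑ y, b u y * ∑ z, K x y z * (if G u x' y z then 1 else 0))]
  refine sum_mul_le_of_le (ha u) fun x' => ?_
  -- The wrong satellite `x'` is independent of the sent one, which can therefore be averaged out;
  -- the output then has law `mix₁`, exactly the law that the test compares with.
  have e : ∑ x, a u x * ∑ y, b u y * ∑ z, K x y z * (if G u x' y z then (1 : ℝ) else 0) =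
      ∑ y, b u y * ∑ z, mix₁ (a u) K y z * (if G u x' y z then 1 else 0) := by
    simp only [mix₁, Finset.mul_sum, Finset.sum_mul]
    rw [Finset.sum_comm]
    refine Finset.sum_congr rfl fun y _ => ?_
    rw [Finset.sum_comm]
    exact Finset.sum_congr rfl fun z _ => Finset.sum_congr rfl fun x _ => by ring
  rw [e]
  exact sum_mul_le_of_le (hb u) fun y => sum_indicator_le _ hT (hK x' y) fun z => h u x' y z

open scoped Classical in
/-- A wrong satellite of the second kind passes the threshold test with small probability. -/
theorem cloud_event₂_le (hT : 0 < T)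
    (h : ∀ u x₁ x₂ z, G u x₁ x₂ z → T * mix₂ (b u) K x₁ z ≤ K x₁ x₂ z) (j : ι₁) {l l' : ι₂}
    (hl : l ≠ l') :
    ∑ k, cloudLaw p a b k * ∑ z, K (k.2.1 j) (k.2.2 l) z *
      (if G k.1 (k.2.1 j) (k.2.2 l') z then 1 else 0) ≤ 1 / T := by
  rw [sum_cloudLaw_mul (fun u f g => ∑ z, K (f j) (g l) z * (if G u (f j) (g l') z then 1 else 0))]
  refine sum_mul_le_of_le hp fun u => ?_
  simp only [fun f : ι₁ → 𝒳₁ => sum_blockLaw_mul_eval₂ (hb u) hl.symm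
    (fun y' y => ∑ z, K (f j) y z * (if G u (f j) y' z then 1 else 0))]
  rw [sum_blockLaw_mul_eval (ha u) j (fun x =>
    ∑ y', b u y' * ∑ y, b u y * ∑ z, K x y z * (if G u x y' z then 1 else 0))]
  refine sum_mul_le_of_le (ha u) fun x => sum_mul_le_of_le (hb u) fun y' => ?_
  have e : ∑ y, b u y * ∑ z, K x y z * (if G u x y' z then (1 : ℝ) else 0) =
      ∑ z, mix₂ (b u) K x z * (if G u x y' z then 1 else 0) := by
    simp only [mix₂, Finset.mul_sum, Finset.sum_mul]
    rw [Finset.sum_comm]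
    exact Finset.sum_congr rfl fun z _ => Finset.sum_congr rfl fun x _ => by ring
  rw [e]
  exact sum_indicator_le _ hT (hK x y') fun z => h u x y' z

omit hp hb ha hK in
theorem sum_pair_eq_mix (α : 𝒳₁ → ℝ) (β : 𝒳₂ → ℝ) (F : 𝒵 → ℝ) :
    ∑ x, α x * ∑ y, β y * ∑ z, K x y z * F z = ∑ z, mix (prodPmf α β) K z * F z := by
  simp only [mix, prodPmf, Fintype.sum_prod_type, Finset.mul_sum, Finset.sum_mul]
  rw [Finset.sum_comm_cycle]
  exact Finset.sum_congr rfl fun z _ => Finset.sum_congr rfl fun x _ =>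
    Finset.sum_congr rfl fun y _ => by ring

open scoped Classical in
/-- A wrong pair of satellites passes the threshold test with small probability. -/
theorem cloud_event₃_le (hT : 0 < T)
    (h : ∀ u x₁ x₂ z, G u x₁ x₂ z → T * mix (prodPmf (a u) (b u)) K z ≤ K x₁ x₂ z)
    {j j' : ι₁} (hj : j ≠ j') {l l' : ι₂} (hl : l ≠ l') :
    ∑ k, cloudLaw p a b k * ∑ z, K (k.2.1 j) (k.2.2 l) z *
      (if G k.1 (k.2.1 j') (k.2.2 l') z then 1 else 0) ≤ 1 / T := by
  rw [sum_cloudLaw_mul (fun u f g => ∑ z, K (f j) (g l) z * (if G u (f j') (g l') z then 1 else 0))]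
  refine sum_mul_le_of_le hp fun u => ?_
  simp only [fun f : ι₁ → 𝒳₁ => sum_blockLaw_mul_eval₂ (hb u) hl.symm
    (fun y' y => ∑ z, K (f j) y z * (if G u (f j') y' z then 1 else 0))]
  rw [sum_blockLaw_mul_eval₂ (ha u) hj.symm (fun x' x =>
    ∑ y', b u y' * ∑ y, b u y * ∑ z, K x y z * (if G u x' y' z then 1 else 0))]
  refine sum_mul_le_of_le (ha u) fun x' => ?_
  have e : ∑ x, a u x * ∑ y', b u y' * ∑ y, b u y * ∑ z, K x y z *
      (if G u x' y' z then (1 : ℝ) else 0) = ∑ y', b u y' * ∑ z, mix (prodPmf (a u) (b u)) K z *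
      (if G u x' y' z then 1 else 0) := by
    simp only [← sum_pair_eq_mix]
    simp only [Finset.mul_sum]
    rw [Finset.sum_comm]
    refine Finset.sum_congr rfl fun y' _ => Finset.sum_congr rfl fun x _ =>
      Finset.sum_congr rfl fun y _ => Finset.sum_congr rfl fun z _ => by ring
  rw [e]
  exact sum_mul_le_of_le (hb u) fun y' => sum_indicator_le _ hT (hK x' y') fun z => h u x' y' z

open scoped Classical in
/-- A codeword pair from a wrong cloud passes the threshold test with small probability. -/
theorem cloud_event₀_le (hT : 0 < T)
    (h : ∀ u x₁ x₂ z, G u x₁ x₂ z → T * mix (inputLaw p a b) K z ≤ K x₁ x₂ z)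
    (j j' : ι₁) (l l' : ι₂) :
    ∑ k', cloudLaw p a b k' * ∑ k, cloudLaw p a b k * ∑ z, K (k.2.1 j) (k.2.2 l) z *
      (if G k'.1 (k'.2.1 j') (k'.2.2 l') z then 1 else 0) ≤ 1 / T := by
  refine sum_mul_le_of_le (cloudLaw_mem hp ha hb) fun k' => ?_
  rw [sum_cloudLaw_mul_eval ha hb j l (fun _ x y => ∑ z, K x y z *
    (if G k'.1 (k'.2.1 j') (k'.2.2 l') z then 1 else 0))]
  -- Distinct clouds are independent, so the sent cloud is averaged out entirely, cloud centre
  -- included, whatever satellites the wrong tuple has.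
  have e : ∑ u, p u * ∑ x, a u x * ∑ y, b u y * ∑ z, K x y z *
      (if G k'.1 (k'.2.1 j') (k'.2.2 l') z then (1 : ℝ) else 0) =
      ∑ z, mix (inputLaw p a b) K z * (if G k'.1 (k'.2.1 j') (k'.2.2 l') z then 1 else 0) := by
    simp only [sum_pair_eq_mix]
    simp only [mix, inputLaw, Finset.mul_sum, Finset.sum_mul]
    rw [Finset.sum_comm]
    refine Finset.sum_congr rfl fun z _ => ?_
    rw [Finset.sum_comm]
    exact Finset.sum_congr rfl fun x _ => Finset.sum_congr rfl fun u _ => by ring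
  rw [e]
  exact sum_indicator_le _ hT (hK _ _) fun z => h _ _ _ z

end Events

/-- The unique message that passes a test, if there is one. -/
noncomputable def uniqueMessage {M : Type*} [Nonempty M] (P : M → Prop) : M :=
  open scoped Classical in if h : ∃! m, P m then h.choose else Classical.arbitrary M

theorem uniqueMessage_eq {M : Type*} [Nonempty M] {P : M → Prop} {m : M} (h : P m)
    (h' : ∀ m', P m' → m' = m) : uniqueMessage P = m := by
  have hex : ∃! m, P m := ⟨m, h, h'⟩
  rw [uniqueMessage, dif_pos hex]
  exact h' _ hex.choose_spec.1

/-- The decoder that tests all codeword triples of a superposition code. -/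
noncomputable def cloudDecoder [Nonempty ι₀] [Nonempty ι₁] [Nonempty ι₂]
    (G : 𝒰 → 𝒳₁ → 𝒳₂ → 𝒵 → Prop) (c : ι₀ → 𝒰 × (ι₁ → 𝒳₁) × (ι₂ → 𝒳₂)) (z : 𝒵) : ι₀ × ι₁ × ι₂ :=
  uniqueMessage fun m => G (c m.1).1 ((c m.1).2.1 m.2.1) ((c m.1).2.2 m.2.2) z

omit [Fintype 𝒰] [Fintype 𝒳₁] [Fintype 𝒳₂] [Fintype 𝒵] in
open scoped Classical in
-- Union bound. An error requires the sent triple to fail its test or another triple to pass. The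
-- competitors are sorted by what is wrong: one satellite, the other, both, or the cloud; once the
-- cloud is wrong the satellites are unrestricted.
theorem cloudDecoder_indicator_le [Nonempty ι₀] [Nonempty ι₁] [Nonempty ι₂]
    (G : 𝒰 → 𝒳₁ → 𝒳₂ → 𝒵 → Prop) (c : ι₀ → 𝒰 × (ι₁ → 𝒳₁) × (ι₂ → 𝒳₂)) (z : 𝒵)
    (i : ι₀) (j : ι₁) (l : ι₂) :
    (if cloudDecoder G c z ≠ (i, j, l) then (1 : ℝ) else 0) ≤
      (if ¬G (c i).1 ((c i).2.1 j) ((c i).2.2 l) z then 1 else 0) +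
      ∑ j' ∈ Finset.univ.erase j, (if G (c i).1 ((c i).2.1 j') ((c i).2.2 l) z then 1 else 0) +
      ∑ l' ∈ Finset.univ.erase l, (if G (c i).1 ((c i).2.1 j) ((c i).2.2 l') z then 1 else 0) +
      ∑ j' ∈ Finset.univ.erase j, ∑ l' ∈ Finset.univ.erase l,
        (if G (c i).1 ((c i).2.1 j') ((c i).2.2 l') z then 1 else 0) +
      ∑ i' ∈ Finset.univ.erase i, ∑ j', ∑ l',
        (if G (c i').1 ((c i').2.1 j') ((c i').2.2 l') z then 1 else 0) := by
  set I : ι₀ → ι₁ → ι₂ → ℝ := fun i' j' l' =>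
    if G (c i').1 ((c i').2.1 j') ((c i').2.2 l') z then 1 else 0 with hI
  have hI0 : ∀ i' j' l', 0 ≤ I i' j' l' := fun i' j' l' => by
    simp only [hI]; split_ifs <;> simp
  have s₁ : 0 ≤ ∑ j' ∈ Finset.univ.erase j, I i j' l := Finset.sum_nonneg fun _ _ => hI0 _ _ _
  have s₂ : 0 ≤ ∑ l' ∈ Finset.univ.erase l, I i j l' := Finset.sum_nonneg fun _ _ => hI0 _ _ _
  have s₃ : 0 ≤ ∑ j' ∈ Finset.univ.erase j, ∑ l' ∈ Finset.univ.erase l, I i j' l' :=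
    Finset.sum_nonneg fun _ _ => Finset.sum_nonneg fun _ _ => hI0 _ _ _
  have s₀ : 0 ≤ ∑ i' ∈ Finset.univ.erase i, ∑ j', ∑ l', I i' j' l' :=
    Finset.sum_nonneg fun _ _ => Finset.sum_nonneg fun _ _ => Finset.sum_nonneg fun _ _ => hI0 _ _ _
  have sn : (0 : ℝ) ≤ if ¬G (c i).1 ((c i).2.1 j) ((c i).2.2 l) z then 1 else 0 := by
    split_ifs <;> simp
  by_cases hG : G (c i).1 ((c i).2.1 j) ((c i).2.2 l) z
  swap
  · rw [if_pos hG]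
    have : (if cloudDecoder G c z ≠ (i, j, l) then (1 : ℝ) else 0) ≤ 1 := by
      split_ifs <;> simp
    linarith
  by_cases hu : ∀ m' : ι₀ × ι₁ × ι₂,
      G (c m'.1).1 ((c m'.1).2.1 m'.2.1) ((c m'.1).2.2 m'.2.2) z → m' = (i, j, l)
  · have : cloudDecoder G c z = (i, j, l) := uniqueMessage_eq hG hu
    rw [if_neg (not_not.2 this)]
    linarith
  · push Not at hu
    obtain ⟨⟨i', j', l'⟩, hG', hne⟩ := hu
    have hone : I i' j' l' = 1 := if_pos hG'
    have hle : (if cloudDecoder G c z ≠ (i, j, l) then (1 : ℝ) else 0) ≤ 1 := by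
      split_ifs <;> simp
    by_cases hi : i' = i
    · subst hi
      by_cases hj : j' = j
      · subst hj
        have hl : l' ≠ l := fun h => hne (by rw [h])
        have := Finset.single_le_sum (f := fun l' => I i' j' l') (fun l' _ => hI0 _ _ _)
          (Finset.mem_erase.2 ⟨hl, Finset.mem_univ l'⟩)
        linarith
      · by_cases hl : l' = l
        · subst hl
          have := Finset.single_le_sum (f := fun j' => I i' j' l') (fun l' _ => hI0 _ _ _)
            (Finset.mem_erase.2 ⟨hj, Finset.mem_univ j'⟩)
          linarith
        · have e1 := Finset.single_le_sum (f := fun j' => ∑ l' ∈ Finset.univ.erase l, I i' j' l')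
            (fun j' _ => Finset.sum_nonneg fun _ _ => hI0 _ _ _)
            (Finset.mem_erase.2 ⟨hj, Finset.mem_univ j'⟩)
          have e2 := Finset.single_le_sum (f := fun l' => I i' j' l') (fun l' _ => hI0 _ _ _)
            (Finset.mem_erase.2 ⟨hl, Finset.mem_univ l'⟩)
          linarith
    · have e1 := Finset.single_le_sum (f := fun i' => ∑ j', ∑ l', I i' j' l')
        (fun i' _ => Finset.sum_nonneg fun _ _ => Finset.sum_nonneg fun _ _ => hI0 _ _ _)
        (Finset.mem_erase.2 ⟨hi, Finset.mem_univ i'⟩)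
      have e2 := Finset.single_le_sum (f := fun j' => ∑ l', I i' j' l')
        (fun j' _ => Finset.sum_nonneg fun _ _ => hI0 _ _ _) (Finset.mem_univ j')
      have e3 := Finset.single_le_sum (f := fun l' => I i' j' l') (fun l' _ => hI0 _ _ _)
        (Finset.mem_univ l')
      linarith

end RandomCoding

/-! ### Expected error of threshold decoding. -/

section ExpectedError

variable {𝒰 𝒳₁ 𝒳₂ 𝒵 ι₀ ι₁ ι₂ : Type*} [Fintype 𝒰] [Fintype 𝒳₁] [Fintype 𝒳₂] [Fintype 𝒵]
  [Fintype ι₀] [Fintype ι₁] [Fintype ι₂] [DecidableEq ι₀] [DecidableEq ι₁] [DecidableEq ι₂]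
  {p : 𝒰 → ℝ} {a : 𝒰 → 𝒳₁ → ℝ} {b : 𝒰 → 𝒳₂ → ℝ} {K : 𝒳₁ → 𝒳₂ → 𝒵 → ℝ}

/-- The four threshold tests of the decoder of a superposition code. -/
def thresholdTest (p : 𝒰 → ℝ) (a : 𝒰 → 𝒳₁ → ℝ) (b : 𝒰 → 𝒳₂ → ℝ) (K : 𝒳₁ → 𝒳₂ → 𝒵 → ℝ)
    (T₁ T₂ T₃ T₀ : ℝ) (u : 𝒰) (x₁ : 𝒳₁) (x₂ : 𝒳₂) (z : 𝒵) : Prop :=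
  T₁ * mix₁ (a u) K x₂ z ≤ K x₁ x₂ z ∧ T₂ * mix₂ (b u) K x₁ z ≤ K x₁ x₂ z ∧
    T₃ * mix (prodPmf (a u) (b u)) K z ≤ K x₁ x₂ z ∧ T₀ * mix (inputLaw p a b) K z ≤ K x₁ x₂ z

open scoped Classical in
/-- **Random coding bound** for superposition codes with threshold decoding. -/
theorem expected_error_le [Nonempty ι₀] [Nonempty ι₁] [Nonempty ι₂]
    (hp : p ∈ stdSimplex ℝ 𝒰) (ha : ∀ u, a u ∈ stdSimplex ℝ 𝒳₁)
    (hb : ∀ u, b u ∈ stdSimplex ℝ 𝒳₂) (hK : ∀ x₁ x₂, K x₁ x₂ ∈ stdSimplex ℝ 𝒵)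
    {T₁ T₂ T₃ T₀ : ℝ} (h₁ : ∀ j j' : ι₁, j ≠ j' → 0 < T₁) (h₂ : ∀ l l' : ι₂, l ≠ l' → 0 < T₂)
    (h₃ : ∀ (j j' : ι₁) (l l' : ι₂), j ≠ j' → l ≠ l' → 0 < T₃)
    (h₀ : ∀ i i' : ι₀, i ≠ i' → 0 < T₀) (i : ι₀) (j : ι₁) (l : ι₂) :
    ∑ c : ι₀ → 𝒰 × (ι₁ → 𝒳₁) × (ι₂ → 𝒳₂), blockLaw (fun _ => cloudLaw p a b) c *
      ∑ z, K ((c i).2.1 j) ((c i).2.2 l) z *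
        (if cloudDecoder (thresholdTest p a b K T₁ T₂ T₃ T₀) c z ≠ (i, j, l) then 1 else 0) ≤
    ∑ ω, superLaw p a b K ω *
      (if ¬thresholdTest p a b K T₁ T₂ T₃ T₀ ω.1 ω.2.1 ω.2.2.1 ω.2.2.2 then 1 else 0) +
      (Fintype.card ι₁ - 1 : ℝ) * (1 / T₁) + (Fintype.card ι₂ - 1 : ℝ) * (1 / T₂) +
      (Fintype.card ι₁ - 1 : ℝ) * ((Fintype.card ι₂ - 1 : ℝ) * (1 / T₃)) +
      (Fintype.card ι₀ - 1 : ℝ) * (Fintype.card ι₁ * (Fintype.card ι₂ * (1 / T₀))) := by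
  set G := thresholdTest p a b K T₁ T₂ T₃ T₀ with hG
  have hcl : cloudLaw (ι₁ := ι₁) (ι₂ := ι₂) p a b ∈ stdSimplex ℝ _ := cloudLaw_mem hp ha hb
  have hμ := blockLaw_mem (ι := ι₀) (fun _ => hcl)
  set μ := blockLaw (fun _ : ι₀ => cloudLaw (ι₁ := ι₁) (ι₂ := ι₂) p a b) with hμdef
  -- the five kinds of error events
  set A : (ι₀ → 𝒰 × (ι₁ → 𝒳₁) × (ι₂ → 𝒳₂)) → ℝ := fun c =>
    ∑ z, K ((c i).2.1 j) ((c i).2.2 l) z *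
      (if ¬G (c i).1 ((c i).2.1 j) ((c i).2.2 l) z then 1 else 0) with hA
  set E : ι₀ → ι₁ → ι₂ → (ι₀ → 𝒰 × (ι₁ → 𝒳₁) × (ι₂ → 𝒳₂)) → ℝ := fun i' j' l' c =>
    ∑ z, K ((c i).2.1 j) ((c i).2.2 l) z *
      (if G (c i').1 ((c i').2.1 j') ((c i').2.2 l') z then 1 else 0) with hE
  have hpt : ∀ c, ∑ z, K ((c i).2.1 j) ((c i).2.2 l) z *
        (if cloudDecoder G c z ≠ (i, j, l) then 1 else 0) ≤
      A c + ∑ j' ∈ Finset.univ.erase j, E i j' l c + ∑ l' ∈ Finset.univ.erase l, E i j l' c +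
      ∑ j' ∈ Finset.univ.erase j, ∑ l' ∈ Finset.univ.erase l, E i j' l' c +
      ∑ i' ∈ Finset.univ.erase i, ∑ j', ∑ l', E i' j' l' c := by
    intro c
    refine (Finset.sum_le_sum fun z _ => mul_le_mul_of_nonneg_left
      (cloudDecoder_indicator_le G c z i j l) ((hK _ _).1 z)).trans_eq ?_
    simp only [hA, hE, mul_add, Finset.sum_add_distrib, Finset.mul_sum]
    congr 1
    · congr 1
      · congr 1
        · congr 1
          exact Finset.sum_comm
        · exact Finset.sum_comm
      · rw [Finset.sum_comm]
        exact Finset.sum_congr rfl fun _ _ => Finset.sum_comm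
    · rw [Finset.sum_comm]
      refine Finset.sum_congr rfl fun _ _ => ?_
      rw [Finset.sum_comm]
      exact Finset.sum_congr rfl fun _ _ => Finset.sum_comm
  have hEA : ∑ c, μ c * A c = ∑ ω, superLaw p a b K ω *
      (if ¬G ω.1 ω.2.1 ω.2.2.1 ω.2.2.2 then 1 else 0) := by
    rw [sum_blockLaw_mul_eval hcl i (fun k => ∑ z, K (k.2.1 j) (k.2.2 l) z *
      (if ¬G k.1 (k.2.1 j) (k.2.2 l) z then 1 else 0)), sum_cloudLaw_mul_eval ha hb j l
      (fun u x y => ∑ z, K x y z * (if ¬G u x y z then 1 else 0))]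
    simp only [superLaw, Fintype.sum_prod_type, Finset.mul_sum, mul_assoc]
  have hE₁ : ∀ j' ∈ Finset.univ.erase j, ∑ c, μ c * E i j' l c ≤ 1 / T₁ := by
    intro j' hj'
    have hne := (Finset.ne_of_mem_erase hj').symm
    rw [sum_blockLaw_mul_eval hcl i (fun k => ∑ z, K (k.2.1 j) (k.2.2 l) z *
      (if G k.1 (k.2.1 j') (k.2.2 l) z then 1 else 0))]
    exact cloud_event₁_le hp ha hb hK (h₁ _ _ hne) (fun u x y z h => h.1) hne l
  have hE₂ : ∀ l' ∈ Finset.univ.erase l, ∑ c, μ c * E i j l' c ≤ 1 / T₂ := by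
    intro l' hl'
    have hne := (Finset.ne_of_mem_erase hl').symm
    rw [sum_blockLaw_mul_eval hcl i (fun k => ∑ z, K (k.2.1 j) (k.2.2 l) z *
      (if G k.1 (k.2.1 j) (k.2.2 l') z then 1 else 0))]
    exact cloud_event₂_le hp ha hb hK (h₂ _ _ hne) (fun u x y z h => h.2.1) j hne
  have hE₃ : ∀ j' ∈ Finset.univ.erase j, ∀ l' ∈ Finset.univ.erase l,
      ∑ c, μ c * E i j' l' c ≤ 1 / T₃ := by
    intro j' hj' l' hl'
    have hne := (Finset.ne_of_mem_erase hj').symm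
    have hne' := (Finset.ne_of_mem_erase hl').symm
    rw [sum_blockLaw_mul_eval hcl i (fun k => ∑ z, K (k.2.1 j) (k.2.2 l) z *
      (if G k.1 (k.2.1 j') (k.2.2 l') z then 1 else 0))]
    exact cloud_event₃_le hp ha hb hK (h₃ _ _ _ _ hne hne') (fun u x y z h => h.2.2.1) hne hne'
  have hE₀ : ∀ i' ∈ Finset.univ.erase i, ∀ j' l', ∑ c, μ c * E i' j' l' c ≤ 1 / T₀ := by
    intro i' hi' j' l'
    have hne := Finset.ne_of_mem_erase hi'
    rw [sum_blockLaw_mul_eval₂ hcl hne (fun k' k => ∑ z, K (k.2.1 j) (k.2.2 l) z *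
      (if G k'.1 (k'.2.1 j') (k'.2.2 l') z then 1 else 0))]
    exact cloud_event₀_le hp ha hb hK (h₀ _ _ hne) (fun u x y z h => h.2.2.2) j j' l l'
  refine (Finset.sum_le_sum fun c _ => mul_le_mul_of_nonneg_left (hpt c) (hμ.1 c)).trans ?_
  simp only [mul_add, Finset.sum_add_distrib, Finset.mul_sum]
  -- Counting only the competitors, without the sent index, makes the term vanish for a singleton
  -- message set; this is why each threshold need be positive only when a competitor of that kind
  -- exists.
  have c₁ : ((Finset.univ.erase j).card : ℝ) = Fintype.card ι₁ - 1 := by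
    rw [Finset.card_erase_of_mem (Finset.mem_univ j), Finset.card_univ,
      Nat.cast_sub Fintype.card_pos, Nat.cast_one]
  have c₂ : ((Finset.univ.erase l).card : ℝ) = Fintype.card ι₂ - 1 := by
    rw [Finset.card_erase_of_mem (Finset.mem_univ l), Finset.card_univ,
      Nat.cast_sub Fintype.card_pos, Nat.cast_one]
  have c₀ : ((Finset.univ.erase i).card : ℝ) = Fintype.card ι₀ - 1 := by
    rw [Finset.card_erase_of_mem (Finset.mem_univ i), Finset.card_univ,
      Nat.cast_sub Fintype.card_pos, Nat.cast_one]
  refine add_le_add (add_le_add (add_le_add (add_le_add hEA.le ?_) ?_) ?_) ?_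
  · rw [Finset.sum_comm, ← c₁, ← nsmul_eq_mul]
    exact Finset.sum_le_card_nsmul _ _ _ hE₁
  · rw [Finset.sum_comm, ← c₂, ← nsmul_eq_mul]
    exact Finset.sum_le_card_nsmul _ _ _ hE₂
  · rw [Finset.sum_comm, ← c₁, ← nsmul_eq_mul]
    refine Finset.sum_le_card_nsmul _ _ _ fun j' hj' => ?_
    rw [Finset.sum_comm, ← c₂, ← nsmul_eq_mul]
    exact Finset.sum_le_card_nsmul _ _ _ (hE₃ j' hj')
  · rw [Finset.sum_comm, ← c₀, ← nsmul_eq_mul]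
    refine Finset.sum_le_card_nsmul _ _ _ fun i' hi' => ?_
    rw [Finset.sum_comm, ← Finset.card_univ, ← nsmul_eq_mul]
    refine Finset.sum_le_card_nsmul _ _ _ fun j' _ => ?_
    rw [Finset.sum_comm, ← Finset.card_univ, ← nsmul_eq_mul]
    exact Finset.sum_le_card_nsmul _ _ _ fun l' _ => hE₀ i' hi' j' l'

end ExpectedError

/-! ### Concentration of the information density. -/

section Chebyshev

variable {α : Type*} [Fintype α]

open scoped Classical in
/-- **Chebyshev's inequality** for sums of independent identically distributed variables. -/
theorem blockLaw_lower_tail_le {q : α → ℝ} (hq : q ∈ stdSimplex ℝ α) (d : α → ℝ) {t : ℝ}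
    (ht : t < ∑ x, q x * d x) {n : ℕ} (hn : 0 < n) :
    ∑ f : Fin n → α, blockLaw (fun _ => q) f * (if ∑ i, d (f i) < n * t then 1 else 0) ≤
      (∑ x, q x * (d x - ∑ x, q x * d x) ^ 2) / (n * (∑ x, q x * d x - t) ^ 2) := by
  set μ := ∑ x, q x * d x with hμ
  set g : α → ℝ := fun x => d x - μ with hg
  have hn' : (0 : ℝ) < n := by exact_mod_cast hn
  have hgap : 0 < μ - t := sub_pos.2 ht
  have hmean : ∑ x, q x * g x = 0 := by
    simp only [hg, mul_sub, Finset.sum_sub_distrib, ← Finset.sum_mul, hq.2]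
    rw [one_mul, ← hμ, sub_self]
  have hvar : ∑ f : Fin n → α, blockLaw (fun _ => q) f * (∑ i, g (f i)) ^ 2 =
      n * ∑ x, q x * g x ^ 2 := by
    have h1 : ∀ f : Fin n → α, blockLaw (fun _ => q) f * (∑ i, g (f i)) ^ 2 =
        ∑ i, ∑ j, blockLaw (fun _ => q) f * (g (f i) * g (f j)) := by
      intro f
      rw [sq, Finset.sum_mul_sum, Finset.mul_sum]
      simp only [Finset.mul_sum]
    simp only [h1]
    rw [Finset.sum_comm]
    have h2 : ∀ i : Fin n, ∑ f : Fin n → α, ∑ j, blockLaw (fun _ => q) f * (g (f i) * g (f j)) =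
        ∑ x, q x * g x ^ 2 := by
      intro i
      rw [Finset.sum_comm, Finset.sum_eq_single i]
      · rw [sum_blockLaw_mul_eval hq i (fun x => g x * g x)]
        simp only [sq]
      · intro j _ hj
        -- Off-diagonal terms vanish, because the centred variables are independent with mean zero.
        rw [sum_blockLaw_mul_eval₂ hq hj.symm (fun x y => g x * g y)]
        refine Finset.sum_eq_zero fun x _ => ?_
        have : ∑ y, q y * (g x * g y) = g x * ∑ y, q y * g y := by
          rw [Finset.mul_sum]
          exact Finset.sum_congr rfl fun _ _ => by ring
        rw [this, hmean, mul_zero, mul_zero]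
      · simp
    simp [h2]
  have hb := (blockLaw_mem (ι := Fin n) (fun _ => hq)).1
  have hpt : ∀ f : Fin n → α, blockLaw (fun _ => q) f *
      (if ∑ i, d (f i) < n * t then (1 : ℝ) else 0) ≤
      blockLaw (fun _ => q) f * (∑ i, g (f i)) ^ 2 / (n * (μ - t)) ^ 2 := by
    intro f
    rw [mul_div_assoc]
    refine mul_le_mul_of_nonneg_left ?_ (hb f)
    split_ifs with h
    · rw [le_div_iff₀ (by positivity), one_mul]
      have hs : ∑ i, g (f i) = ∑ i, d (f i) - n * μ := by
        simp [hg, Finset.sum_sub_distrib]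
      have : n * (μ - t) ≤ -∑ i, g (f i) := by rw [hs]; linarith
      calc (n * (μ - t)) ^ 2 ≤ (-∑ i, g (f i)) ^ 2 := pow_le_pow_left₀ (by positivity) this 2
        _ = _ := neg_sq _
    · positivity
  refine (Finset.sum_le_sum fun f _ => hpt f).trans_eq ?_
  rw [← Finset.sum_div, hvar]
  field_simp
  rfl

open scoped Classical in
/-- A likelihood-ratio threshold below the mean log-likelihood ratio is exceeded with high
probability. -/
theorem eventually_threshold_fails_le {q : α → ℝ} (hq : q ∈ stdSimplex ℝ α) {ρ κ : α → ℝ}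
    (hρ : ∀ x, 0 < q x → 0 < ρ x) (hκ : ∀ x, 0 < q x → 0 < κ x) {t : ℝ}
    (ht : t < ∑ x, q x * Real.logb 2 (κ x / ρ x)) {ε : ℝ} (hε : 0 < ε) :
    ∀ᶠ n : ℕ in Filter.atTop, ∑ f : Fin n → α, blockLaw (fun _ => q) f *
      (if ¬(2 : ℝ) ^ ((n : ℝ) * t) * ∏ i, ρ (f i) ≤ ∏ i, κ (f i) then 1 else 0) ≤ ε := by
  set d : α → ℝ := fun x => Real.logb 2 (κ x / ρ x) with hd
  set μ := ∑ x, q x * d x with hμ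
  set v := ∑ x, q x * (d x - μ) ^ 2 with hv
  have hlim : Filter.Tendsto (fun n : ℕ => v / (n * (μ - t) ^ 2)) Filter.atTop (nhds 0) := by
    have hgap : 0 < (μ - t) ^ 2 := pow_pos (sub_pos.2 ht) 2
    exact tendsto_const_nhds.div_atTop
      (tendsto_natCast_atTop_atTop.atTop_mul_const hgap)
  filter_upwards [hlim.eventually (ge_mem_nhds hε), Filter.eventually_gt_atTop 0] with n hn hn0
  refine le_trans ?_ ((blockLaw_lower_tail_le hq d ht hn0).trans hn)
  refine Finset.sum_le_sum fun f _ => ?_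
  rcases ((blockLaw_mem (ι := Fin n) (fun _ => hq)).1 f).eq_or_lt with h | h
  · rw [← h, zero_mul, zero_mul]
  refine mul_le_mul_of_nonneg_left ?_ h.le
  -- A block of positive probability has all its letters in the support, so all likelihoods are
  -- positive and the logarithms may be taken.
  have hqi : ∀ i, 0 < q (f i) := by
    intro i
    refine (hq.1 (f i)).lt_of_ne fun h0 => h.ne' ?_
    exact Finset.prod_eq_zero (Finset.mem_univ i) h0.symm
  have hρ' : 0 < ∏ i, ρ (f i) := Finset.prod_pos fun i _ => hρ _ (hqi i)
  have hκ' : 0 < ∏ i, κ (f i) := Finset.prod_pos fun i _ => hκ _ (hqi i)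
  have hsum : ∑ i, d (f i) = Real.logb 2 ((∏ i, κ (f i)) / ∏ i, ρ (f i)) := by
    rw [← Finset.prod_div_distrib, Real.logb_prod]
    exact fun i _ => (div_pos (hκ _ (hqi i)) (hρ _ (hqi i))).ne'
  by_cases hT : (2 : ℝ) ^ ((n : ℝ) * t) * ∏ i, ρ (f i) ≤ ∏ i, κ (f i)
  · rw [if_neg (not_not.2 hT)]
    split_ifs <;> simp
  · rw [if_pos hT, if_pos]
    rw [hsum, Real.logb_lt_iff_lt_rpow one_lt_two (div_pos hκ' hρ'), div_lt_iff₀ hρ']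
    exact not_le.1 hT

end Chebyshev

/-! ### Mean information densities equal the rates. -/

section Density

variable {𝒰 𝒳₁ 𝒳₂ 𝒵 : Type*} [Fintype 𝒰] [Fintype 𝒳₁] [Fintype 𝒳₂] [Fintype 𝒵]
  {p : 𝒰 → ℝ} {a : 𝒰 → 𝒳₁ → ℝ} {b : 𝒰 → 𝒳₂ → ℝ} {K : 𝒳₁ → 𝒳₂ → 𝒵 → ℝ}

omit [Fintype 𝒰] [Fintype 𝒳₁] [Fintype 𝒳₂] [Fintype 𝒵] in
theorem pos_of_superLaw_pos (hp : ∀ u, 0 ≤ p u) (ha : ∀ u x, 0 ≤ a u x) (hb : ∀ u x, 0 ≤ b u x)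
    (hK : ∀ x₁ x₂ z, 0 ≤ K x₁ x₂ z) {x : 𝒰 × 𝒳₁ × 𝒳₂ × 𝒵} (h : 0 < superLaw p a b K x) :
    0 < p x.1 ∧ 0 < a x.1 x.2.1 ∧ 0 < b x.1 x.2.2.1 ∧ 0 < K x.2.1 x.2.2.1 x.2.2.2 := by
  unfold superLaw at h
  refine ⟨(hp _).lt_of_ne fun e => ?_, (ha _ _).lt_of_ne fun e => ?_,
    (hb _ _).lt_of_ne fun e => ?_, (hK _ _ _).lt_of_ne fun e => ?_⟩ <;>
  · rw [← e] at h
    simp at h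

omit [Fintype 𝒳₂] [Fintype 𝒵] in
theorem mix₁_pos {α : 𝒳₁ → ℝ} (hα : ∀ x, 0 ≤ α x) (hK : ∀ x₁ x₂ z, 0 ≤ K x₁ x₂ z) {x₁ : 𝒳₁}
    {x₂ : 𝒳₂} {z : 𝒵} (h : 0 < α x₁) (h' : 0 < K x₁ x₂ z) : 0 < mix₁ α K x₂ z :=
  (mul_pos h h').trans_le (Finset.single_le_sum (f := fun x => α x * K x x₂ z)
    (fun x _ => mul_nonneg (hα x) (hK _ _ _)) (Finset.mem_univ x₁))

omit [Fintype 𝒳₁] [Fintype 𝒵] in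
theorem mix₂_pos {β : 𝒳₂ → ℝ} (hβ : ∀ x, 0 ≤ β x) (hK : ∀ x₁ x₂ z, 0 ≤ K x₁ x₂ z) {x₁ : 𝒳₁}
    {x₂ : 𝒳₂} {z : 𝒵} (h : 0 < β x₂) (h' : 0 < K x₁ x₂ z) : 0 < mix₂ β K x₁ z :=
  (mul_pos h h').trans_le (Finset.single_le_sum (f := fun x => β x * K x₁ x z)
    (fun x _ => mul_nonneg (hβ x) (hK _ _ _)) (Finset.mem_univ x₂))

omit [Fintype 𝒵] in
theorem mix_pos {π : 𝒳₁ × 𝒳₂ → ℝ} (hπ : ∀ x, 0 ≤ π x) (hK : ∀ x₁ x₂ z, 0 ≤ K x₁ x₂ z)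
    {x : 𝒳₁ × 𝒳₂} {z : 𝒵} (h : 0 < π x) (h' : 0 < K x.1 x.2 z) : 0 < mix π K z :=
  (mul_pos h h').trans_le (Finset.single_le_sum (f := fun x => π x * K x.1 x.2 z)
    (fun x _ => mul_nonneg (hπ x) (hK _ _ _)) (Finset.mem_univ x))

variable (hp : p ∈ stdSimplex ℝ 𝒰) (ha : ∀ u, a u ∈ stdSimplex ℝ 𝒳₁)
  (hb : ∀ u, b u ∈ stdSimplex ℝ 𝒳₂) (hK : ∀ x₁ x₂, K x₁ x₂ ∈ stdSimplex ℝ 𝒵)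

theorem inputLaw_pos (hp : p ∈ stdSimplex ℝ 𝒰) (ha : ∀ u, a u ∈ stdSimplex ℝ 𝒳₁)
    (hb : ∀ u, b u ∈ stdSimplex ℝ 𝒳₂) {u : 𝒰} {x₁ : 𝒳₁} {x₂ : 𝒳₂} (h : 0 < p u)
    (h₁ : 0 < a u x₁) (h₂ : 0 < b u x₂) : 0 < inputLaw p a b (x₁, x₂) :=
  (mul_pos h (mul_pos h₁ h₂)).trans_le (Finset.single_le_sum
    (f := fun u => p u * prodPmf (a u) (b u) (x₁, x₂))
    (fun u _ => mul_nonneg (hp.1 u) ((prodPmf_mem (ha u) (hb u)).1 _)) (Finset.mem_univ u))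

include hp ha hb hK

/-- All four tests have the same numerator, whose mean logarithm is minus the noise entropy; only
the reference law `ρ` differs. The logarithm of the ratio is split on the support only. -/
theorem sum_superLaw_logb_div {ρ : 𝒰 × 𝒳₁ × 𝒳₂ × 𝒵 → ℝ}
    (hρ : ∀ x, 0 < superLaw p a b K x → 0 < ρ x) :
    ∑ x, superLaw p a b K x * Real.logb 2 (K x.2.1 x.2.2.1 x.2.2.2 / ρ x) =
      ∑ x, superLaw p a b K x * -Real.logb 2 (ρ x) -
        ∑ u, p u * noise (prodPmf (a u) (b u)) K := by
  have hn : ∑ u, p u * noise (prodPmf (a u) (b u)) K =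
      ∑ x, superLaw p a b K x * -Real.logb 2 (K x.2.1 x.2.2.1 x.2.2.2) := by
    simp only [noise, prodPmf, pmfEntropy_eq_sum_logb, superLaw, Fintype.sum_prod_type,
      Finset.mul_sum, ← Finset.sum_neg_distrib]
    refine Finset.sum_congr rfl fun u _ => Finset.sum_congr rfl fun x _ =>
      Finset.sum_congr rfl fun y _ => Finset.sum_congr rfl fun z _ => by ring
  rw [hn, ← Finset.sum_sub_distrib]
  refine Finset.sum_congr rfl fun x _ => ?_
  rcases (superLaw_mem hp ha hb hK).1 x |>.eq_or_lt with h | h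
  · simp [← h]
  · have hKx := (pos_of_superLaw_pos hp.1 (fun u => (ha u).1) (fun u => (hb u).1)
      (fun x y => (hK x y).1) h).2.2.2
    rw [Real.logb_div hKx.ne' (hρ x h).ne']
    ring

/-- The reference law does not depend on `x₁`, so summing over `x₁` first turns `K` into `mix₁` and
yields its entropy. -/
theorem sum_density₁ : ∑ x, superLaw p a b K x *
      Real.logb 2 (K x.2.1 x.2.2.1 x.2.2.2 / mix₁ (a x.1) K x.2.2.1 x.2.2.2) =
      ∑ u, p u * rate₁ (a u) (b u) K := by
  rw [sum_superLaw_logb_div hp ha hb hK (ρ := fun x => mix₁ (a x.1) K x.2.2.1 x.2.2.2)]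
  · simp only [rate₁, mul_sub, Finset.sum_sub_distrib]
    congr 1
    simp only [pmfEntropy_eq_sum_logb, superLaw, Fintype.sum_prod_type,
      ← Finset.sum_neg_distrib, Finset.mul_sum]
    refine Finset.sum_congr rfl fun u _ => ?_
    rw [Finset.sum_comm]
    refine Finset.sum_congr rfl fun y _ => ?_
    rw [Finset.sum_comm]
    refine Finset.sum_congr rfl fun z _ => ?_
    rw [← Finset.sum_mul]
    have : ∑ x, p u * a u x * b u y * K x y z = p u * b u y * mix₁ (a u) K y z := by
      rw [mix₁, Finset.mul_sum]
      exact Finset.sum_congr rfl fun _ _ => by ring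
    rw [this]
    ring
  · intro x h
    obtain ⟨-, h₁, -, h₂⟩ := pos_of_superLaw_pos hp.1 (fun u => (ha u).1) (fun u => (hb u).1)
      (fun x y => (hK x y).1) h
    exact mix₁_pos (ha _).1 (fun x y => (hK x y).1) h₁ h₂

theorem sum_density₂ : ∑ x, superLaw p a b K x *
      Real.logb 2 (K x.2.1 x.2.2.1 x.2.2.2 / mix₂ (b x.1) K x.2.1 x.2.2.2) =
      ∑ u, p u * rate₂ (a u) (b u) K := by
  rw [sum_superLaw_logb_div hp ha hb hK (ρ := fun x => mix₂ (b x.1) K x.2.1 x.2.2.2)]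
  · simp only [rate₂, mul_sub, Finset.sum_sub_distrib]
    congr 1
    simp only [pmfEntropy_eq_sum_logb, superLaw, Fintype.sum_prod_type,
      ← Finset.sum_neg_distrib, Finset.mul_sum]
    refine Finset.sum_congr rfl fun u _ => Finset.sum_congr rfl fun x _ => ?_
    rw [Finset.sum_comm]
    refine Finset.sum_congr rfl fun z _ => ?_
    rw [← Finset.sum_mul]
    have : ∑ y, p u * a u x * b u y * K x y z = p u * a u x * mix₂ (b u) K x z := by
      rw [mix₂, Finset.mul_sum]
      exact Finset.sum_congr rfl fun _ _ => by ring
    rw [this]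
    ring
  · intro x h
    obtain ⟨-, -, h₁, h₂⟩ := pos_of_superLaw_pos hp.1 (fun u => (ha u).1) (fun u => (hb u).1)
      (fun x y => (hK x y).1) h
    exact mix₂_pos (hb _).1 (fun x y => (hK x y).1) h₁ h₂

theorem sum_density_sum : ∑ x, superLaw p a b K x *
      Real.logb 2 (K x.2.1 x.2.2.1 x.2.2.2 / mix (prodPmf (a x.1) (b x.1)) K x.2.2.2) =
      ∑ u, p u * rateSum (prodPmf (a u) (b u)) K := by
  rw [sum_superLaw_logb_div hp ha hb hK (ρ := fun x => mix (prodPmf (a x.1) (b x.1)) K x.2.2.2)]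
  · simp only [rateSum, mul_sub, Finset.sum_sub_distrib]
    congr 1
    simp only [pmfEntropy_eq_sum_logb, superLaw, Fintype.sum_prod_type,
      ← Finset.sum_neg_distrib, Finset.mul_sum]
    refine Finset.sum_congr rfl fun u _ => ?_
    rw [Finset.sum_comm_cycle]
    refine Finset.sum_congr rfl fun z _ => ?_
    simp only [← Finset.sum_mul]
    have : ∑ x, ∑ y, p u * a u x * b u y * K x y z = p u * mix (prodPmf (a u) (b u)) K z := by
      simp only [mix, prodPmf, Finset.mul_sum, Fintype.sum_prod_type]
      exact Finset.sum_congr rfl fun _ _ => Finset.sum_congr rfl fun _ _ => by ring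
    rw [this]
    ring
  · intro x h
    obtain ⟨-, h₁, h₂, h₃⟩ := pos_of_superLaw_pos hp.1 (fun u => (ha u).1) (fun u => (hb u).1)
      (fun x y => (hK x y).1) h
    exact mix_pos (x := (x.2.1, x.2.2.1)) (prodPmf_mem (ha _) (hb _)).1 (fun x y => (hK x y).1)
      (mul_pos h₁ h₂) h₃

theorem sum_density_total : ∑ x, superLaw p a b K x *
      Real.logb 2 (K x.2.1 x.2.2.1 x.2.2.2 / mix (inputLaw p a b) K x.2.2.2) =
      rateSum (inputLaw p a b) K := by
  rw [sum_superLaw_logb_div hp ha hb hK (ρ := fun x => mix (inputLaw p a b) K x.2.2.2), rateSum,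
    noise_inputLaw]
  · congr 1
    rw [← sum_law_mul (superLaw p a b K) (fun x => x.2.2.2)
      (fun z => -Real.logb 2 (mix (inputLaw p a b) K z)), law_superLaw_output,
      pmfEntropy_eq_sum_logb, ← Finset.sum_neg_distrib]
    simp only [mul_neg]
  · intro x h
    obtain ⟨h₀, h₁, h₂, h₃⟩ := pos_of_superLaw_pos hp.1 (fun u => (ha u).1) (fun u => (hb u).1)
      (fun x y => (hK x y).1) h
    exact mix_pos (x := (x.2.1, x.2.2.1)) (inputLaw_mem hp ha hb).1 (fun x y => (hK x y).1)
      (inputLaw_pos hp ha hb h₀ h₁ h₂) h₃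

end Density

/-! ### Memoryless extensions and threshold tests on blocks. -/

section Blocks

variable {𝒰 𝒳₁ 𝒳₂ 𝒵 : Type*} [Fintype 𝒰] [Fintype 𝒳₁] [Fintype 𝒳₂] [Fintype 𝒵] {n : ℕ}

/-- Memoryless extension of a conditional law. -/
def blockCond {𝒰 𝒳 : Type*} (n : ℕ) (a : 𝒰 → 𝒳 → ℝ) (u : Fin n → 𝒰) : (Fin n → 𝒳) → ℝ :=
  blockLaw fun i => a (u i)

/-- Memoryless extension of a channel with two inputs. -/
def blockChannel (n : ℕ) (K : 𝒳₁ → 𝒳₂ → 𝒵 → ℝ) (x₁ : Fin n → 𝒳₁) (x₂ : Fin n → 𝒳₂) :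
    (Fin n → 𝒵) → ℝ :=
  blockLaw fun i => K (x₁ i) (x₂ i)

variable {p : 𝒰 → ℝ} {a : 𝒰 → 𝒳₁ → ℝ} {b : 𝒰 → 𝒳₂ → ℝ} {K : 𝒳₁ → 𝒳₂ → 𝒵 → ℝ}

omit [Fintype 𝒰] in
theorem blockCond_mem (ha : ∀ u, a u ∈ stdSimplex ℝ 𝒳₁) (u : Fin n → 𝒰) :
    blockCond n a u ∈ stdSimplex ℝ (Fin n → 𝒳₁) :=
  blockLaw_mem fun i => ha (u i)

omit [Fintype 𝒳₁] [Fintype 𝒳₂] in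
theorem blockChannel_mem (hK : ∀ x₁ x₂, K x₁ x₂ ∈ stdSimplex ℝ 𝒵) (x₁ : Fin n → 𝒳₁)
    (x₂ : Fin n → 𝒳₂) : blockChannel n K x₁ x₂ ∈ stdSimplex ℝ (Fin n → 𝒵) :=
  blockLaw_mem fun i => hK (x₁ i) (x₂ i)

omit [Fintype 𝒰] [Fintype 𝒳₁] [Fintype 𝒳₂] [Fintype 𝒵] in
-- Quadruples of blocks are blocks of independent quadruples. With the factorisations of `mix₁`,
-- `mix₂` and `mix` below, a block test concerns a product of independent likelihood ratios.
theorem superLaw_block (u : Fin n → 𝒰) (x₁ : Fin n → 𝒳₁) (x₂ : Fin n → 𝒳₂) (z : Fin n → 𝒵) :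
    superLaw (blockLaw fun _ => p) (blockCond n a) (blockCond n b) (blockChannel n K)
      (u, x₁, x₂, z) = blockLaw (fun _ => superLaw p a b K) fun i => (u i, x₁ i, x₂ i, z i) := by
  simp only [superLaw, blockCond, blockChannel, blockLaw, Finset.prod_mul_distrib]

omit [Fintype 𝒳₂] [Fintype 𝒵] in
theorem mix₁_block (α : Fin n → 𝒳₁ → ℝ) (x₂ : Fin n → 𝒳₂) (z : Fin n → 𝒵) :
    mix₁ (blockLaw α) (blockChannel n K) x₂ z = ∏ i, mix₁ (α i) K (x₂ i) (z i) := by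
  simp only [mix₁, blockChannel, blockLaw, Fintype.prod_sum, Finset.prod_mul_distrib]

omit [Fintype 𝒳₁] [Fintype 𝒵] in
theorem mix₂_block (β : Fin n → 𝒳₂ → ℝ) (x₁ : Fin n → 𝒳₁) (z : Fin n → 𝒵) :
    mix₂ (blockLaw β) (blockChannel n K) x₁ z = ∏ i, mix₂ (β i) K (x₁ i) (z i) := by
  simp only [mix₂, blockChannel, blockLaw, Fintype.prod_sum, Finset.prod_mul_distrib]

omit [Fintype 𝒵] in
theorem mix_block {π' : (Fin n → 𝒳₁) × (Fin n → 𝒳₂) → ℝ} {π : Fin n → 𝒳₁ × 𝒳₂ → ℝ}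
    (h : ∀ x₁ x₂, π' (x₁, x₂) = ∏ i, π i (x₁ i, x₂ i)) (z : Fin n → 𝒵) :
    mix π' (blockChannel n K) z = ∏ i, mix (π i) K (z i) := by
  simp only [mix, blockChannel, blockLaw, Fintype.prod_sum, Finset.prod_mul_distrib]
  rw [← (Equiv.arrowProdEquivProdArrow (Fin n) (fun _ => 𝒳₁) (fun _ => 𝒳₂)).sum_comp]
  exact Finset.sum_congr rfl fun x _ => congrArg₂ _ (h _ _) rfl

omit [Fintype 𝒳₁] [Fintype 𝒳₂] in
theorem prodPmf_block (α : Fin n → 𝒳₁ → ℝ) (β : Fin n → 𝒳₂ → ℝ) (x₁ : Fin n → 𝒳₁)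
    (x₂ : Fin n → 𝒳₂) :
    prodPmf (blockLaw α) (blockLaw β) (x₁, x₂) = ∏ i, prodPmf (α i) (β i) (x₁ i, x₂ i) := by
  simp only [prodPmf, blockLaw, Finset.prod_mul_distrib]

omit [Fintype 𝒳₁] [Fintype 𝒳₂] in
theorem inputLaw_block (x₁ : Fin n → 𝒳₁) (x₂ : Fin n → 𝒳₂) :
    inputLaw (blockLaw fun _ => p) (blockCond n a) (blockCond n b) (x₁, x₂) =
      ∏ i, inputLaw p a b (x₁ i, x₂ i) := by
  simp only [inputLaw, Fintype.prod_sum, Finset.prod_mul_distrib]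
  refine Finset.sum_congr rfl fun u _ => ?_
  rw [blockCond, blockCond, prodPmf_block]
  rfl

/-- A block of quadruples as a quadruple of blocks. -/
def quadrupleEquiv (n : ℕ) (𝒰 𝒳₁ 𝒳₂ 𝒵 : Type*) : (Fin n → 𝒰 × 𝒳₁ × 𝒳₂ × 𝒵) ≃
    (Fin n → 𝒰) × (Fin n → 𝒳₁) × (Fin n → 𝒳₂) × (Fin n → 𝒵) where
  toFun f := (fun i => (f i).1, fun i => (f i).2.1, fun i => (f i).2.2.1, fun i => (f i).2.2.2)
  invFun x := fun i => (x.1 i, x.2.1 i, x.2.2.1 i, x.2.2.2 i)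
  left_inv _ := rfl
  right_inv _ := rfl

/-- The threshold of a test that has to separate a code of rate `r`; no test is needed if `r` is
zero. -/
noncomputable def threshold (n : ℕ) (s r : ℝ) : ℝ :=
  open scoped Classical in if r = 0 then 0 else (2 : ℝ) ^ ((n : ℝ) * (s * r))

theorem threshold_pos (n : ℕ) (s : ℝ) {r : ℝ} (hr : r ≠ 0) : 0 < threshold n s r := by
  rw [threshold, if_neg hr]
  positivity

open scoped Classical in
-- For `r > 0` the exponent `s * r` lies strictly below the mean density, and concentration applies.
-- For `r = 0` there may be no gap, but the threshold is zero and the test always passes.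
theorem eventually_test_fails_le {α : Type*} [Fintype α] {q : α → ℝ} (hq : q ∈ stdSimplex ℝ α)
    {ρ κ : α → ℝ} (hρ : ∀ x, 0 < q x → 0 < ρ x) (hκ : ∀ x, 0 < q x → 0 < κ x)
    (hκ0 : ∀ x, 0 ≤ κ x) {s r : ℝ} (hs : s < 1) (hr0 : 0 ≤ r)
    (hr : r ≤ ∑ x, q x * Real.logb 2 (κ x / ρ x)) {ε : ℝ} (hε : 0 < ε) :
    ∀ᶠ n : ℕ in Filter.atTop, ∑ f : Fin n → α, blockLaw (fun _ => q) f *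
      (if ¬threshold n s r * ∏ i, ρ (f i) ≤ ∏ i, κ (f i) then 1 else 0) ≤ ε := by
  rcases hr0.eq_or_lt with h | h
  · refine Filter.Eventually.of_forall fun n => ?_
    rw [Finset.sum_eq_zero]
    · exact hε.le
    · intro f _
      rw [if_neg, mul_zero]
      rw [not_not, threshold, if_pos h.symm, zero_mul]
      exact Finset.prod_nonneg fun i _ => hκ0 _
  · have ht : s * r < ∑ x, q x * Real.logb 2 (κ x / ρ x) := by nlinarith
    filter_upwards [eventually_threshold_fails_le hq hρ hκ ht hε] with n hn
    rw [threshold, if_neg h.ne']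
    exact hn

open scoped Classical in
/-- The correct codewords pass the threshold tests with high probability. -/
theorem eventually_thresholdTest_fails_le {m : ℕ} {q : Fin m → ℝ} {a : Fin m → 𝒳₁ → ℝ}
    {b : Fin m → 𝒳₂ → ℝ} (hq : q ∈ stdSimplex ℝ (Fin m)) (ha : ∀ u, a u ∈ stdSimplex ℝ 𝒳₁)
    (hb : ∀ u, b u ∈ stdSimplex ℝ 𝒳₂) (hK : ∀ x₁ x₂, K x₁ x₂ ∈ stdSimplex ℝ 𝒵)
    {R₀ R₁ R₂ : ℝ} (h : RateBounds q a b K 0 R₀ R₁ R₂) (h₀ : 0 ≤ R₀) (h₁ : 0 ≤ R₁) (h₂ : 0 ≤ R₂)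
    {s : ℝ} (hs : s < 1) {ε : ℝ} (hε : 0 < ε) :
    ∀ᶠ n : ℕ in Filter.atTop, ∑ ω, superLaw (blockLaw fun _ => q) (blockCond n a) (blockCond n b)
      (blockChannel n K) ω * (if ¬thresholdTest (blockLaw fun _ => q) (blockCond n a)
        (blockCond n b) (blockChannel n K) (threshold n s R₁) (threshold n s R₂)
        (threshold n s (R₁ + R₂)) (threshold n s (R₀ + R₁ + R₂)) ω.1 ω.2.1 ω.2.2.1 ω.2.2.2
        then 1 else 0) ≤ ε := by
  have hm := superLaw_mem hq ha hb hK
  have hpos := fun x => pos_of_superLaw_pos (x := x) hq.1 (fun u => (ha u).1) (fun u => (hb u).1)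
    (fun x y => (hK x y).1)
  have hK0 : ∀ x y z, 0 ≤ K x y z := fun x y => (hK x y).1
  obtain ⟨b₁, b₂, b₃, b₀⟩ := h
  rw [add_zero] at b₁ b₂ b₃ b₀
  rw [← sum_density₁ hq ha hb hK] at b₁
  rw [← sum_density₂ hq ha hb hK] at b₂
  rw [← sum_density_sum hq ha hb hK] at b₃
  rw [← sum_density_total hq ha hb hK] at b₀
  have hε4 : 0 < ε / 4 := by positivity
  filter_upwards [
    eventually_test_fails_le hm (ρ := fun x => mix₁ (a x.1) K x.2.2.1 x.2.2.2)
      (κ := fun x => K x.2.1 x.2.2.1 x.2.2.2)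
      (fun x hx => mix₁_pos (ha _).1 hK0 (hpos x hx).2.1 (hpos x hx).2.2.2)
      (fun x hx => (hpos x hx).2.2.2) (fun x => hK0 _ _ _) hs h₁ b₁ hε4,
    eventually_test_fails_le hm (ρ := fun x => mix₂ (b x.1) K x.2.1 x.2.2.2)
      (κ := fun x => K x.2.1 x.2.2.1 x.2.2.2)
      (fun x hx => mix₂_pos (hb _).1 hK0 (hpos x hx).2.2.1 (hpos x hx).2.2.2)
      (fun x hx => (hpos x hx).2.2.2) (fun x => hK0 _ _ _) hs h₂ b₂ hε4,
    eventually_test_fails_le hm (ρ := fun x => mix (prodPmf (a x.1) (b x.1)) K x.2.2.2)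
      (κ := fun x => K x.2.1 x.2.2.1 x.2.2.2)
      (fun x hx => mix_pos (x := (x.2.1, x.2.2.1)) (prodPmf_mem (ha _) (hb _)).1 hK0
        (mul_pos (hpos x hx).2.1 (hpos x hx).2.2.1) (hpos x hx).2.2.2)
      (fun x hx => (hpos x hx).2.2.2) (fun x => hK0 _ _ _) hs (add_nonneg h₁ h₂) b₃ hε4,
    eventually_test_fails_le hm (ρ := fun x => mix (inputLaw q a b) K x.2.2.2)
      (κ := fun x => K x.2.1 x.2.2.1 x.2.2.2)
      (fun x hx => mix_pos (x := (x.2.1, x.2.2.1)) (inputLaw_mem hq ha hb).1 hK0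
        (inputLaw_pos hq ha hb (hpos x hx).1 (hpos x hx).2.1 (hpos x hx).2.2.1) (hpos x hx).2.2.2)
      (fun x hx => (hpos x hx).2.2.2) (fun x => hK0 _ _ _) hs
      (add_nonneg (add_nonneg h₀ h₁) h₂) b₀ hε4] with n e₁ e₂ e₃ e₀
  have hsum := add_le_add (add_le_add (add_le_add e₁ e₂) e₃) e₀
  rw [← Finset.sum_add_distrib, ← Finset.sum_add_distrib, ← Finset.sum_add_distrib] at hsum
  refine le_trans ?_ (hsum.trans (by linarith))
  rw [← (quadrupleEquiv n (Fin m) 𝒳₁ 𝒳₂ 𝒵).sum_comp]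
  refine Finset.sum_le_sum fun f _ => ?_
  have hf : superLaw (blockLaw fun _ => q) (blockCond n a) (blockCond n b) (blockChannel n K)
      (quadrupleEquiv n (Fin m) 𝒳₁ 𝒳₂ 𝒵 f) = blockLaw (fun _ => superLaw q a b K) f :=
    superLaw_block _ _ _ _
  rw [hf, ← mul_add, ← mul_add, ← mul_add]
  refine mul_le_mul_of_nonneg_left ?_ ((blockLaw_mem fun _ => hm).1 f)
  -- From here on: the failure indicator of the combined test is at most the sum of the failure
  -- indicators of the four tests.
  have ind : ∀ P : Prop, (0 : ℝ) ≤ if P then 1 else 0 := fun P => by split_ifs <;> simp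
  by_cases t₁ : threshold n s R₁ * ∏ i, mix₁ (a (f i).1) K (f i).2.2.1 (f i).2.2.2 ≤
      ∏ i, K (f i).2.1 (f i).2.2.1 (f i).2.2.2
  swap
  · rw [if_pos t₁]
    have := ind (¬threshold n s R₂ * ∏ i, mix₂ (b (f i).1) K (f i).2.1 (f i).2.2.2 ≤
      ∏ i, K (f i).2.1 (f i).2.2.1 (f i).2.2.2)
    have := ind (¬threshold n s (R₁ + R₂) * ∏ i, mix (prodPmf (a (f i).1) (b (f i).1)) K
      (f i).2.2.2 ≤ ∏ i, K (f i).2.1 (f i).2.2.1 (f i).2.2.2)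
    have := ind (¬threshold n s (R₀ + R₁ + R₂) * ∏ i, mix (inputLaw q a b) K (f i).2.2.2 ≤
      ∏ i, K (f i).2.1 (f i).2.2.1 (f i).2.2.2)
    split_ifs <;> linarith
  by_cases t₂ : threshold n s R₂ * ∏ i, mix₂ (b (f i).1) K (f i).2.1 (f i).2.2.2 ≤
      ∏ i, K (f i).2.1 (f i).2.2.1 (f i).2.2.2
  swap
  · rw [if_pos t₂]
    split_ifs <;> norm_num
  by_cases t₃ : threshold n s (R₁ + R₂) * ∏ i, mix (prodPmf (a (f i).1) (b (f i).1)) K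
      (f i).2.2.2 ≤ ∏ i, K (f i).2.1 (f i).2.2.1 (f i).2.2.2
  swap
  · rw [if_pos t₃]
    split_ifs <;> norm_num
  by_cases t₀ : threshold n s (R₀ + R₁ + R₂) * ∏ i, mix (inputLaw q a b) K (f i).2.2.2 ≤
      ∏ i, K (f i).2.1 (f i).2.2.1 (f i).2.2.2
  swap
  · rw [if_pos t₀]
    split_ifs <;> norm_num
  rw [if_neg]
  · split_ifs
    norm_num
  · rw [not_not]
    refine ⟨?_, ?_, ?_, ?_⟩
    · rw [blockCond, mix₁_block]
      exact t₁
    · rw [blockCond, mix₂_block]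
      exact t₂
    · rw [blockCond, blockCond, mix_block (prodPmf_block _ _)]
      exact t₃
    · rw [mix_block (π := fun _ => inputLaw q a b) inputLaw_block]
      exact t₀

end Blocks

/-! ### Conferencing codes built from superposition codes. -/

section CloudCode

variable {X₁ X₂ Y₁ Y₂ : Type*} {M₁ M₂ A₁ A₂ N₁ N₂ n : ℕ}

/-- The code in which each encoder communicates a part of its message to the other one in a single
conferencing round, so that the exchanged parts select the cloud of a superposition code. The
decoders do not confer. -/
def cloudCode (φ₁ : Fin M₁ → Fin A₁ × Fin N₁) (φ₂ : Fin M₂ → Fin A₂ × Fin N₂)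
    (ψ₁ : Fin A₁ × Fin N₁ → Fin M₁) (ψ₂ : Fin A₂ × Fin N₂ → Fin M₂)
    (x₁ : Fin A₁ × Fin A₂ → Fin N₁ → Fin n → X₁) (x₂ : Fin A₁ × Fin A₂ → Fin N₂ → Fin n → X₂)
    (d₁ : (Fin n → Y₁) → (Fin A₁ × Fin A₂) × Fin N₁ × Fin N₂)
    (d₂ : (Fin n → Y₂) → (Fin A₁ × Fin A₂) × Fin N₁ × Fin N₂) : Code X₁ X₂ Y₁ Y₂ M₁ M₂ n where
  encConf :=
    { rounds := 1
      card₁ := fun _ => A₁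
      card₂ := fun _ => A₂
      send₁ := fun _ w _ => (φ₁ w).1
      send₂ := fun _ w _ => (φ₂ w).1 }
  enc₁ := fun w v => x₁ ((φ₁ w).1, v 0) (φ₁ w).2
  enc₂ := fun w v => x₂ (v 0, (φ₂ w).1) (φ₂ w).2
  decConf :=
    { rounds := 0
      card₁ := fun _ => 1
      card₂ := fun _ => 1
      send₁ := fun _ _ _ => 0
      send₂ := fun _ _ _ => 0 }
  dec₁ := fun y _ => (ψ₁ ((d₁ y).1.1, (d₁ y).2.1), ψ₂ ((d₁ y).1.2, (d₁ y).2.2))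
  dec₂ := fun y _ => (ψ₁ ((d₂ y).1.1, (d₂ y).2.1), ψ₂ ((d₂ y).1.2, (d₂ y).2.2))

theorem cloudCode_withinBudget (φ₁ : Fin M₁ → Fin A₁ × Fin N₁) (φ₂ : Fin M₂ → Fin A₂ × Fin N₂)
    (ψ₁ : Fin A₁ × Fin N₁ → Fin M₁) (ψ₂ : Fin A₂ × Fin N₂ → Fin M₂)
    (x₁ : Fin A₁ × Fin A₂ → Fin N₁ → Fin n → X₁) (x₂ : Fin A₁ × Fin A₂ → Fin N₂ → Fin n → X₂)
    (d₁ : (Fin n → Y₁) → (Fin A₁ × Fin A₂) × Fin N₁ × Fin N₂)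
    (d₂ : (Fin n → Y₂) → (Fin A₁ × Fin A₂) × Fin N₁ × Fin N₂) {B₁₂ B₂₁ : ℝ}
    (h₁ : Real.logb 2 A₁ ≤ n * B₁₂) (h₂ : Real.logb 2 A₂ ≤ n * B₂₁) :
    (cloudCode φ₁ φ₂ ψ₁ ψ₂ x₁ x₂ d₁ d₂).encConf.WithinBudget n B₁₂ B₂₁ ∧
      (cloudCode φ₁ φ₂ ψ₁ ψ₂ x₁ x₂ d₁ d₂).decConf.WithinBudget n 0 0 := by
  refine ⟨⟨?_, ?_⟩, ?_, ?_⟩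
  · refine le_trans (le_of_eq ?_) h₁
    exact (Fin.sum_univ_one (fun _ : Fin 1 => Real.logb 2 (A₁ : ℝ)))
  · refine le_trans (le_of_eq ?_) h₂
    exact (Fin.sum_univ_one (fun _ : Fin 1 => Real.logb 2 (A₂ : ℝ)))
  · rw [mul_zero]
    exact (Fin.sum_univ_zero (fun _ : Fin 0 => Real.logb 2 ((1 : ℕ) : ℝ))).le
  · rw [mul_zero]
    exact (Fin.sum_univ_zero (fun _ : Fin 0 => Real.logb 2 ((1 : ℕ) : ℝ))).le

variable [Fintype Y₁] [Fintype Y₂]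

theorem sum_snd_prod_eq (W : X₁ → X₂ → stdSimplex ℝ (Y₁ × Y₂)) (x₁ : Fin n → X₁) (x₂ : Fin n → X₂)
    (y₁ : Fin n → Y₁) :
    ∑ y₂ : Fin n → Y₂, ∏ j, (W (x₁ j) (x₂ j) : Y₁ × Y₂ → ℝ) (y₁ j, y₂ j) =
      blockChannel n (receiver W Prod.fst) x₁ x₂ y₁ := by
  classical
  rw [← Fintype.prod_sum (fun j y => (W (x₁ j) (x₂ j) : Y₁ × Y₂ → ℝ) (y₁ j, y))]
  refine Finset.prod_congr rfl fun j _ => ?_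
  simp only [receiver, law, Fintype.sum_prod_type]
  rw [Finset.sum_comm]
  simp

theorem sum_fst_prod_eq (W : X₁ → X₂ → stdSimplex ℝ (Y₁ × Y₂)) (x₁ : Fin n → X₁) (x₂ : Fin n → X₂)
    (y₂ : Fin n → Y₂) :
    ∑ y₁ : Fin n → Y₁, ∏ j, (W (x₁ j) (x₂ j) : Y₁ × Y₂ → ℝ) (y₁ j, y₂ j) =
      blockChannel n (receiver W Prod.snd) x₁ x₂ y₂ := by
  classical
  rw [← Fintype.prod_sum (fun j y => (W (x₁ j) (x₂ j) : Y₁ × Y₂ → ℝ) (y, y₂ j))]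
  refine Finset.prod_congr rfl fun j _ => ?_
  simp only [receiver, law, Fintype.sum_prod_type]
  simp

open scoped Classical in
-- Union bound over the decoders. Without decoder conferencing each event depends on one output
-- block, so only the marginal channels appear and any correlation of the outputs is irrelevant.
theorem cloudCode_errorProb_le (W : X₁ → X₂ → stdSimplex ℝ (Y₁ × Y₂))
    (φ₁ : Fin M₁ → Fin A₁ × Fin N₁) (φ₂ : Fin M₂ → Fin A₂ × Fin N₂)
    (ψ₁ : Fin A₁ × Fin N₁ → Fin M₁) (ψ₂ : Fin A₂ × Fin N₂ → Fin M₂)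
    (h₁ : ∀ w, ψ₁ (φ₁ w) = w) (h₂ : ∀ w, ψ₂ (φ₂ w) = w)
    (x₁ : Fin A₁ × Fin A₂ → Fin N₁ → Fin n → X₁) (x₂ : Fin A₁ × Fin A₂ → Fin N₂ → Fin n → X₂)
    (d₁ : (Fin n → Y₁) → (Fin A₁ × Fin A₂) × Fin N₁ × Fin N₂)
    (d₂ : (Fin n → Y₂) → (Fin A₁ × Fin A₂) × Fin N₁ × Fin N₂) :
    (cloudCode φ₁ φ₂ ψ₁ ψ₂ x₁ x₂ d₁ d₂).errorProb W ≤ (1 / ((M₁ : ℝ) * M₂)) * ∑ w₁, ∑ w₂,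
      (∑ y, blockChannel n (receiver W Prod.fst) (x₁ ((φ₁ w₁).1, (φ₂ w₂).1) (φ₁ w₁).2)
          (x₂ ((φ₁ w₁).1, (φ₂ w₂).1) (φ₂ w₂).2) y *
          (if d₁ y ≠ (((φ₁ w₁).1, (φ₂ w₂).1), (φ₁ w₁).2, (φ₂ w₂).2) then 1 else 0) +
        ∑ y, blockChannel n (receiver W Prod.snd) (x₁ ((φ₁ w₁).1, (φ₂ w₂).1) (φ₁ w₁).2)
          (x₂ ((φ₁ w₁).1, (φ₂ w₂).1) (φ₂ w₂).2) y *
          (if d₂ y ≠ (((φ₁ w₁).1, (φ₂ w₂).1), (φ₁ w₁).2, (φ₂ w₂).2) then 1 else 0)) := by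
  unfold Code.errorProb
  refine mul_le_mul_of_nonneg_left (Finset.sum_le_sum fun w₁ _ => Finset.sum_le_sum fun w₂ _ => ?_)
    (by positivity)
  set m := (((φ₁ w₁).1, (φ₂ w₂).1), (φ₁ w₁).2, (φ₂ w₂).2) with hm
  set c := cloudCode φ₁ φ₂ ψ₁ ψ₂ x₁ x₂ d₁ d₂ with hc
  have hc₁ : c.codeword₁ w₁ w₂ = x₁ ((φ₁ w₁).1, (φ₂ w₂).1) (φ₁ w₁).2 := by
    exact congrArg (fun v => x₁ ((φ₁ w₁).1, v) (φ₁ w₁).2) (c.encConf.sent₂_eq w₁ w₂ (0 : Fin 1))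
  have hc₂ : c.codeword₂ w₁ w₂ = x₂ ((φ₁ w₁).1, (φ₂ w₂).1) (φ₂ w₂).2 := by
    exact congrArg (fun v => x₂ (v, (φ₂ w₂).1) (φ₂ w₂).2) (c.encConf.sent₁_eq w₁ w₂ (0 : Fin 1))
  have he₁ : ∀ y₁ y₂, d₁ y₁ = m → c.estimate₁ y₁ y₂ = (w₁, w₂) := by
    intro y₁ y₂ h
    change (ψ₁ ((d₁ y₁).1.1, (d₁ y₁).2.1), ψ₂ ((d₁ y₁).1.2, (d₁ y₁).2.2)) = _
    rw [h]
    exact Prod.ext (h₁ w₁) (h₂ w₂)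
  have he₂ : ∀ y₁ y₂, d₂ y₂ = m → c.estimate₂ y₁ y₂ = (w₁, w₂) := by
    intro y₁ y₂ h
    change (ψ₁ ((d₂ y₂).1.1, (d₂ y₂).2.1), ψ₂ ((d₂ y₂).1.2, (d₂ y₂).2.2)) = _
    rw [h]
    exact Prod.ext (h₁ w₁) (h₂ w₂)
  rw [hc₁, hc₂]
  set ξ₁ := x₁ ((φ₁ w₁).1, (φ₂ w₂).1) (φ₁ w₁).2
  set ξ₂ := x₂ ((φ₁ w₁).1, (φ₂ w₂).1) (φ₂ w₂).2
  have hswap :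
      ∑ y, blockChannel n (receiver W Prod.snd) ξ₁ ξ₂ y * (if d₂ y ≠ m then (1 : ℝ) else 0) =
      ∑ y₁ : Fin n → Y₁, ∑ y₂ : Fin n → Y₂, (∏ j, (W (ξ₁ j) (ξ₂ j) : Y₁ × Y₂ → ℝ) (y₁ j, y₂ j)) *
        (if d₂ y₂ ≠ m then 1 else 0) := by
    simp only [← sum_fst_prod_eq, Finset.sum_mul]
    exact Finset.sum_comm
  rw [hswap]
  simp only [← sum_snd_prod_eq, Finset.sum_mul]
  rw [← Finset.sum_add_distrib]
  refine Finset.sum_le_sum fun y₁ _ => ?_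
  rw [← Finset.sum_add_distrib]
  refine Finset.sum_le_sum fun y₂ _ => ?_
  have hnn : 0 ≤ ∏ j, (W (ξ₁ j) (ξ₂ j) : Y₁ × Y₂ → ℝ) (y₁ j, y₂ j) :=
    Finset.prod_nonneg fun j _ => (W (ξ₁ j) (ξ₂ j)).2.1 _
  by_cases e₁ : d₁ y₁ = m <;> by_cases e₂ : d₂ y₂ = m
  · rw [if_neg (by rw [he₁ _ _ e₁, he₂ _ _ e₂]; simp)]
    positivity
  all_goals
    simp only [ne_eq, e₁, e₂, not_true_eq_false, not_false_eq_true, if_true, if_false, mul_one,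
      mul_zero, add_zero, zero_add]
    split_ifs <;> linarith

end CloudCode

/-! ### Competitor counts against thresholds. -/

section Rates

/-- At most `D 2^(n t r)` competitors meet a threshold `2^(n s r)` with `t < s`, so the product
decays exponentially. For `r = 0` the threshold is zero and the convention `1 / 0 = 0` makes the
term vanish. -/
theorem eventually_union_le {c : ℕ → ℝ} {D t s r : ℝ} (hr : 0 ≤ r) (hts : t < s)
    (hc : ∀ n, c n ≤ D * (2 : ℝ) ^ ((n : ℝ) * (t * r))) {ε : ℝ}
    (hε : 0 < ε) : ∀ᶠ n : ℕ in Filter.atTop, c n * (1 / threshold n s r) ≤ ε := by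
  rcases hr.eq_or_lt with h | h
  · refine Filter.Eventually.of_forall fun n => ?_
    rw [threshold, if_pos h.symm]
    simp [hε.le]
  · have hgap : 0 < (s - t) * r := mul_pos (sub_pos.2 hts) h
    have hlim : Filter.Tendsto (fun n : ℕ => D * ((2 : ℝ) ^ (-((s - t) * r))) ^ n) Filter.atTop
        (nhds (D * 0)) := by
      refine Filter.Tendsto.const_mul D (tendsto_pow_atTop_nhds_zero_of_lt_one (by positivity) ?_)
      exact Real.rpow_lt_one_of_one_lt_of_neg one_lt_two (neg_lt_zero.2 hgap)
    rw [mul_zero] at hlim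
    filter_upwards [hlim.eventually (ge_mem_nhds hε)] with n hn
    refine le_trans ?_ hn
    rw [threshold, if_neg h.ne', one_div, ← Real.rpow_neg two_pos.le]
    refine (mul_le_mul_of_nonneg_right (hc n) (by positivity)).trans_eq ?_
    rw [mul_assoc, ← Real.rpow_add two_pos, ← Real.rpow_natCast, ← Real.rpow_mul two_pos.le]
    congr 2
    ring

end Rates

/-! ### Existence of good codes and the direct part. -/

section Achievability

theorem exists_le_of_mean_le {α : Type*} [Fintype α] {q F : α → ℝ} (hq : q ∈ stdSimplex ℝ α)
    {ε : ℝ} (h : ∑ x, q x * F x ≤ ε) : ∃ x, F x ≤ ε := by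
  by_contra! hlt
  have hnn : ∀ x, 0 ≤ q x * (F x - ε) := fun x => mul_nonneg (hq.1 x) (sub_nonneg.2 (hlt x).le)
  have hsum : ∑ x, q x * (F x - ε) = 0 := by
    refine le_antisymm ?_ (Finset.sum_nonneg fun x _ => hnn x)
    simp only [mul_sub, Finset.sum_sub_distrib, ← Finset.sum_mul, hq.2]
    linarith
  rw [Finset.sum_eq_zero_iff_of_nonneg fun x _ => hnn x] at hsum
  have hq0 : ∀ x, q x = 0 := fun x =>
    (mul_eq_zero.1 (hsum x (Finset.mem_univ x))).resolve_right (sub_pos.2 (hlt x)).ne'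
  have := hq.2
  simp [hq0] at this

/-- The number of messages of a code of block length `n` and rate `r`. -/
noncomputable def messageCount (n : ℕ) (r : ℝ) : ℕ := ⌈(2 : ℝ) ^ ((n : ℝ) * r)⌉₊

theorem messageCount_pos (n : ℕ) (r : ℝ) : 0 < messageCount n r :=
  Nat.ceil_pos.2 (Real.rpow_pos_of_pos two_pos _)

theorem rpow_le_messageCount (n : ℕ) (r : ℝ) : (2 : ℝ) ^ ((n : ℝ) * r) ≤ messageCount n r :=
  Nat.le_ceil _

theorem messageCount_sub_one_le (n : ℕ) (r : ℝ) :
    (messageCount n r : ℝ) - 1 ≤ (2 : ℝ) ^ ((n : ℝ) * r) := by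
  have := (Nat.ceil_lt_add_one (Real.rpow_pos_of_pos two_pos ((n : ℝ) * r)).le).le
  unfold messageCount
  linarith

theorem messageCount_sub_one_nonneg (n : ℕ) (r : ℝ) : 0 ≤ (messageCount n r : ℝ) - 1 := by
  have : (1 : ℝ) ≤ messageCount n r := by exact_mod_cast messageCount_pos n r
  linarith

theorem messageCount_le (n : ℕ) {r : ℝ} (hr : 0 ≤ r) :
    (messageCount n r : ℝ) ≤ 2 * (2 : ℝ) ^ ((n : ℝ) * r) :=
  ceil_le_two_mul (one_le_two_rpow (by positivity))

theorem messageCount_zero (n : ℕ) : messageCount n 0 = 1 := by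
  simp [messageCount]

/-- Lets a message set be embedded into pairs of an announced part and a private part despite the
rounding. -/
theorem messageCount_add_le (n : ℕ) (r r' : ℝ) :
    messageCount n (r + r') ≤ messageCount n r * messageCount n r' := by
  refine Nat.ceil_le.2 ?_
  rw [mul_add, Real.rpow_add two_pos, Nat.cast_mul]
  exact mul_le_mul (rpow_le_messageCount n r) (rpow_le_messageCount n r') (by positivity)
    (by positivity)

/-- The scaling by `l < 1` pays for the bit lost in rounding. At rate zero there is one message and
no bit is sent, so a link of capacity zero causes no trouble. -/
theorem eventually_logb_messageCount_le {r l : ℝ} (hr : 0 ≤ r) (hl : l < 1) (hl0 : 0 ≤ l) {B : ℝ}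
    (hB : r ≤ B) :
    ∀ᶠ n : ℕ in Filter.atTop, Real.logb 2 (messageCount n (l * r)) ≤ n * B := by
  rcases hr.eq_or_lt with h | h
  · refine Filter.Eventually.of_forall fun n => ?_
    rw [← h, mul_zero, messageCount_zero, Nat.cast_one, Real.logb_one]
    exact mul_nonneg (Nat.cast_nonneg n) (hr.trans hB)
  · have hgap : 0 < (1 - l) * r := mul_pos (sub_pos.2 hl) h
    obtain ⟨k, hk⟩ := exists_nat_gt (1 / ((1 - l) * r))
    filter_upwards [Filter.eventually_ge_atTop k] with n hn
    have hkn : (k : ℝ) ≤ n := by exact_mod_cast hn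
    have h1 := logb_ceil_le n (mul_nonneg hl0 hr)
    have h2 := hk.trans_le hkn
    rw [div_lt_iff₀ hgap] at h2
    have h3 : (n : ℝ) * r ≤ n * B := mul_le_mul_of_nonneg_left hB (Nat.cast_nonneg n)
    have h4 : (n : ℝ) * (l * r) + 1 ≤ n * r := by nlinarith
    exact h1.trans (h4.trans h3)

theorem subsingleton_fin_messageCount_zero (n : ℕ) : Subsingleton (Fin (messageCount n 0)) := by
  rw [messageCount_zero]
  infer_instance

theorem ne_zero_of_distinct_messages {n : ℕ} {l r : ℝ} {j j' : Fin (messageCount n (l * r))}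
    (h : j ≠ j') : r ≠ 0 := by
  rintro rfl
  have : Subsingleton (Fin (messageCount n (l * 0))) := by
    rw [mul_zero]
    exact subsingleton_fin_messageCount_zero n
  exact h (Subsingleton.elim _ _)

variable {X₁ X₂ Z : Type*} [Fintype X₁] [Fintype X₂] [Fintype Z]

open scoped Classical in
/-- Random coding over a memoryless channel: the expected error probability of each message vanishes
at rates in the interior of the rate region of the receiver. -/
theorem eventually_expected_error_le {m : ℕ} {q : Fin m → ℝ} {a : Fin m → X₁ → ℝ}
    {b : Fin m → X₂ → ℝ} {K : X₁ → X₂ → Z → ℝ} (hq : q ∈ stdSimplex ℝ (Fin m))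
    (ha : ∀ u, a u ∈ stdSimplex ℝ X₁) (hb : ∀ u, b u ∈ stdSimplex ℝ X₂)
    (hK : ∀ x₁ x₂, K x₁ x₂ ∈ stdSimplex ℝ Z) {r₁ r₂ R₁ R₂ : ℝ}
    (h : RateBounds q a b K 0 (r₁ + r₂) R₁ R₂) (hr₁ : 0 ≤ r₁) (hr₂ : 0 ≤ r₂)
    (hR₁ : 0 ≤ R₁) (hR₂ : 0 ≤ R₂) {l s : ℝ} (hl : 0 ≤ l) (hls : l < s) (hs : s < 1) {ε : ℝ}
    (hε : 0 < ε) :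
    ∀ᶠ n : ℕ in Filter.atTop, ∃ d : (Fin (messageCount n (l * r₁)) × Fin (messageCount n (l * r₂)) →
        (Fin n → Fin m) × (Fin (messageCount n (l * R₁)) → Fin n → X₁) ×
          (Fin (messageCount n (l * R₂)) → Fin n → X₂)) → (Fin n → Z) →
        (Fin (messageCount n (l * r₁)) × Fin (messageCount n (l * r₂))) ×
          Fin (messageCount n (l * R₁)) × Fin (messageCount n (l * R₂)),
      ∀ i j k, ∑ c, blockLaw (fun _ => cloudLaw (blockLaw fun _ => q) (blockCond n a)
        (blockCond n b)) c * ∑ y, blockChannel n K ((c i).2.1 j) ((c i).2.2 k) y *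
          (if d c y ≠ (i, j, k) then 1 else 0) ≤ ε := by
  -- One fifth for each of the five terms of `expected_error_le`.
  have hε5 : 0 < ε / 5 := by positivity
  filter_upwards [
    eventually_thresholdTest_fails_le hq ha hb hK h (add_nonneg hr₁ hr₂) hR₁ hR₂ hs hε5,
    eventually_union_le (c := fun n => (messageCount n (l * R₁) : ℝ) - 1) (D := 1) hR₁ hls
      (fun n => by
        rw [one_mul]
        exact messageCount_sub_one_le n _) hε5,
    eventually_union_le (c := fun n => (messageCount n (l * R₂) : ℝ) - 1) (D := 1) hR₂ hls
      (fun n => by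
        rw [one_mul]
        exact messageCount_sub_one_le n _) hε5,
    eventually_union_le (c := fun n => ((messageCount n (l * R₁) : ℝ) - 1) *
      ((messageCount n (l * R₂) : ℝ) - 1)) (D := 1) (add_nonneg hR₁ hR₂) hls
      (fun n => by
        rw [one_mul, mul_add, mul_add, Real.rpow_add two_pos]
        exact mul_le_mul (messageCount_sub_one_le n _) (messageCount_sub_one_le n _)
          (messageCount_sub_one_nonneg n _) (by positivity)) hε5,
    -- The constant `16` is a factor two of rounding for each of the four message sets.
    eventually_union_le (c := fun n => (((messageCount n (l * r₁) : ℝ) *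
      (messageCount n (l * r₂) : ℝ)) - 1) * ((messageCount n (l * R₁) : ℝ) *
      (messageCount n (l * R₂) : ℝ))) (D := 16) (r := r₁ + r₂ + R₁ + R₂)
      (add_nonneg (add_nonneg (add_nonneg hr₁ hr₂) hR₁) hR₂) hls
      (fun n => by
        have e₁ := messageCount_le n (mul_nonneg hl hr₁)
        have e₂ := messageCount_le n (mul_nonneg hl hr₂)
        have e₃ := messageCount_le n (mul_nonneg hl hR₁)
        have e₄ := messageCount_le n (mul_nonneg hl hR₂)
        have e₁₂ := mul_le_mul e₁ e₂ (by positivity) (by positivity)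
        have e₃₄ := mul_le_mul e₃ e₄ (by positivity) (by positivity)
        have := mul_le_mul ((sub_le_self _ zero_le_one).trans e₁₂) e₃₄ (by positivity)
          (by positivity)
        refine this.trans_eq ?_
        rw [mul_add l, mul_add l, mul_add l, mul_add, mul_add, mul_add, Real.rpow_add two_pos,
          Real.rpow_add two_pos, Real.rpow_add two_pos]
        ring) hε5] with n f u₁ u₂ u₃ u₀
  have p₁ := messageCount_pos n (l * r₁)
  have p₂ := messageCount_pos n (l * r₂)
  have p₃ := messageCount_pos n (l * R₁)
  have p₄ := messageCount_pos n (l * R₂)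
  have : Nonempty (Fin (messageCount n (l * r₁))) := ⟨⟨0, p₁⟩⟩
  have : Nonempty (Fin (messageCount n (l * r₂))) := ⟨⟨0, p₂⟩⟩
  have : Nonempty (Fin (messageCount n (l * R₁))) := ⟨⟨0, p₃⟩⟩
  have : Nonempty (Fin (messageCount n (l * R₂))) := ⟨⟨0, p₄⟩⟩
  refine ⟨cloudDecoder (thresholdTest (blockLaw fun _ => q) (blockCond n a) (blockCond n b)
    (blockChannel n K) (threshold n s R₁) (threshold n s R₂) (threshold n s (R₁ + R₂))
    (threshold n s (r₁ + r₂ + R₁ + R₂))), fun i j k => ?_⟩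
  refine (expected_error_le (blockLaw_mem fun _ => hq) (blockCond_mem ha) (blockCond_mem hb)
    (blockChannel_mem hK)
    (fun j j' hj => threshold_pos n s (ne_zero_of_distinct_messages hj))
    (fun j j' hj => threshold_pos n s (ne_zero_of_distinct_messages hj))
    (fun j j' k k' hj _ => threshold_pos n s (add_pos_of_pos_of_nonneg
      (hR₁.lt_of_ne (ne_zero_of_distinct_messages hj).symm) hR₂).ne')
    (fun i i' hi => threshold_pos n s fun h0 => hi (by
      have z₁ : r₁ = 0 := by linarith
      have z₂ : r₂ = 0 := by linarith
      refine Prod.ext ?_ ?_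
      · by_contra hne
        exact ne_zero_of_distinct_messages hne z₁
      · by_contra hne
        exact ne_zero_of_distinct_messages hne z₂)) i j k).trans ?_
  simp only [Fintype.card_prod, Fintype.card_fin, Nat.cast_mul]
  rw [mul_assoc] at u₃
  rw [mul_assoc, mul_assoc] at u₀
  linarith

/-- Derandomisation: averages over codebooks and over messages are exchanged, so a bound for every
message on average over codebooks gives one codebook that is good on average over messages. -/
theorem exists_le_of_average_mean_le {ι κ₁ κ₂ : Type*} [Fintype ι] [Fintype κ₁] [Fintype κ₂]
    [Nonempty κ₁] [Nonempty κ₂] {μ : ι → ℝ} (hμ : μ ∈ stdSimplex ℝ ι) {f : ι → ℝ}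
    {e : ι → κ₁ → κ₂ → ℝ} {ε : ℝ}
    (hf : ∀ i, f i ≤ (1 / ((Fintype.card κ₁ : ℝ) * Fintype.card κ₂)) * ∑ k₁, ∑ k₂, e i k₁ k₂)
    (he : ∀ k₁ k₂, ∑ i, μ i * e i k₁ k₂ ≤ ε) : ∃ i, f i ≤ ε := by
  have hcard : 0 < (Fintype.card κ₁ : ℝ) * Fintype.card κ₂ :=
    mul_pos (Nat.cast_pos.2 Fintype.card_pos) (Nat.cast_pos.2 Fintype.card_pos)
  refine exists_le_of_mean_le hμ ?_
  refine (Finset.sum_le_sum fun i _ => mul_le_mul_of_nonneg_left (hf i) (hμ.1 i)).trans ?_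
  simp only [mul_left_comm (μ _) (1 / _) _, ← Finset.mul_sum]
  rw [one_div, inv_mul_le_iff₀ hcard]
  calc ∑ i, μ i * ∑ k₁, ∑ k₂, e i k₁ k₂ = ∑ k₁, ∑ k₂, ∑ i, μ i * e i k₁ k₂ := by
        simp only [Finset.mul_sum]
        rw [Finset.sum_comm]
        exact Finset.sum_congr rfl fun k₁ _ => Finset.sum_comm
    _ ≤ ∑ _k₁ : κ₁, ∑ _k₂ : κ₂, ε :=
        Finset.sum_le_sum fun k₁ _ => Finset.sum_le_sum fun k₂ _ => he k₁ k₂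
    _ = Fintype.card κ₁ * Fintype.card κ₂ * ε := by simp [mul_assoc]

/-- The same codebook must serve both decoders, and it does because their expected errors add. The
messages only have to inject into the index pairs, since the bounds hold for every index triple. -/
theorem exists_code_of_expected_error_le {Y₁ Y₂ : Type*} [Fintype Y₁] [Fintype Y₂] {V : Type*}
    [Fintype V] {M₁ M₂ A₁ A₂ N₁ N₂ n : ℕ} [NeZero M₁] [NeZero M₂]
    (W : X₁ → X₂ → stdSimplex ℝ (Y₁ × Y₂)) {B₁₂ B₂₁ : ℝ} (hA₁ : Real.logb 2 A₁ ≤ n * B₁₂)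
    (hA₂ : Real.logb 2 A₂ ≤ n * B₂₁) (hM₁ : M₁ ≤ A₁ * N₁) (hM₂ : M₂ ≤ A₂ * N₂)
    {μ : (Fin A₁ × Fin A₂ → V × (Fin N₁ → Fin n → X₁) × (Fin N₂ → Fin n → X₂)) → ℝ}
    (hμ : μ ∈ stdSimplex ℝ _) {δ₁ δ₂ : ℝ}
    {d₁ : (Fin A₁ × Fin A₂ → V × (Fin N₁ → Fin n → X₁) × (Fin N₂ → Fin n → X₂)) → (Fin n → Y₁) →
      (Fin A₁ × Fin A₂) × Fin N₁ × Fin N₂}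
    {d₂ : (Fin A₁ × Fin A₂ → V × (Fin N₁ → Fin n → X₁) × (Fin N₂ → Fin n → X₂)) → (Fin n → Y₂) →
      (Fin A₁ × Fin A₂) × Fin N₁ × Fin N₂}
    (h₁ : ∀ i j k, ∑ c, μ c * ∑ y, blockChannel n (receiver W Prod.fst) ((c i).2.1 j) ((c i).2.2 k)
      y * (if d₁ c y ≠ (i, j, k) then 1 else 0) ≤ δ₁)
    (h₂ : ∀ i j k, ∑ c, μ c * ∑ y, blockChannel n (receiver W Prod.snd) ((c i).2.1 j) ((c i).2.2 k)
      y * (if d₂ c y ≠ (i, j, k) then 1 else 0) ≤ δ₂) :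
    ∃ c : Code X₁ X₂ Y₁ Y₂ M₁ M₂ n, c.encConf.WithinBudget n B₁₂ B₂₁ ∧
      c.decConf.WithinBudget n 0 0 ∧ c.errorProb W ≤ δ₁ + δ₂ := by
  have embed : ∀ M A N : ℕ, NeZero M → M ≤ A * N → ∃ (φ : Fin M → Fin A × Fin N)
      (ψ : Fin A × Fin N → Fin M), ∀ w, ψ (φ w) = w := by
    intro M A N hM h
    obtain ⟨φ⟩ : Nonempty (Fin M ↪ Fin A × Fin N) :=
      Function.Embedding.nonempty_of_card_le (by simpa using h)
    exact ⟨φ, Function.invFun φ, Function.leftInverse_invFun φ.injective⟩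
  obtain ⟨φ₁, ψ₁, hφ₁⟩ := embed M₁ A₁ N₁ inferInstance hM₁
  obtain ⟨φ₂, ψ₂, hφ₂⟩ := embed M₂ A₂ N₂ inferInstance hM₂
  obtain ⟨c, hc⟩ := exists_le_of_average_mean_le hμ (κ₁ := Fin M₁) (κ₂ := Fin M₂) (ε := δ₁ + δ₂)
    (f := fun c => (cloudCode φ₁ φ₂ ψ₁ ψ₂ (fun i => (c i).2.1) (fun i => (c i).2.2) (d₁ c)
      (d₂ c)).errorProb W)
    (e := fun c w₁ w₂ =>
      (∑ y, blockChannel n (receiver W Prod.fst) ((c ((φ₁ w₁).1, (φ₂ w₂).1)).2.1 (φ₁ w₁).2)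
          ((c ((φ₁ w₁).1, (φ₂ w₂).1)).2.2 (φ₂ w₂).2) y *
          (if d₁ c y ≠ (((φ₁ w₁).1, (φ₂ w₂).1), (φ₁ w₁).2, (φ₂ w₂).2) then 1 else 0)) +
        ∑ y, blockChannel n (receiver W Prod.snd) ((c ((φ₁ w₁).1, (φ₂ w₂).1)).2.1 (φ₁ w₁).2)
          ((c ((φ₁ w₁).1, (φ₂ w₂).1)).2.2 (φ₂ w₂).2) y *
          (if d₂ c y ≠ (((φ₁ w₁).1, (φ₂ w₂).1), (φ₁ w₁).2, (φ₂ w₂).2) then 1 else 0))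
    (fun c => by
      simpa only [Fintype.card_fin] using cloudCode_errorProb_le W φ₁ φ₂ ψ₁ ψ₂ hφ₁ hφ₂
        (fun i => (c i).2.1) (fun i => (c i).2.2) (d₁ c) (d₂ c))
    (fun w₁ w₂ => by
      simp only [mul_add, Finset.sum_add_distrib]
      exact add_le_add (h₁ ((φ₁ w₁).1, (φ₂ w₂).1) (φ₁ w₁).2 (φ₂ w₂).2)
        (h₂ ((φ₁ w₁).1, (φ₂ w₂).1) (φ₁ w₁).2 (φ₂ w₂).2))
  obtain ⟨hb₁, hb₂⟩ := cloudCode_withinBudget φ₁ φ₂ ψ₁ ψ₂ (fun i => (c i).2.1)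
    (fun i => (c i).2.2) (d₁ c) (d₂ c) hA₁ hA₂
  exact ⟨_, hb₁, hb₂, hc⟩

/-- **Achievability** with conferencing at the encoders only. -/
theorem achievable_of_rateBounds {Y₁ Y₂ : Type*} [Fintype Y₁] [Fintype Y₂]
    (W : X₁ → X₂ → stdSimplex ℝ (Y₁ × Y₂)) {B₁₂ B₂₁ R₁ R₂ : ℝ} (hB₁₂ : 0 ≤ B₁₂) (hB₂₁ : 0 ≤ B₂₁)
    (hR₁ : 0 ≤ R₁) (hR₂ : 0 ≤ R₂) {m : ℕ} {q : Fin m → ℝ} {a : Fin m → X₁ → ℝ}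
    {b : Fin m → X₂ → ℝ} (hq : q ∈ stdSimplex ℝ (Fin m))
    (ha : ∀ u, a u ∈ stdSimplex ℝ X₁) (hb : ∀ u, b u ∈ stdSimplex ℝ X₂)
    (h₁ : RateBounds q a b (receiver W Prod.fst) 0 (min R₁ B₁₂ + min R₂ B₂₁) (R₁ - min R₁ B₁₂)
      (R₂ - min R₂ B₂₁))
    (h₂ : RateBounds q a b (receiver W Prod.snd) 0 (min R₁ B₁₂ + min R₂ B₂₁) (R₁ - min R₁ B₁₂)
      (R₂ - min R₂ B₂₁)) {l : ℝ} (hl : 0 ≤ l) (hl1 : l < 1) :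
    Achievable W B₁₂ B₂₁ 0 0 (l * R₁) (l * R₂) := by
  classical
  refine ⟨mul_nonneg hl hR₁, mul_nonneg hl hR₂, fun ε hε => ?_⟩
  have hr₁ : 0 ≤ min R₁ B₁₂ := le_min hR₁ hB₁₂
  have hr₂ : 0 ≤ min R₂ B₂₁ := le_min hR₂ hB₂₁
  have hR₁' : 0 ≤ R₁ - min R₁ B₁₂ := sub_nonneg.2 (min_le_left _ _)
  have hR₂' : 0 ≤ R₂ - min R₂ B₂₁ := sub_nonneg.2 (min_le_left _ _)
  -- The threshold exponent is scaled halfway between `l` and `1`: above the rate of the code, and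
  -- below the mean information density.
  have hls : l < (l + 1) / 2 := by linarith
  have hs1 : (l + 1) / 2 < 1 := by linarith
  have hε2 : 0 < ε / 2 := by positivity
  refine Filter.eventually_atTop.1 ?_
  filter_upwards [
    eventually_expected_error_le hq ha hb (receiver_mem W Prod.fst) h₁ hr₁ hr₂ hR₁' hR₂' hl hls hs1
      hε2,
    eventually_expected_error_le hq ha hb (receiver_mem W Prod.snd) h₂ hr₁ hr₂ hR₁' hR₂' hl hls hs1
      hε2,
    eventually_logb_messageCount_le hr₁ hl1 hl (min_le_right R₁ B₁₂),
    eventually_logb_messageCount_le hr₂ hl1 hl (min_le_right R₂ B₂₁)] with n e₁ e₂ c₁ c₂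
  obtain ⟨d₁, e₁⟩ := e₁
  obtain ⟨d₂, e₂⟩ := e₂
  have split : ∀ R r : ℝ, messageCount n (l * R) ≤
      messageCount n (l * r) * messageCount n (l * (R - r)) := by
    intro R r
    have := messageCount_add_le n (l * r) (l * (R - r))
    rwa [← mul_add, add_sub_cancel] at this
  have hμ := blockLaw_mem (ι := Fin (messageCount n (l * min R₁ B₁₂)) ×
    Fin (messageCount n (l * min R₂ B₂₁))) (fun _ => cloudLaw_mem
      (ι₁ := Fin (messageCount n (l * (R₁ - min R₁ B₁₂))))
      (ι₂ := Fin (messageCount n (l * (R₂ - min R₂ B₂₁)))) (blockLaw_mem fun _ : Fin n => hq)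
      (blockCond_mem (n := n) ha) (blockCond_mem (n := n) hb))
  have : NeZero (messageCount n (l * R₁)) := ⟨(messageCount_pos n _).ne'⟩
  have : NeZero (messageCount n (l * R₂)) := ⟨(messageCount_pos n _).ne'⟩
  have hcode := exists_code_of_expected_error_le W c₁ c₂ (split R₁ (min R₁ B₁₂))
    (split R₂ (min R₂ B₂₁)) hμ e₁ e₂
  rw [add_halves] at hcode
  exact hcode

end Achievability

/-- With conferencing at the encoders only, the outer bound is achievable. -/
theorem cmeOuterRegion_subset {X₁ X₂ Y₁ Y₂ : Type*} [Fintype X₁] [Fintype X₂] [Fintype Y₁]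
    [Fintype Y₂] (W : X₁ → X₂ → stdSimplex ℝ (Y₁ × Y₂)) (B₁₂ B₂₁ : ℝ) (hB₁₂ : 0 ≤ B₁₂)
    (hB₂₁ : 0 ≤ B₂₁) : cmeOuterRegion W B₁₂ B₂₁ 0 0 ⊆ capacityRegion W B₁₂ B₂₁ 0 0 := by
  -- The constraint of the receiver that sees both outputs is discarded: the code uses only the
  -- constraints of the two actual decoders.
  rintro ⟨R₁, R₂⟩ ⟨hR₁, hR₂, m, q, a, b, -, h₁, h₂, -⟩
  have hach : ∀ l : ℝ, 0 ≤ l → l < 1 → Achievable W B₁₂ B₂₁ 0 0 (l * R₁) (l * R₂) :=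
    fun l hl hl1 => achievable_of_rateBounds W hB₁₂ hB₂₁ hR₁ hR₂ q.2 (fun u => (a u).2)
      (fun u => (b u).2) ((MACBounds_iff W q a b Prod.fst _ _ _ _).1 h₁)
      ((MACBounds_iff W q a b Prod.snd _ _ _ _).1 h₂) hl hl1
  -- The pair is approached along its ray to the origin by achievable pairs, with scaling factors
  -- below one.
  have hlim : Filter.Tendsto (fun k : ℕ => 1 - 1 / ((k : ℝ) + 1)) Filter.atTop (nhds 1) := by
    simpa using (tendsto_const_nhds (x := (1 : ℝ))).sub tendsto_one_div_add_atTop_nhds_zero_nat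
  have hpair : Filter.Tendsto (fun k : ℕ => ((1 - 1 / ((k : ℝ) + 1)) * R₁,
      (1 - 1 / ((k : ℝ) + 1)) * R₂)) Filter.atTop (nhds (R₁, R₂)) := by
    simpa using (hlim.mul_const R₁).prodMk_nhds (hlim.mul_const R₂)
  refine mem_closure_of_tendsto hpair (Filter.Eventually.of_forall fun k => hach _ ?_ ?_)
  · have hk : 1 / ((k : ℝ) + 1) ≤ 1 :=
      div_le_one_of_le₀ (by linarith [k.cast_nonneg (α := ℝ)]) (by positivity)
    linarith
  · have hk : 0 < 1 / ((k : ℝ) + 1) := by positivity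
    linarith

end CompoundMAC

theorem proposition12 {X₁ X₂ Y₁ Y₂ : Type*} [Fintype X₁] [Fintype X₂] [Fintype Y₁] [Fintype Y₂]
    (W : X₁ → X₂ → stdSimplex ℝ (Y₁ × Y₂)) (B₁₂ B₂₁ C₁₂ C₂₁ : ℝ)
    (hB₁₂ : 0 ≤ B₁₂) (hB₂₁ : 0 ≤ B₂₁) (hC₁₂ : 0 ≤ C₁₂) (hC₂₁ : 0 ≤ C₂₁) :
    CompoundMAC.capacityRegion W B₁₂ B₂₁ C₁₂ C₂₁ ⊆
        CompoundMAC.cmeOuterRegion W B₁₂ B₂₁ C₁₂ C₂₁ ∧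
      CompoundMAC.capacityRegion W B₁₂ B₂₁ 0 0 = CompoundMAC.cmeOuterRegion W B₁₂ B₂₁ 0 0 :=
  ⟨CompoundMAC.capacityRegion_subset W B₁₂ B₂₁ C₁₂ C₂₁ hB₁₂ hB₂₁,
    Set.Subset.antisymm (CompoundMAC.capacityRegion_subset W B₁₂ B₂₁ 0 0 hB₁₂ hB₂₁)
      (CompoundMAC.cmeOuterRegion_subset W B₁₂ B₂₁ hB₁₂ hB₂₁)⟩
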